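/- Let $k$ be a field of characteristic $0$ with algebraic closure $\bar k$, and suppose that $[k(\sqrt{-1},\sqrt2,\sqrt3,\sqrt5):k]=16$. For $K = k$ or $K=\bar k$ let $X_K\subset\mathbb{P}^4_K$ be the closed subscheme defined by $$T_0^2+T_1^2+T_2^2+T_3^2+T_4^2=0,\qquad 2T_0^2+3T_1^2+5T_2^2+7T_3^2+11T_4^2=0,$$ and write $X = X_k$, so that $X_{\bar k}$ is the base change of $X$ to $\bar k$. Then: 1. $X$ is smooth over $k$ of relative dimension $2$, and $X_{\bar k}$ is integral; 2. $X_{\bar k}$ contains exactly $16$ lines of $\mathbb{P}^4_{\bar k}$, and $\mathrm{Gal}(\bar k/k)$ acts transitively on them; 3. $(\operatorname{Pic} X_{\bar k})^{\mathrm{Gal}(\bar k/k)}=\mathbb{Z}\cdot \mathrm{K}_X$, where $\mathrm{K}_X\in\operatorname{Pic}X_{\bar k}$ is the class of the canonical bundle $\bigwedge^2\Omega_{X_{\bar k}/\bar k}$. -/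

import Mathlib

open AlgebraicGeometry CategoryTheory

universe u

/-! ### Grading on the quotient of a graded algebra by a homogeneous ideal -/

namespace GradedQuotient

variable {R A : Type*} [CommRing R] [CommRing A] [Algebra R A]

/-- The induced grading on `A ⧸ I`: the degree `n` part is the image of the degree `n` part. -/
def grading (𝒜 : ℕ → Submodule R A) (I : Ideal A) (n : ℕ) : Submodule R (A ⧸ I) :=
  (𝒜 n).map (Ideal.Quotient.mkₐ R I).toLinearMap

/-- The projection of a graded piece onto the corresponding piece of the quotient. -/
def piece (𝒜 : ℕ → Submodule R A) (I : Ideal A) (n : ℕ) : 𝒜 n →ₗ[R] grading 𝒜 I n :=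
  (Ideal.Quotient.mkₐ R I).toLinearMap.restrict (fun _ hx => Submodule.mem_map_of_mem hx)

theorem piece_coe (𝒜 : ℕ → Submodule R A) (I : Ideal A) (n : ℕ) (x : 𝒜 n) :
    (piece 𝒜 I n x : A ⧸ I) = Ideal.Quotient.mk I (x : A) := rfl

/-- Decomposition of the classes modulo `I`, before passing to the quotient. -/
noncomputable def preDecompose (𝒜 : ℕ → Submodule R A) [GradedAlgebra 𝒜] (I : Ideal A) :
    A →ₗ[R] DirectSum ℕ (fun n => grading 𝒜 I n) :=
  (DirectSum.lmap (piece 𝒜 I)).comp (DirectSum.decomposeLinearEquiv 𝒜).toLinearMap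

theorem preDecompose_apply (𝒜 : ℕ → Submodule R A) [GradedAlgebra 𝒜] (I : Ideal A) (a : A)
    (n : ℕ) : ((preDecompose 𝒜 I a n : grading 𝒜 I n) : A ⧸ I) =
      Ideal.Quotient.mk I (DirectSum.decompose 𝒜 a n : A) := by
  simp only [preDecompose, LinearMap.comp_apply, LinearEquiv.coe_coe,
    DirectSum.decomposeLinearEquiv_apply, DirectSum.lmap_apply, piece_coe]

theorem preDecompose_of_mem (𝒜 : ℕ → Submodule R A) [GradedAlgebra 𝒜] (I : Ideal A)
    (n : ℕ) (a : 𝒜 n) :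
    preDecompose 𝒜 I (a : A) = DirectSum.of (fun n => grading 𝒜 I n) n (piece 𝒜 I n a) := by
  simp only [preDecompose, LinearMap.comp_apply, LinearEquiv.coe_coe,
    DirectSum.decomposeLinearEquiv_apply, DirectSum.decompose_coe]
  exact DirectSum.lmap_lof _ _ _

theorem preDecompose_eq_zero (𝒜 : ℕ → Submodule R A) [GradedAlgebra 𝒜] (I : Ideal A)
    (hI : I.IsHomogeneous 𝒜) (a : A) (ha : a ∈ I) : preDecompose 𝒜 I a = 0 := by
  refine DFinsupp.ext fun n => Subtype.ext ?_
  rw [preDecompose_apply]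
  exact Ideal.Quotient.eq_zero_iff_mem.mpr (hI n ha)

instance (𝒜 : ℕ → Submodule R A) [GradedAlgebra 𝒜] (I : Ideal A) :
    SetLike.GradedMonoid (grading 𝒜 I) where
  one_mem := ⟨1, SetLike.GradedOne.one_mem, map_one (Ideal.Quotient.mkₐ R I)⟩
  mul_mem := by
    rintro i j _ _ ⟨a, ha, rfl⟩ ⟨b, hb, rfl⟩
    exact ⟨a * b, SetLike.GradedMul.mul_mem ha hb, map_mul (Ideal.Quotient.mkₐ R I) a b⟩

/-- The decomposition of the quotient into its graded pieces. -/
noncomputable def quotDecompose (𝒜 : ℕ → Submodule R A) [GradedAlgebra 𝒜] (I : Ideal A)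
    (hI : I.IsHomogeneous 𝒜) : (A ⧸ I) →ₗ[R] DirectSum ℕ (fun n => grading 𝒜 I n) where
  toFun x := Quotient.liftOn' x (preDecompose 𝒜 I) (fun a b h => by
    have hab : a - b ∈ I := (Submodule.quotientRel_def I).mp h
    rw [← sub_add_cancel a b, map_add, preDecompose_eq_zero 𝒜 I hI _ hab, zero_add])
  map_add' x y := by
    obtain ⟨a, rfl⟩ := Ideal.Quotient.mk_surjective x
    obtain ⟨b, rfl⟩ := Ideal.Quotient.mk_surjective y
    exact map_add (preDecompose 𝒜 I) a b
  map_smul' r x := by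
    obtain ⟨a, rfl⟩ := Ideal.Quotient.mk_surjective x
    exact map_smul (preDecompose 𝒜 I) r a

theorem quotDecompose_mk (𝒜 : ℕ → Submodule R A) [GradedAlgebra 𝒜] (I : Ideal A)
    (hI : I.IsHomogeneous 𝒜) (a : A) :
    quotDecompose 𝒜 I hI (Ideal.Quotient.mk I a) = preDecompose 𝒜 I a := rfl

theorem coe_preDecompose (𝒜 : ℕ → Submodule R A) [GradedAlgebra 𝒜] (I : Ideal A) (a : A) :
    DirectSum.coeLinearMap (grading 𝒜 I) (preDecompose 𝒜 I a) = Ideal.Quotient.mk I a := by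
  induction a using DirectSum.Decomposition.inductionOn 𝒜 with
  | zero => rw [map_zero, map_zero, map_zero]
  | homogeneous a =>
    rw [preDecompose_of_mem]
    exact DirectSum.coeLinearMap_of _ _ _
  | add a b ha hb => rw [map_add, map_add, map_add, ha, hb]

/-- The quotient of a graded algebra by a homogeneous ideal is graded. -/
@[reducible] noncomputable def gradedAlgebra (𝒜 : ℕ → Submodule R A) [GradedAlgebra 𝒜]
    (I : Ideal A) (hI : I.IsHomogeneous 𝒜) : GradedAlgebra (grading 𝒜 I) where
  toDecomposition := DirectSum.Decomposition.ofLinearMap _ (quotDecompose 𝒜 I hI)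
    (LinearMap.ext fun x => by
      obtain ⟨a, rfl⟩ := Ideal.Quotient.mk_surjective x
      exact coe_preDecompose 𝒜 I a)
    (DirectSum.linearMap_ext _ fun n => LinearMap.ext fun x => by
      obtain ⟨_, a, ha, rfl⟩ := x
      refine (congrArg (quotDecompose 𝒜 I hI) (DirectSum.coeLinearMap_of _ _ _)).trans ?_
      exact preDecompose_of_mem 𝒜 I n ⟨a, ha⟩)

end GradedQuotient

/-! ### The Picard group of an integral scheme and its canonical class -/

namespace AlgebraicGeometry.Scheme

noncomputable section

/-- The local ring `𝒪_{X,x}`, viewed as a subring of the function field. -/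
def localSubring (X : Scheme.{u}) [IsIntegral X] (x : X) : Subring X.functionField :=
  (algebraMap (X.presheaf.stalk x) X.functionField).range

/-- The unit group `𝒪_{X,x}ˣ`, viewed as a subgroup of the units of the function field. -/
def localUnits (X : Scheme.{u}) [IsIntegral X] (x : X) : Subgroup (X.functionField)ˣ :=
  (Units.map (algebraMap (X.presheaf.stalk x) X.functionField).toMonoidHom).range

/-- The stalk at `x` of the sheaf `𝒦ˣ / 𝒪ˣ`. -/
def CartierStalk (X : Scheme.{u}) [IsIntegral X] (x : X) : Type u :=
  (X.functionField)ˣ ⧸ X.localUnits x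

instance (X : Scheme.{u}) [IsIntegral X] (x : X) : CommGroup (X.CartierStalk x) :=
  inferInstanceAs (CommGroup ((X.functionField)ˣ ⧸ X.localUnits x))

/-- The germ at `x` of the divisor of a nonzero rational function. -/
def germDiv (X : Scheme.{u}) [IsIntegral X] (x : X) : (X.functionField)ˣ →* X.CartierStalk x :=
  QuotientGroup.mk' (X.localUnits x)

/-- The group of Cartier divisors of an integral scheme `X`, i.e. the global sections of the sheaf
`𝒦ˣ / 𝒪ˣ`: families of elements of `K(X)ˣ / 𝒪_{X,x}ˣ` which are locally given by one rational
function. -/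
def cartierDivisors (X : Scheme.{u}) [IsIntegral X] : Subgroup (∀ x : X, X.CartierStalk x) where
  carrier := {D | ∀ x : X, ∃ U : X.Opens, x ∈ U ∧ ∃ f : (X.functionField)ˣ,
    ∀ y ∈ U, D y = X.germDiv y f}
  one_mem' := fun _ => ⟨⊤, trivial, 1, fun y _ => (map_one (X.germDiv y)).symm⟩
  mul_mem' := by
    intro D E hD hE x
    obtain ⟨U, hxU, f, hf⟩ := hD x
    obtain ⟨V, hxV, g, hg⟩ := hE x
    refine ⟨U ⊓ V, ⟨hxU, hxV⟩, f * g, fun y hy => ?_⟩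
    rw [Pi.mul_apply, hf y hy.1, hg y hy.2, map_mul]
  inv_mem' := by
    intro D hD x
    obtain ⟨U, hxU, f, hf⟩ := hD x
    refine ⟨U, hxU, f⁻¹, fun y hy => ?_⟩
    rw [Pi.inv_apply, hf y hy, map_inv]

/-- The principal Cartier divisor of a nonzero rational function. -/
def principalDivisor (X : Scheme.{u}) [IsIntegral X] :
    (X.functionField)ˣ →* X.cartierDivisors where
  toFun f := ⟨fun x => X.germDiv x f, fun _ => ⟨⊤, trivial, f, fun _ _ => rfl⟩⟩
  map_one' := Subtype.ext (funext fun x => map_one (X.germDiv x))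
  map_mul' f g := Subtype.ext (funext fun x => map_mul (X.germDiv x) f g)

/-- The Picard group of an integral scheme, as the group of Cartier divisors modulo principal
ones. It is written multiplicatively; the class of `D` is the class of the invertible sheaf
`𝒪(D)`. -/
def PicardGroup (X : Scheme.{u}) [IsIntegral X] : Type u :=
  X.cartierDivisors ⧸ (principalDivisor X).range

instance (X : Scheme.{u}) [IsIntegral X] : CommGroup X.PicardGroup :=
  inferInstanceAs (CommGroup (X.cartierDivisors ⧸ (principalDivisor X).range))

/-- The class of a Cartier divisor in the Picard group. -/
def divisorClass (X : Scheme.{u}) [IsIntegral X] : X.cartierDivisors →* X.PicardGroup :=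
  QuotientGroup.mk' (principalDivisor X).range

/-- A dominant morphism maps the generic point to a point specializing to the generic point. -/
theorem specializes_genericPoint {X Y : Scheme.{u}} [IsIntegral X] [IsIntegral Y] (f : X ⟶ Y)
    [IsDominant f] : f (genericPoint X) ⤳ genericPoint Y := by
  have h : IsGenericPoint (f (genericPoint X)) Set.univ := by
    have := (genericPoint_spec X).image f.continuous
    rwa [Set.image_univ, f.denseRange.closure_range] at this
  exact h.specializes trivial

/-- The map of function fields `K(Y) → K(X)` induced by a dominant morphism `X ⟶ Y`. -/
def functionFieldMap {X Y : Scheme.{u}} [IsIntegral X] [IsIntegral Y] (f : X ⟶ Y)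
    [IsDominant f] : Y.functionField ⟶ X.functionField :=
  Y.presheaf.stalkSpecializes (specializes_genericPoint f) ≫ f.stalkMap (genericPoint X)

theorem functionFieldMap_algebraMap {X Y : Scheme.{u}} [IsIntegral X] [IsIntegral Y] (f : X ⟶ Y)
    [IsDominant f] (x : X) (a : Y.presheaf.stalk (f x)) :
    (functionFieldMap f).hom (algebraMap _ Y.functionField a) =
      algebraMap (X.presheaf.stalk x) X.functionField ((f.stalkMap x).hom a) := by
  have h : Y.presheaf.stalkSpecializes ((genericPoint_spec Y).specializes trivial) ≫
      functionFieldMap f =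
      f.stalkMap x ≫ X.presheaf.stalkSpecializes ((genericPoint_spec X).specializes trivial) := by
    rw [functionFieldMap, ← Category.assoc, TopCat.Presheaf.stalkSpecializes_comp]
    exact Scheme.Hom.stalkSpecializes_stalkMap f _ _ _
  exact congr($(h).hom a)

theorem localUnits_le_comap {X Y : Scheme.{u}} [IsIntegral X] [IsIntegral Y] (f : X ⟶ Y)
    [IsDominant f] (x : X) : Y.localUnits (f x) ≤
      (X.localUnits x).comap (Units.map (functionFieldMap f).hom.toMonoidHom) := by
  rintro _ ⟨a, rfl⟩
  refine ⟨Units.map (f.stalkMap x).hom.toMonoidHom a, Units.ext ?_⟩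
  exact (functionFieldMap_algebraMap f x (a : Y.presheaf.stalk (f x))).symm

/-- The map `K(Y)ˣ / 𝒪_{Y,f(x)}ˣ → K(X)ˣ / 𝒪_{X,x}ˣ` induced by a dominant morphism `f`. -/
def cartierStalkMap {X Y : Scheme.{u}} [IsIntegral X] [IsIntegral Y] (f : X ⟶ Y)
    [IsDominant f] (x : X) : Y.CartierStalk (f x) →* X.CartierStalk x :=
  QuotientGroup.map _ _ (Units.map (functionFieldMap f).hom.toMonoidHom)
    (localUnits_le_comap f x)

theorem cartierStalkMap_germDiv {X Y : Scheme.{u}} [IsIntegral X] [IsIntegral Y] (f : X ⟶ Y)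
    [IsDominant f] (x : X) (g : (Y.functionField)ˣ) :
    cartierStalkMap f x (Y.germDiv (f x) g) =
      X.germDiv x (Units.map (functionFieldMap f).hom.toMonoidHom g) := rfl

/-- Pullback of Cartier divisors along a dominant morphism. -/
def cartierPullback {X Y : Scheme.{u}} [IsIntegral X] [IsIntegral Y] (f : X ⟶ Y)
    [IsDominant f] : Y.cartierDivisors →* X.cartierDivisors where
  toFun D := ⟨fun x => cartierStalkMap f x (D.1 (f x)), by
    intro x
    obtain ⟨U, hxU, g, hg⟩ := D.2 (f x)
    refine ⟨f ⁻¹ᵁ U, hxU, Units.map (functionFieldMap f).hom.toMonoidHom g, fun y hy => ?_⟩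
    exact (congrArg (cartierStalkMap f y) (hg (f y) hy)).trans (cartierStalkMap_germDiv f y g)⟩
  map_one' := Subtype.ext (funext fun x => map_one (cartierStalkMap f x))
  map_mul' D E := Subtype.ext (funext fun x =>
    map_mul (cartierStalkMap f x) (D.1 (f x)) (E.1 (f x)))

theorem cartierPullback_principal {X Y : Scheme.{u}} [IsIntegral X] [IsIntegral Y] (f : X ⟶ Y)
    [IsDominant f] : (principalDivisor Y).range ≤
      (principalDivisor X).range.comap (cartierPullback f) := by
  rintro _ ⟨g, rfl⟩
  exact ⟨Units.map (functionFieldMap f).hom.toMonoidHom g, Subtype.ext (funext fun x =>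
    (cartierStalkMap_germDiv f x g).symm)⟩

/-- Pullback on Picard groups along a dominant morphism of integral schemes. -/
def picardPullback {X Y : Scheme.{u}} [IsIntegral X] [IsIntegral Y] (f : X ⟶ Y)
    [IsDominant f] : Y.PicardGroup →* X.PicardGroup :=
  QuotientGroup.map _ _ (cartierPullback f) (cartierPullback_principal f)

/-- The ring homomorphism `K → K(X)` for a scheme `X` over `K`. -/
def baseToFunctionField {K : Type u} [CommRing K] {X : Scheme.{u}} [IsIntegral X]
    (s : X ⟶ Spec (.of K)) : K →+* X.functionField :=
  ((Scheme.ΓSpecIso (.of K)).inv ≫ s.appTop ≫ X.presheaf.germ ⊤ (genericPoint X) trivial).hom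

open scoped KaehlerDifferential in
/-- `D` is the divisor of a nonzero rational differential `n`-form `ω` on the integral scheme `X`
over `K`: at every point `x` one has `D = div f` near `x` for some `f` such that `f⁻¹ ω` generates
the `𝒪_{X,x}`-module of `n`-forms regular at `x`, that is, the `𝒪_{X,x}`-span of the forms
`db₁ ∧ ⋯ ∧ dbₙ` with `bᵢ ∈ 𝒪_{X,x}` (the image of `⋀ⁿ Ω_{𝒪_{X,x}/K}`). -/
def IsCanonicalDivisor {K : Type u} [CommRing K] {X : Scheme.{u}} [IsIntegral X]
    (s : X ⟶ Spec (.of K)) (n : ℕ) (D : X.cartierDivisors) : Prop :=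
  letI : Algebra K X.functionField := (baseToFunctionField s).toAlgebra
  ∃ ω : ⋀[X.functionField]^n Ω[X.functionField⁄K], ω ≠ 0 ∧
    ∀ x : X, ∃ f : (X.functionField)ˣ, D.1 x = X.germDiv x f ∧
      Submodule.span (X.localSubring x) {f⁻¹ • ω} =
        Submodule.span (X.localSubring x)
          {η | ∃ b : Fin n → X.functionField, (∀ i, b i ∈ X.localSubring x) ∧
            η = exteriorPower.ιMulti X.functionField n
              (fun i => KaehlerDifferential.D K X.functionField (b i))}

/-- `κ` is the class of the canonical bundle `⋀ⁿ Ω_{X/K}` (for `X` smooth of dimension `n`). -/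
def IsCanonicalClass {K : Type u} [CommRing K] {X : Scheme.{u}} [IsIntegral X]
    (s : X ⟶ Spec (.of K)) (n : ℕ) (κ : X.PicardGroup) : Prop :=
  ∃ D : X.cartierDivisors, IsCanonicalDivisor s n D ∧ κ = X.divisorClass D

end

end AlgebraicGeometry.Scheme

/-! ### The intersection of the two quadrics -/

namespace TwoQuadrics

noncomputable section

open MvPolynomial

attribute [local instance] MvPolynomial.gradedAlgebra

/-- The coefficients of the second quadric. -/
def coeffs : Fin 5 → ℕ := ![2, 3, 5, 7, 11]

/-- The form `T₀² + T₁² + T₂² + T₃² + T₄²`. -/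
def q₁ (K : Type u) [Field K] : MvPolynomial (Fin 5) K := ∑ i, X i ^ 2

/-- The form `2T₀² + 3T₁² + 5T₂² + 7T₃² + 11T₄²`. -/
def q₂ (K : Type u) [Field K] : MvPolynomial (Fin 5) K := ∑ i, C (coeffs i : K) * X i ^ 2

/-- The homogeneous ideal generated by the two forms. -/
def ideal (K : Type u) [Field K] : Ideal (MvPolynomial (Fin 5) K) := Ideal.span {q₁ K, q₂ K}

theorem ideal_isHomogeneous (K : Type u) [Field K] :
    (ideal K).IsHomogeneous (homogeneousSubmodule (Fin 5) K) := by
  apply Ideal.homogeneous_span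
  rintro _ (rfl | rfl)
  · exact ⟨2, IsHomogeneous.sum _ _ _ fun i _ => isHomogeneous_X_pow i 2⟩
  · exact ⟨2, IsHomogeneous.sum _ _ _ fun i _ =>
      (zero_add 2) ▸ (isHomogeneous_C _ _).mul (isHomogeneous_X_pow i 2)⟩

/-- The homogeneous coordinate ring `K[T₀, …, T₄] / (q₁, q₂)`. -/
abbrev CoordRing (K : Type u) [Field K] : Type u := MvPolynomial (Fin 5) K ⧸ ideal K

/-- The grading of the homogeneous coordinate ring by degree. -/
def grading (K : Type u) [Field K] : ℕ → Submodule K (CoordRing K) :=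
  GradedQuotient.grading (homogeneousSubmodule (Fin 5) K) (ideal K)

instance (K : Type u) [Field K] : GradedAlgebra (grading K) :=
  GradedQuotient.gradedAlgebra _ (ideal K) (ideal_isHomogeneous K)

/-- The closed subscheme `q₁ = q₂ = 0` of `ℙ⁴_K`, as `Proj K[T₀, …, T₄] / (q₁, q₂)`. -/
abbrev surface (K : Type u) [Field K] : Scheme.{u} := Proj (grading K)

/-- The structure morphism of the surface. -/
def structureMap (K : Type u) [Field K] : surface K ⟶ Spec (.of K) :=
  Proj.toSpecZero (grading K) ≫ Spec.map (CommRingCat.ofHom (algebraMap K (grading K 0)))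

theorem ideal_le_comap {K : Type u} [Field K] (σ : K ≃+* K) :
    ideal K ≤ (ideal K).comap (MvPolynomial.map (σ : K →+* K)) := by
  rw [ideal, Ideal.span_le]
  rintro _ (rfl | rfl)
  · refine Ideal.subset_span (Or.inl ?_)
    simp [q₁]
  · refine Ideal.subset_span (Or.inr ?_)
    simp [q₂]

/-- A field automorphism acts on the homogeneous coordinate ring through the coefficients,
fixing the classes of the `Tᵢ`. -/
def coordMap {K : Type u} [Field K] (σ : K ≃+* K) : GradedRingHom (grading K) (grading K) where
  toRingHom := Ideal.quotientMap (ideal K) (MvPolynomial.map (σ : K →+* K)) (ideal_le_comap σ)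
  map_mem := by
    rintro n _ ⟨p, hp, rfl⟩
    exact ⟨MvPolynomial.map (σ : K →+* K) p, IsHomogeneous.map hp _, rfl⟩

theorem coordMap_comp {K : Type u} [Field K] (σ τ : K ≃+* K) (h : ∀ a, σ (τ a) = a) :
    (coordMap σ).comp (coordMap τ) = GradedRingHom.id (grading K) := by
  refine DFunLike.ext _ _ fun x => ?_
  obtain ⟨p, rfl⟩ := Ideal.Quotient.mk_surjective x
  change Ideal.Quotient.mk (ideal K) (MvPolynomial.map (σ : K →+* K)
    (MvPolynomial.map (τ : K →+* K) p)) = Ideal.Quotient.mk (ideal K) p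
  rw [MvPolynomial.map_map]
  congr 1
  have : (σ : K →+* K).comp (τ : K →+* K) = RingHom.id K := RingHom.ext h
  rw [this, MvPolynomial.map_id]

theorem irrelevant_le {K : Type u} [Field K] (σ : K ≃+* K) :
    HomogeneousIdeal.irrelevant (grading K) ≤
      (HomogeneousIdeal.irrelevant (grading K)).map (coordMap σ) := by
  intro x hx
  have hxx : coordMap σ (coordMap σ.symm x) = x :=
    DFunLike.congr_fun (coordMap_comp σ σ.symm σ.apply_symm_apply) x
  rw [← hxx]
  refine Ideal.mem_map_of_mem _ ?_
  change GradedRing.proj (grading K) 0 (coordMap σ.symm x) = 0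
  have h0 : GradedRing.proj (grading K) 0 x = 0 := hx
  rw [GradedRing.proj_apply] at h0 ⊢
  rw [← GradedRingHom.map_directSumDecompose, h0, map_zero]

/-- The automorphism of the surface induced by a field automorphism of `K`. -/
def fieldAut {K : Type u} [Field K] (σ : K ≃+* K) : surface K ⟶ surface K :=
  Proj.map (coordMap σ) (irrelevant_le σ)

instance {K : Type u} [Field K] (σ : K ≃+* K) : IsIso (fieldAut σ) := by
  have key : ∀ σ τ : K ≃+* K, (∀ a, σ (τ a) = a) → fieldAut σ ≫ fieldAut τ = 𝟙 _ := by
    intro σ τ h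
    have := Proj.map_comp (coordMap τ) (coordMap σ) (irrelevant_le τ) (irrelevant_le σ)
    refine this.symm.trans ?_
    have hc := coordMap_comp σ τ h
    refine Eq.trans ?_ (Proj.map_id (𝒜 := grading K))
    congr 1
  exact ⟨fieldAut σ.symm, key σ σ.symm σ.apply_symm_apply, key σ.symm σ σ.symm_apply_apply⟩

/-- The lines of `ℙ⁴_K` contained in the surface, as planes `W ⊆ K⁵` on which both forms
vanish. -/
def lines (K : Type u) [Field K] : Set (Submodule K (Fin 5 → K)) :=
  {W | Module.finrank K W = 2 ∧ ∀ v ∈ W, eval v (q₁ K) = 0 ∧ eval v (q₂ K) = 0}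

end

end TwoQuadrics

/-!
A smooth intersection of two quadrics in `ℙ⁴` is a del Pezzo surface of degree four: over an
algebraically closed field it is the projective plane blown up in five points. The proof makes this
explicit for two diagonal quadrics and reads everything off the sixteen lines.

Let `a n` be the coefficients `2, 3, 5, 7, 11` of the second quadric and `d n` the derivative at
`a n` of the polynomial with these roots. After the choice of square roots `c n` of the `d n`
(`Roots`), put `y n = T n / c n`. The power sums `∑ (a n) ^ m * y n`, for `m = 0, 1, 2`, define a
projection `φ` of the surface to the plane, whose inverse `ψ` is given by plane cubics through the
five points with parameters `a n` of the conic `δ = 0` (`ψ_powerSum`, `φ_ψ_T`). So the complement of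
the conic is an open subset of the surface, and changing the signs of the coordinates gives sixteen
such charts, which cover the surface (`chart`, `exists_φ_δ_notMem`). As polynomial rings are
factorial, a function is a unit at a point of a chart as soon as its order along every plane curve
through the point is zero (`PlaneChart.mem_localUnits_of_forall`). Cartier divisors are therefore
determined by their multiplicities along curves, and each is equivalent to one supported on the
sixteen lines of the surface (`exists_supportedOnLines`): the chart without a line `H 0 1 = 0` is an
open subset of the affine plane, on which all divisors are principal.

Lines correspond to sign vectors `ε` up to a common sign, and two different lines meet if and only
if the vectors differ, up to a common sign, in one place. This gives a formula for the intersection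
number `lineDeg` of a line and a divisor supported on the lines. The factorization of the transition
maps between the charts (`conic_sq_sub`, `conic_cube_sub`) provides the divisors of the functions
composed of the conic and of the lines joining two of the five points. It follows that intersection
numbers of principal divisors vanish (`lineDeg_principalDivisor`) and that divisors all of whose
intersection numbers vanish are principal (`SupportedOnLines.exists_principalDivisor_eq`).

The `c n` are monomials in square roots of `-1`, `2`, `3` and `5`. If these generate an extension of
degree `16`, the Galois group realizes all sign vectors with product `1` (`exists_roots_signs`), and
it acts transitively on the lines. An invariant class has the same intersection number with all
lines, and a hyperplane section has intersection number one with each of them, so that the invariant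
class is a multiple of the hyperplane class (`mem_zpowers_of_invariant`). The latter is the inverse
of the canonical class: the residue of the standard form of projective space is a rational form on
the surface whose divisor is minus a hyperplane section (`isCanonicalDivisor_inv_hyperplane`).

The other assertions are more elementary. The coordinate ring embeds into the extension of
`K(T₀, T₁, T₂)` by two square roots, so it is a domain (`ideal_isPrime`). At most two coordinates
vanish at a point of the surface (`exists_three_notMem`), and where three of them do not vanish the
Jacobian criterion applies (`isStandardSmooth_away`). Finally, on a line of the surface all products
`d n * v n * w n` of coordinates of two vectors are values at `a n` of quadratic polynomials
(`eq_of_orthogonal`), which leaves only the sixteen lines given by signs (`exists_eq_lineSpace`).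
-/


/-! ### The function field of `Proj` of a graded domain -/

namespace AlgebraicGeometry.Proj

open HomogeneousLocalization AlgebraicGeometry.ProjectiveSpectrum

variable {K A : Type u} [CommRing K] [CommRing A] [Algebra K A]
  (𝒜 : ℕ → Submodule K A) [GradedAlgebra 𝒜]

instance isPrime_toIdeal (x : Proj 𝒜) : x.asHomogeneousIdeal.toIdeal.IsPrime :=
  _root_.ProjectiveSpectrum.isPrime x

variable [IsDomain A]
noncomputable section

theorem isUnit_algebraMap_primeCompl (I : Ideal A) [I.IsPrime] (y : I.primeCompl) :
    IsUnit (algebraMap A (FractionRing A) y) := by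
  refine isUnit_iff_ne_zero.mpr fun h => y.2 ?_
  rw [(map_eq_zero_iff _ (IsFractionRing.injective A (FractionRing A))).mp h]
  exact zero_mem I

/-- The homogeneous localization at a prime embeds into the field of fractions. -/
def atPrimeToFrac (I : Ideal A) [I.IsPrime] :
    HomogeneousLocalization.AtPrime 𝒜 I →+* FractionRing A :=
  (IsLocalization.lift (S := Localization I.primeCompl) (isUnit_algebraMap_primeCompl I)).comp
    (algebraMap (HomogeneousLocalization.AtPrime 𝒜 I) _)

theorem atPrimeToFrac_mk (I : Ideal A) [I.IsPrime] (c : NumDenSameDeg 𝒜 I.primeCompl) :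
    atPrimeToFrac 𝒜 I (HomogeneousLocalization.mk c) =
      algebraMap A _ (c.num : A) / algebraMap A _ (c.den : A) := by
  simp only [atPrimeToFrac, RingHom.comp_apply]
  rw [HomogeneousLocalization.algebraMap_apply, HomogeneousLocalization.val_mk,
    Localization.mk_eq_mk',
    eq_div_iff (isUnit_algebraMap_primeCompl I ⟨c.den, c.den_mem⟩).ne_zero,
    ← IsLocalization.lift_eq (S := Localization I.primeCompl) (isUnit_algebraMap_primeCompl I)
      (c.den : A), ← map_mul, IsLocalization.mk'_spec, IsLocalization.lift_eq]

theorem atPrimeToFrac_injective (I : Ideal A) [I.IsPrime] :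
    Function.Injective (atPrimeToFrac 𝒜 I) := by
  have h : Function.Injective (IsLocalization.lift (S := Localization I.primeCompl)
      (isUnit_algebraMap_primeCompl I)) := by
    rw [IsLocalization.lift_injective_iff]
    intro x y
    rw [(IsLocalization.injective (Localization I.primeCompl)
      (Ideal.primeCompl_le_nonZeroDivisors I)).eq_iff,
      (IsFractionRing.injective A (FractionRing A)).eq_iff]
  exact h.comp (HomogeneousLocalization.val_injective _)

/-- The embedding of the local ring of `Proj 𝒜` at `x` into the field of fractions of `A`. -/
def stalkToFrac (x : Proj 𝒜) : (Proj 𝒜).presheaf.stalk x →+* FractionRing A :=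
  (atPrimeToFrac 𝒜 x.asHomogeneousIdeal.toIdeal).comp (Proj.stalkIso 𝒜 x).hom.hom

theorem stalkToFrac_stalkIso_inv (x : Proj 𝒜)
    (c : NumDenSameDeg 𝒜 x.asHomogeneousIdeal.toIdeal.primeCompl) :
    stalkToFrac 𝒜 x ((Proj.stalkIso 𝒜 x).inv.hom (HomogeneousLocalization.mk c)) =
      algebraMap A _ (c.num : A) / algebraMap A _ (c.den : A) := by
  simp only [stalkToFrac, RingHom.comp_apply]
  rw [← CommRingCat.comp_apply, Iso.inv_hom_id, CommRingCat.id_apply]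
  exact atPrimeToFrac_mk 𝒜 x.asHomogeneousIdeal.toIdeal c

theorem stalkToFrac_injective (x : Proj 𝒜) : Function.Injective (stalkToFrac 𝒜 x) :=
  (atPrimeToFrac_injective 𝒜 x.asHomogeneousIdeal.toIdeal).comp
    (ConcreteCategory.bijective_of_isIso (Proj.stalkIso 𝒜 x).hom).1

/-- Every element of the local ring at `x` is a homogeneous fraction of degree zero whose
denominator does not vanish at `x`. -/
theorem exists_stalkToFrac_eq (x : Proj 𝒜) (g : (Proj 𝒜).presheaf.stalk x) :
    ∃ n, ∃ a ∈ 𝒜 n, ∃ b ∈ 𝒜 n, b ∉ x.asHomogeneousIdeal ∧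
      stalkToFrac 𝒜 x g = algebraMap A _ a / algebraMap A _ b := by
  obtain ⟨c, hc⟩ := HomogeneousLocalization.mk_surjective ((Proj.stalkIso 𝒜 x).hom.hom g)
  refine ⟨c.deg, c.num, c.num.2, c.den, c.den.2, c.den_mem, ?_⟩
  rw [← stalkToFrac_stalkIso_inv, hc, ← CommRingCat.comp_apply, Iso.hom_inv_id,
    CommRingCat.id_apply]

theorem exists_eq_stalkToFrac (x : Proj 𝒜) {n : ℕ} {a b : A} (ha : a ∈ 𝒜 n) (hb : b ∈ 𝒜 n)
    (hbx : b ∉ x.asHomogeneousIdeal) :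
    ∃ g, stalkToFrac 𝒜 x g = algebraMap A _ a / algebraMap A _ b :=
  ⟨_, stalkToFrac_stalkIso_inv 𝒜 x ⟨n, ⟨a, ha⟩, ⟨b, hb⟩, hbx⟩⟩

theorem stalkToFrac_germ (U : (Proj 𝒜).Opens) (x : Proj 𝒜) (hx : x ∈ U)
    (s : Γ(Proj 𝒜, U))
    (c : NumDenSameDeg 𝒜 x.asHomogeneousIdeal.toIdeal.primeCompl)
    (h : (s : (Proj.structureSheaf 𝒜).1.obj (Opposite.op U)).1 ⟨x, hx⟩ =
      HomogeneousLocalization.mk c) :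
    stalkToFrac 𝒜 x ((Proj 𝒜).presheaf.germ U x hx s) =
      algebraMap A _ (c.num : A) / algebraMap A _ (c.den : A) := by
  have h1 : (Proj.stalkIso 𝒜 x).hom.hom ((Proj 𝒜).presheaf.germ U x hx s) = .mk c := by
    rw [← h]
    exact Proj.stalkIso'_germ 𝒜 U x hx s
  rw [← stalkToFrac_stalkIso_inv, ← h1, ← CommRingCat.comp_apply, Iso.hom_inv_id,
    CommRingCat.id_apply]

theorem stalkToFrac_stalkSpecializes {x y : Proj 𝒜} (h : y ⤳ x)
    (g : (Proj 𝒜).presheaf.stalk x) :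
    stalkToFrac 𝒜 y (((Proj 𝒜).presheaf.stalkSpecializes h).hom g) = stalkToFrac 𝒜 x g := by
  obtain ⟨U, hxU, s, rfl⟩ := (Proj 𝒜).presheaf.exists_germ_eq g
  obtain ⟨V, hxV, i, n, a, b, hV, e⟩ := s.2 ⟨x, hxU⟩
  have hyV : y ∈ V := h.mem_open V.2 hxV
  have hyU : y ∈ U := h.mem_open U.2 hxU
  have h1 := stalkToFrac_germ 𝒜 U x hxU s ⟨n, a, b, hV ⟨x, hxV⟩⟩ (e ⟨x, hxV⟩)
  have h2 := stalkToFrac_germ 𝒜 U y hyU s ⟨n, a, b, hV ⟨y, hyV⟩⟩ (e ⟨y, hyV⟩)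
  refine Eq.trans ?_ (h2.trans h1.symm)
  congr 1
  exact TopCat.Presheaf.germ_stalkSpecializes_apply (X := (Proj 𝒜).toTopCat) (C := CommRingCat)
    (Proj 𝒜).presheaf _ h s

omit [IsDomain A] in
theorem specializes_iff {x y : Proj 𝒜} :
    y ⤳ x ↔ y.asHomogeneousIdeal ≤ x.asHomogeneousIdeal := by
  rw [specializes_iff_mem_closure]
  exact (ProjectiveSpectrum.le_iff_mem_closure 𝒜 y x).symm

instance : IsReduced (Proj 𝒜) := by
  have : ∀ x : Proj 𝒜, _root_.IsReduced ((Proj 𝒜).presheaf.stalk x) := fun x =>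
    isReduced_of_injective (stalkToFrac 𝒜 x) (stalkToFrac_injective 𝒜 x)
  exact isReduced_of_isReduced_stalk _

/-- The generic point of `Proj` of a graded domain. -/
def zeroPoint (h : (HomogeneousIdeal.irrelevant 𝒜) ≠ ⊥) : Proj 𝒜 where
  asHomogeneousIdeal := ⊥
  isPrime := by
    rw [HomogeneousIdeal.toIdeal_bot]; exact Ideal.isPrime_bot
  not_irrelevant_le h' := h (le_bot_iff.mp h')

/-- The zero ideal is a generic point of `Proj 𝒜`, and the local rings are domains because they
embed into the field of fractions. -/
theorem isIntegral_of_irrelevant_ne_bot (h : (HomogeneousIdeal.irrelevant 𝒜) ≠ ⊥) :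
    IsIntegral (Proj 𝒜) := by
  have : IrreducibleSpace (Proj 𝒜) := by
    have : IsIrreducible (Set.univ : Set (Proj 𝒜)) := by
      have h1 := isIrreducible_singleton (x := zeroPoint 𝒜 h).closure
      convert h1
      refine (Set.eq_univ_of_forall fun x => ?_).symm
      rw [← specializes_iff_mem_closure, specializes_iff]
      exact bot_le
    exact (irreducibleSpace_def _).mpr this
  exact isIntegral_of_irreducibleSpace_of_isReduced _

variable [IsIntegral (Proj 𝒜)]

theorem genericPoint_asHomogeneousIdeal (h : (HomogeneousIdeal.irrelevant 𝒜) ≠ ⊥) :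
    (genericPoint (Proj 𝒜)).asHomogeneousIdeal = ⊥ := by
  have h1 : genericPoint (Proj 𝒜) ⤳ zeroPoint 𝒜 h := (genericPoint_spec _).specializes trivial
  exact le_bot_iff.mp ((specializes_iff 𝒜).mp h1)

/-- The embedding of the function field of `Proj 𝒜` into the field of fractions of `A`. -/
def toFrac : (Proj 𝒜).functionField →+* FractionRing A := stalkToFrac 𝒜 (genericPoint _)

theorem toFrac_injective : Function.Injective (toFrac 𝒜) := stalkToFrac_injective 𝒜 _

theorem toFrac_algebraMap (x : Proj 𝒜) (g : (Proj 𝒜).presheaf.stalk x) :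
    toFrac 𝒜 (algebraMap _ _ g) = stalkToFrac 𝒜 x g :=
  stalkToFrac_stalkSpecializes 𝒜 _ g

/-- The local ring at `x`, inside the function field, consists of the fractions `a / b` with `a`
and `b` homogeneous of the same degree and `b` not vanishing at `x`. -/
theorem mem_localSubring_iff (x : Proj 𝒜) (g : (Proj 𝒜).functionField) :
    g ∈ (Proj 𝒜).localSubring x ↔ ∃ n, ∃ a ∈ 𝒜 n, ∃ b ∈ 𝒜 n, b ∉ x.asHomogeneousIdeal ∧
      toFrac 𝒜 g = algebraMap A _ a / algebraMap A _ b := by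
  constructor
  · rintro ⟨g, rfl⟩
    rw [toFrac_algebraMap]
    exact exists_stalkToFrac_eq 𝒜 x g
  · rintro ⟨n, a, ha, b, hb, hbx, h⟩
    obtain ⟨g', hg'⟩ := exists_eq_stalkToFrac 𝒜 x ha hb hbx
    refine ⟨g', toFrac_injective 𝒜 ?_⟩
    rw [toFrac_algebraMap, hg', h]

theorem exists_toFrac_eq (g : (Proj 𝒜).functionField) : ∃ n, ∃ a ∈ 𝒜 n, ∃ b ∈ 𝒜 n, b ≠ 0 ∧
    toFrac 𝒜 g = algebraMap A _ a / algebraMap A _ b := by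
  obtain ⟨n, a, ha, b, hb, hbx, h⟩ := exists_stalkToFrac_eq 𝒜 (genericPoint _) g
  exact ⟨n, a, ha, b, hb, fun h0 => hbx (h0 ▸ zero_mem _), h⟩

theorem exists_eq_toFrac (hirr : (HomogeneousIdeal.irrelevant 𝒜) ≠ ⊥) {n : ℕ} {a b : A}
    (ha : a ∈ 𝒜 n) (hb : b ∈ 𝒜 n) (hb0 : b ≠ 0) :
    ∃ g, toFrac 𝒜 g = algebraMap A _ a / algebraMap A _ b := by
  refine exists_eq_stalkToFrac 𝒜 _ ha hb ?_
  rw [genericPoint_asHomogeneousIdeal 𝒜 hirr]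
  exact hb0

/-- The units of the local ring at `x`: fractions of homogeneous elements not vanishing at `x`. -/
theorem mem_localUnits_iff (x : Proj 𝒜) (g : (Proj 𝒜).functionFieldˣ) :
    g ∈ (Proj 𝒜).localUnits x ↔ ∃ n, ∃ a ∈ 𝒜 n, ∃ b ∈ 𝒜 n, a ∉ x.asHomogeneousIdeal ∧
      b ∉ x.asHomogeneousIdeal ∧ toFrac 𝒜 g = algebraMap A _ a / algebraMap A _ b := by
  have hne : ∀ {b : A}, b ∉ x.asHomogeneousIdeal → algebraMap A (FractionRing A) b ≠ 0 := by
    intro b hb h0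
    rw [map_eq_zero_iff _ (IsFractionRing.injective A (FractionRing A))] at h0
    exact hb (h0 ▸ zero_mem _)
  constructor
  · rintro ⟨u, rfl⟩
    obtain ⟨n, a, ha, b, hb, hbx, h⟩ := exists_stalkToFrac_eq 𝒜 x (u : _)
    obtain ⟨m, c, hc, d, hd, hdx, h'⟩ := exists_stalkToFrac_eq 𝒜 x ((u⁻¹ : _ˣ) : _)
    refine ⟨n, a, ha, b, hb, ?_, hbx, ?_⟩
    · have h1 : stalkToFrac 𝒜 x u * stalkToFrac 𝒜 x (u⁻¹ : _ˣ) = 1 := by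
        rw [← map_mul, Units.mul_inv, map_one]
      rw [h, h', div_mul_div_comm, div_eq_one_iff_eq (mul_ne_zero (hne hbx) (hne hdx)),
        ← map_mul, ← map_mul] at h1
      have h2 := IsFractionRing.injective A (FractionRing A) h1
      intro hax
      have h3 : b * d ∈ x.asHomogeneousIdeal.toIdeal := h2 ▸ Ideal.mul_mem_right _ _ hax
      exact ((isPrime_toIdeal 𝒜 x).mem_or_mem h3).elim hbx hdx
    · rw [← h]
      exact toFrac_algebraMap 𝒜 x _
  · rintro ⟨n, a, ha, b, hb, hax, hbx, h⟩
    obtain ⟨g', hg'⟩ := exists_eq_stalkToFrac 𝒜 x ha hb hbx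
    obtain ⟨g'', hg''⟩ := exists_eq_stalkToFrac 𝒜 x hb ha hax
    have h1 : g' * g'' = 1 := by
      apply stalkToFrac_injective 𝒜 x
      rw [map_mul, hg', hg'', map_one, div_mul_div_cancel₀ (hne hbx), div_self (hne hax)]
    refine ⟨⟨g', g'', h1, mul_comm g' g'' ▸ h1⟩, Units.ext (toFrac_injective 𝒜 ?_)⟩
    exact (toFrac_algebraMap 𝒜 x g').trans (hg'.trans h.symm)

end
end AlgebraicGeometry.Proj

/-! ### Rational functions under graded maps -/

namespace AlgebraicGeometry.Proj

open HomogeneousLocalization AlgebraicGeometry.ProjectiveSpectrum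

variable {K A : Type u} [CommRing K] [CommRing A] [Algebra K A]
  (𝒜 : ℕ → Submodule K A) [GradedAlgebra 𝒜] [IsDomain A]

/-- The map of local rings induced by a graded homomorphism `f` applies `f` to numerators and
denominators. -/
theorem stalkToFrac_stalkMap (f : GradedRingHom 𝒜 𝒜)
    (hf : HomogeneousIdeal.irrelevant 𝒜 ≤ (HomogeneousIdeal.irrelevant 𝒜).map f)
    (F : FractionRing A →+* FractionRing A)
    (hF : ∀ a, F (algebraMap A _ a) = algebraMap A _ (f a)) (x : Proj 𝒜)
    (g : (Proj 𝒜).presheaf.stalk ((Proj.map f hf) x)) :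
    stalkToFrac 𝒜 x (((Proj.map f hf).stalkMap x).hom g) =
      F (stalkToFrac 𝒜 (Proj.map f hf x) g) := by
  have key := congr($(Proj.localRingHom_comp_stalkIso f hf x).hom g)
  have h1 : ((Proj.map f hf).stalkMap x).hom g =
    ((Proj.sheafedSpaceMap f hf).hom.stalkMap x).hom g := rfl
  rw [h1]
  refine (congrArg (stalkToFrac 𝒜 x) key.symm).trans ?_
  obtain ⟨c, hc⟩ := HomogeneousLocalization.mk_surjective
    ((Proj.stalkIso 𝒜 ((Proj.map f hf) x)).hom.hom g)
  have h2 : stalkToFrac 𝒜 (Proj.map f hf x) g =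
      algebraMap A _ (c.num : A) / algebraMap A _ (c.den : A) := by
    rw [← stalkToFrac_stalkIso_inv, hc, ← CommRingCat.comp_apply, Iso.hom_inv_id,
      CommRingCat.id_apply]
  rw [h2, map_div₀, hF, hF]
  refine Eq.trans ?_ (stalkToFrac_stalkIso_inv 𝒜 x
    ⟨c.deg, ⟨f c.num, f.2 c.num.2⟩, ⟨f c.den, f.2 c.den.2⟩, c.den_mem⟩)
  refine congrArg (fun z => stalkToFrac 𝒜 x ((Proj.stalkIso 𝒜 x).inv.hom z)) ?_
  refine (congrArg (HomogeneousLocalization.localRingHom f _ _ rfl) hc.symm).trans ?_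
  rfl

theorem toFrac_functionFieldMap [IsIntegral (Proj 𝒜)] (f : GradedRingHom 𝒜 𝒜)
    (hf : HomogeneousIdeal.irrelevant 𝒜 ≤ (HomogeneousIdeal.irrelevant 𝒜).map f)
    [IsDominant (Proj.map f hf)] (F : FractionRing A →+* FractionRing A)
    (hF : ∀ a, F (algebraMap A _ a) = algebraMap A _ (f a)) (g : (Proj 𝒜).functionField) :
    toFrac 𝒜 ((Scheme.functionFieldMap (Proj.map f hf)).hom g) = F (toFrac 𝒜 g) := by
  rw [Scheme.functionFieldMap, CommRingCat.hom_comp, RingHom.comp_apply, toFrac,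
    stalkToFrac_stalkMap 𝒜 f hf F hF]
  congr 1
  exact stalkToFrac_stalkSpecializes 𝒜 _ g

/-- For an open subset equal to `⊤`, the global sections of the associated open subscheme are
identified with `Γ(X, ⊤)` in two ways, which agree. -/
theorem topIso_inv_appTop_of_eq_top (X : Scheme.{u}) {U : X.Opens} (e : U = ⊤) :
    U.topIso.inv ≫ ((Scheme.topIso X).inv ≫ (X.isoOfEq e).inv).appTop =
      X.presheaf.map (eqToHom e.symm).op := by
  subst e
  rw [Iso.inv_comp_eq]
  have : (X.isoOfEq (rfl : (⊤ : X.Opens) = ⊤)).inv = 𝟙 _ := by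
    rw [← cancel_mono (Scheme.Opens.ι _)]; simp
  rw [this]
  have h3 : (Scheme.topIso X).hom.appTop ≫ (Scheme.topIso X).inv.appTop = 𝟙 _ := by
    rw [← Scheme.Hom.comp_appTop, Iso.inv_hom_id, Scheme.Hom.id_appTop]
  have h4 : ((⊤ : X.Opens).topIso.hom ≫ X.presheaf.map (eqToHom rfl).op) ≫
      (Scheme.topIso X).hom.appTop = 𝟙 _ := by
    rw [Scheme.topIso_hom, Scheme.Opens.topIso_hom, Scheme.Opens.ι_appTop]
    exact (congrArg (· ≫ _) (X.presheaf.map_comp _ _).symm).trans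
      ((X.presheaf.map_comp _ _).symm.trans (X.presheaf.map_id _))
  rw [Category.comp_id]
  refine (Category.id_comp _).symm.trans ?_
  rw [← h4, Category.assoc, h3, Category.comp_id]

omit [IsDomain A] in
theorem toSpecZero_appTop : (Scheme.ΓSpecIso (.of (𝒜 0))).inv ≫ (Proj.toSpecZero 𝒜).appTop =
    CommRingCat.ofHom (fromZeroRingHom 𝒜 _) ≫ Proj.awayToSection 𝒜 1 ≫
      (Proj 𝒜).presheaf.map (eqToHom (Proj.basicOpen_one 𝒜).symm).op := by
  have h : (Proj.basicOpenToSpec 𝒜 1).appTop = _ := basicOpenToSpec_app_top 𝒜 1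
  have h2 := topIso_inv_appTop_of_eq_top (Proj 𝒜) (Proj.basicOpen_one 𝒜)
  rw [← h2, toSpecZero, ← Category.assoc (Iso.inv _), Scheme.Hom.comp_appTop (_ ≫ _),
    Scheme.Hom.comp_appTop (basicOpenToSpec 𝒜 1), h]
  generalize ((Scheme.topIso _).inv ≫ _).appTop = r
  simp only [Category.assoc]
  rw [← Scheme.ΓSpecIso_inv_naturality_assoc, Iso.inv_hom_id_assoc]

/-- A scalar of degree zero, pulled back along the structure morphism, is the constant rational
function given by the scalar. -/
theorem toFrac_germ_toSpecZero [IsIntegral (Proj 𝒜)] (c : 𝒜 0)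
    (hη : genericPoint (Proj 𝒜) ∈ (⊤ : (Proj 𝒜).Opens)) :
    toFrac 𝒜 (((Scheme.ΓSpecIso (.of (𝒜 0))).inv ≫ (Proj.toSpecZero 𝒜).appTop ≫
      (Proj 𝒜).presheaf.germ ⊤ (genericPoint (Proj 𝒜)) hη).hom c) =
      algebraMap A _ (c : A) := by
  rw [← Category.assoc, toSpecZero_appTop, Category.assoc, Category.assoc,
    TopCat.Presheaf.germ_res]
  have h := stalkToFrac_germ 𝒜 (Proj.basicOpen 𝒜 1) (genericPoint (Proj 𝒜))
    (by rw [Proj.basicOpen_one]; exact hη)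
    ((CommRingCat.ofHom (fromZeroRingHom 𝒜 _) ≫ Proj.awayToSection 𝒜 1).hom c)
    ⟨0, c, ⟨1, SetLike.GradedOne.one_mem⟩, Submonoid.one_mem _⟩ rfl
  refine Eq.trans h ?_
  simp

end AlgebraicGeometry.Proj

/-! ### The homogeneous coordinate ring is a domain -/

namespace TwoQuadrics

open MvPolynomial

section Domain

variable {K : Type u} [Field K] [CharZero K]

/-- The restriction of a ternary form to the affine line `T₀ = 1`, `T₂ = 0`. -/
noncomputable def toLine : MvPolynomial (Fin 3) K →ₐ[K] Polynomial K :=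
  aeval ![1, Polynomial.X, 0]

omit [CharZero K] in
/-- A polynomial which is a square of a rational function is the square of a polynomial, and so is
its restriction to a line: all roots of the restriction are multiple. -/
theorem eval_derivative_eq_zero_of_isSquare {G : MvPolynomial (Fin 3) K}
    (h : IsSquare (algebraMap _ (FractionRing (MvPolynomial (Fin 3) K)) G)) {t : K}
    (ht : (toLine G).eval t = 0) : (toLine G).derivative.eval t = 0 := by
  obtain ⟨r, hr⟩ := h
  have hint : IsIntegral (MvPolynomial (Fin 3) K) (r ^ 2) := by
    rw [sq, ← hr]; exact isIntegral_algebraMap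
  obtain ⟨s, rfl⟩ := IsIntegrallyClosed.algebraMap_eq_of_integral (hint.of_pow two_pos)
  rw [← map_mul, (IsFractionRing.injective _ _).eq_iff] at hr
  rw [hr, map_mul, Polynomial.eval_mul, mul_self_eq_zero] at ht
  rw [hr, map_mul, Polynomial.derivative_mul]
  simp [ht]

/-- On the surface, `T₃² = quad₃(T₀, T₁, T₂)`. -/
noncomputable def quad₃ (K : Type u) [Field K] : MvPolynomial (Fin 3) K :=
  -C 4⁻¹ * (C 9 * X 0 ^ 2 + C 8 * X 1 ^ 2 + C 6 * X 2 ^ 2)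

/-- On the surface, `T₄² = quad₄(T₀, T₁, T₂)`. -/
noncomputable def quad₄ (K : Type u) [Field K] : MvPolynomial (Fin 3) K :=
  C 4⁻¹ * (C 5 * X 0 ^ 2 + C 4 * X 1 ^ 2 + C 2 * X 2 ^ 2)

omit [CharZero K] in
theorem toLine_quad₃ : toLine (quad₃ K) =
    -Polynomial.C 4⁻¹ * (Polynomial.C 9 + Polynomial.C 8 * Polynomial.X ^ 2) := by
  simp only [toLine, quad₃, map_mul, map_add, map_neg, map_pow, aeval_X, algHom_C,
    Polynomial.algebraMap_eq]
  simp

omit [CharZero K] in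
theorem toLine_quad₄ : toLine (quad₄ K) =
    Polynomial.C 4⁻¹ * (Polynomial.C 5 + Polynomial.C 4 * Polynomial.X ^ 2) := by
  simp only [toLine, quad₄, map_mul, map_add, map_pow, aeval_X, algHom_C,
    Polynomial.algebraMap_eq]
  simp

variable [IsAlgClosed K]

theorem not_isSquare_quad₃ :
    ¬ IsSquare (algebraMap _ (FractionRing (MvPolynomial (Fin 3) K)) (quad₃ K)) := by
  intro h
  obtain ⟨t, ht⟩ := IsAlgClosed.exists_pow_nat_eq (-(9 / 8) : K) two_pos
  have h0 : (t : K) ≠ 0 := by rintro rfl; norm_num at ht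
  have := eval_derivative_eq_zero_of_isSquare h (t := t) (by
    rw [toLine_quad₃]; simp [ht]; norm_num)
  rw [toLine_quad₃] at this
  simp [h0] at this

theorem not_isSquare_quad₄ :
    ¬ IsSquare (algebraMap _ (FractionRing (MvPolynomial (Fin 3) K)) (quad₄ K)) := by
  intro h
  obtain ⟨t, ht⟩ := IsAlgClosed.exists_pow_nat_eq (-(5 / 4) : K) two_pos
  have h0 : (t : K) ≠ 0 := by rintro rfl; norm_num at ht
  have := eval_derivative_eq_zero_of_isSquare h (t := t) (by
    rw [toLine_quad₄]; simp [ht]; norm_num)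
  rw [toLine_quad₄] at this
  simp [h0] at this

theorem not_isSquare_quad₃_mul_quad₄ :
    ¬ IsSquare (algebraMap _ (FractionRing (MvPolynomial (Fin 3) K)) (quad₃ K * quad₄ K)) := by
  intro h
  obtain ⟨t, ht⟩ := IsAlgClosed.exists_pow_nat_eq (-(5 / 4) : K) two_pos
  have h0 : (t : K) ≠ 0 := by rintro rfl; norm_num at ht
  have := eval_derivative_eq_zero_of_isSquare h (t := t) (by
    rw [map_mul, toLine_quad₄]; simp [ht]; right; norm_num)
  rw [map_mul, toLine_quad₄, toLine_quad₃] at this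
  simp [ht] at this
  norm_num at this
  exact h0 this

/-- If none of `P`, `Q`, `PQ` is a square in a field, then `1, √P, √Q, √P√Q` are linearly
independent over it. -/
theorem eq_zero_of_add_sqrt_eq_zero {F L : Type*} [Field F] [Field L] [Algebra F L] {P Q : F}
    (hP : ¬ IsSquare P) (hQ : ¬ IsSquare Q) (hPQ : ¬ IsSquare (P * Q)) (h2 : (2 : F) ≠ 0) {p q : L}
    (hp : p ^ 2 = algebraMap F L P) (hq : q ^ 2 = algebraMap F L Q) {a b c d : F}
    (h : algebraMap F L a + algebraMap F L b * p + algebraMap F L c * q +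
      algebraMap F L d * p * q = 0) : a = 0 ∧ b = 0 ∧ c = 0 ∧ d = 0 := by
  have inj := (algebraMap F L).injective
  have key : ∀ a b : F, algebraMap F L a + algebraMap F L b * p = 0 → a = 0 ∧ b = 0 := by
    intro a b hab
    by_cases hb : b = 0
    · subst hb
      simpa using hab
    · refine absurd ⟨a / b, inj ?_⟩ hP
      have hb' : algebraMap F L b ≠ 0 := (map_ne_zero _).mpr hb
      have : p = - (algebraMap F L (a / b)) := by
        rw [map_div₀]; field_simp; linear_combination hab
      rw [← hp, this, map_mul]; ring
  by_cases hcd : algebraMap F L c + algebraMap F L d * p = 0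
  · obtain ⟨rfl, rfl⟩ := key c d hcd
    obtain ⟨rfl, rfl⟩ := key a b (by simpa using h)
    simp
  · exfalso
    have hN : c ^ 2 - d ^ 2 * P ≠ 0 := by
      intro hN
      have h1 : (algebraMap F L c + algebraMap F L d * p) *
          (algebraMap F L c + algebraMap F L (-d) * p) = 0 := by
        have := congrArg (algebraMap F L) hN
        simp only [map_sub, map_mul, map_pow, map_zero] at this
        rw [map_neg]
        linear_combination this - algebraMap F L d ^ 2 * hp
      obtain ⟨rfl, h3⟩ := key _ _ ((mul_eq_zero.mp h1).resolve_left hcd)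
      rw [neg_eq_zero] at h3
      subst h3
      simp at hcd
    have hN' : algebraMap F L (c ^ 2 - d ^ 2 * P) ≠ 0 := (map_ne_zero _).mpr hN
    obtain ⟨e, f, hq'⟩ : ∃ e f : F, q = algebraMap F L e + algebraMap F L f * p := by
      refine ⟨-(a * c - b * d * P) / (c ^ 2 - d ^ 2 * P), -(b * c - a * d) / (c ^ 2 - d ^ 2 * P),
        ?_⟩
      rw [map_div₀, map_div₀]
      field_simp
      simp only [map_sub, map_mul, map_pow, map_neg]
      linear_combination (algebraMap F L c - algebraMap F L d * p) * h +
        (algebraMap F L d ^ 2 * q + algebraMap F L b * algebraMap F L d) * hp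
    have h3 : algebraMap F L (e ^ 2 + f ^ 2 * P - Q) + algebraMap F L (2 * e * f) * p = 0 := by
      simp only [map_sub, map_mul, map_pow, map_add, map_ofNat]
      rw [hq'] at hq
      linear_combination hq - algebraMap F L f ^ 2 * hp
    obtain ⟨h4, h5⟩ := key _ _ h3
    rcases mul_eq_zero.mp h5 with h6 | rfl
    · obtain rfl := (mul_eq_zero.mp h6).resolve_left h2
      exact hPQ ⟨f * P, by linear_combination -P * h4⟩
    · exact hQ ⟨e, by linear_combination -h4⟩

omit [IsAlgClosed K] in
theorem C_quarter_mul {σ : Type*} : (C 4⁻¹ : MvPolynomial σ K) * 4 = 1 := by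
  rw [← map_ofNat C 4, ← C_mul, ← C_1]
  norm_num

/-- The inclusion `K[T₀, T₁, T₂] → K[T₀, …, T₄]`. -/
noncomputable def incl (K : Type u) [Field K] :
    MvPolynomial (Fin 3) K →ₐ[K] MvPolynomial (Fin 5) K :=
  rename (Fin.castLE (by norm_num))

omit [CharZero K] [IsAlgClosed K] in
theorem incl_X (i : Fin 3) : incl K (X i) = X (Fin.castLE (by norm_num) i) := rename_X _ _

omit [IsAlgClosed K] in
/-- The two equations solved for `T₃²`. -/
theorem X_three_sq_sub_mem : (X 3 ^ 2 - incl K (quad₃ K) : MvPolynomial (Fin 5) K) ∈ ideal K := by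
  have : (X 3 ^ 2 - incl K (quad₃ K) : MvPolynomial (Fin 5) K) =
      (C 4⁻¹ * 11) * q₁ K + (-C 4⁻¹) * q₂ K := by
    simp only [quad₃, q₁, q₂, Fin.sum_univ_five, coeffs, map_mul, map_add, map_pow, incl_X,
      map_neg, map_ofNat, algHom_C, algebraMap_eq]
    simp only [Fin.castLE, Matrix.cons_val, Nat.cast_ofNat, map_ofNat]
    simp
    linear_combination (-X 3 ^ 2) * C_quarter_mul (K := K) (σ := Fin 5)
  rw [this]
  exact Ideal.add_mem _ (Ideal.mul_mem_left _ _ (Ideal.subset_span (by simp)))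
    (Ideal.mul_mem_left _ _ (Ideal.subset_span (by simp)))

omit [IsAlgClosed K] in
/-- The two equations solved for `T₄²`. -/
theorem X_four_sq_sub_mem : (X 4 ^ 2 - incl K (quad₄ K) : MvPolynomial (Fin 5) K) ∈ ideal K := by
  have : (X 4 ^ 2 - incl K (quad₄ K) : MvPolynomial (Fin 5) K) =
      (-C 4⁻¹ * 7) * q₁ K + (C 4⁻¹) * q₂ K := by
    simp only [quad₄, q₁, q₂, Fin.sum_univ_five, coeffs, map_mul, map_add, map_pow, incl_X,
      map_ofNat, algHom_C, algebraMap_eq]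
    simp only [Fin.castLE, Matrix.cons_val, Nat.cast_ofNat, map_ofNat]
    simp
    linear_combination (-X 4 ^ 2) * C_quarter_mul (K := K) (σ := Fin 5)
  rw [this]
  exact Ideal.add_mem _ (Ideal.mul_mem_left _ _ (Ideal.subset_span (by simp)))
    (Ideal.mul_mem_left _ _ (Ideal.subset_span (by simp)))

omit [IsAlgClosed K] in
/-- Modulo the two quadrics every polynomial is a combination of `1, T₃, T₄, T₃T₄` with
coefficients in `K[T₀, T₁, T₂]`. -/
theorem exists_normalForm (f : MvPolynomial (Fin 5) K) :
    ∃ a b c d : MvPolynomial (Fin 3) K,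
      f - (incl K a + incl K b * X 3 + incl K c * X 4 + incl K d * X 3 * X 4) ∈ ideal K := by
  induction f using MvPolynomial.induction_on with
  | C r => exact ⟨C r, 0, 0, 0, by simp [incl]⟩
  | add f g hf hg =>
    obtain ⟨a, b, c, d, h⟩ := hf
    obtain ⟨a', b', c', d', h'⟩ := hg
    refine ⟨a + a', b + b', c + c', d + d', ?_⟩
    convert Ideal.add_mem _ h h' using 1
    simp only [map_add]
    ring
  | mul_X f i hf =>
    obtain ⟨a, b, c, d, h⟩ := hf
    have h1 := Ideal.mul_mem_right (X i) _ h
    have hlow : ∀ j : Fin 3, i = Fin.castLE (by norm_num) j → ∃ a b c d : MvPolynomial (Fin 3) K,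
        f * X i - (incl K a + incl K b * X 3 + incl K c * X 4 + incl K d * X 3 * X 4)
          ∈ ideal K := by
      rintro j rfl
      refine ⟨a * X j, b * X j, c * X j, d * X j, ?_⟩
      convert h1 using 1
      simp only [map_mul, incl_X]
      ring
    fin_cases i
    · exact hlow 0 rfl
    · exact hlow 1 rfl
    · exact hlow 2 rfl
    · refine ⟨b * quad₃ K, a, d * quad₃ K, c, ?_⟩
      convert Ideal.add_mem _ h1 (Ideal.mul_mem_left _ (incl K b + incl K d * X 4)
        X_three_sq_sub_mem) using 1
      simp only [map_mul, Fin.reduceFinMk]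
      ring
    · refine ⟨c * quad₄ K, d * quad₄ K, a, b, ?_⟩
      convert Ideal.add_mem _ h1 (Ideal.mul_mem_left _ (incl K c + incl K d * X 3)
        X_four_sq_sub_mem) using 1
      simp only [map_mul, Fin.reduceFinMk]
      ring

/-- The homogeneous coordinate ring embeds into a multiquadratic extension of `K(T₀, T₁, T₂)`. -/
instance ideal_isPrime : (ideal K).IsPrime := by
  let F := FractionRing (MvPolynomial (Fin 3) K)
  let L := AlgebraicClosure F
  obtain ⟨p, hp⟩ := IsAlgClosed.exists_pow_nat_eq (algebraMap F L (algebraMap _ F (quad₃ K)))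
    two_pos
  obtain ⟨q, hq⟩ := IsAlgClosed.exists_pow_nat_eq (algebraMap F L (algebraMap _ F (quad₄ K)))
    two_pos
  let ι : MvPolynomial (Fin 3) K →+* L := (algebraMap F L).comp (algebraMap _ F)
  let Θ : MvPolynomial (Fin 5) K →+* L :=
    eval₂Hom (ι.comp C) ![ι (X 0), ι (X 1), ι (X 2), p, q]
  have hι : ∀ a, Θ (incl K a) = ι a := by
    intro a
    have : Θ.comp (incl K).toRingHom = ι := by
      refine MvPolynomial.ringHom_ext (fun r => ?_) (fun i => ?_)
      · simp [Θ, incl]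
      · fin_cases i <;> simp [Θ, incl]
    exact RingHom.congr_fun this a
  have h3 : Θ (X 3) = p := by simp [Θ]
  have h4 : Θ (X 4) = q := by simp [Θ]
  have hle : ideal K ≤ RingHom.ker Θ := by
    have e3 : Θ (X 3 ^ 2 - incl K (quad₃ K)) = 0 := by
      rw [map_sub, map_pow, hι, h3, hp]; exact sub_self _
    have e4 : Θ (X 4 ^ 2 - incl K (quad₄ K)) = 0 := by
      rw [map_sub, map_pow, hι, h4, hq]; exact sub_self _
    rw [ideal, Ideal.span_le]
    rintro _ (rfl | rfl)
    · have : q₁ K = (X 3 ^ 2 - incl K (quad₃ K)) + (X 4 ^ 2 - incl K (quad₄ K)) := by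
        simp only [quad₃, quad₄, q₁, Fin.sum_univ_five, map_mul, map_add, map_pow, incl_X,
          map_neg, map_ofNat, algHom_C, algebraMap_eq]
        simp only [Fin.castLE]
        simp
        linear_combination (-X 0 ^ 2 - X 1 ^ 2 - X 2 ^ 2) * C_quarter_mul (K := K) (σ := Fin 5)
      rw [this, SetLike.mem_coe, RingHom.mem_ker, map_add, e3, e4, add_zero]
    · have : q₂ K = 7 * (X 3 ^ 2 - incl K (quad₃ K)) + 11 * (X 4 ^ 2 - incl K (quad₄ K)) := by
        simp only [quad₃, quad₄, q₂, Fin.sum_univ_five, coeffs, map_mul, map_add, map_pow, incl_X,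
          map_neg, map_ofNat, algHom_C, algebraMap_eq]
        simp only [Fin.castLE, Matrix.cons_val, Nat.cast_ofNat, map_ofNat]
        simp
        linear_combination (-2 * X 0 ^ 2 - 3 * X 1 ^ 2 - 5 * X 2 ^ 2) *
          C_quarter_mul (K := K) (σ := Fin 5)
      rw [this, SetLike.mem_coe, RingHom.mem_ker, map_add, map_mul, map_mul, e3, e4, mul_zero,
        mul_zero, add_zero]
  have hker : RingHom.ker Θ = ideal K := by
    apply le_antisymm
    · intro f hf
      obtain ⟨a, b, c, d, h⟩ := exists_normalForm f
      have h0 : Θ (incl K a + incl K b * X 3 + incl K c * X 4 + incl K d * X 3 * X 4) = 0 := by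
        have := hle h
        rw [RingHom.mem_ker, map_sub, RingHom.mem_ker.mp hf, zero_sub, neg_eq_zero] at this
        exact this
      simp only [map_add, map_mul, hι, h3, h4] at h0
      obtain ⟨ha, hb, hc, hd⟩ := eq_zero_of_add_sqrt_eq_zero (F := F) (L := L) not_isSquare_quad₃
        not_isSquare_quad₄ (by rw [← map_mul]; exact not_isSquare_quad₃_mul_quad₄) two_ne_zero
        hp hq h0
      rw [map_eq_zero_iff _ (IsFractionRing.injective _ _)] at ha hb hc hd
      simpa [ha, hb, hc, hd] using h
    · exact hle
  rw [← hker]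
  exact RingHom.ker_isPrime Θ

instance coordRing_isDomain : IsDomain (CoordRing K) := Ideal.Quotient.isDomain _

end Domain
end TwoQuadrics

/-! ### Homogeneous polynomials and graded maps -/

namespace MvPolynomial

variable {σ R : Type*} [CommRing R]

/-- The substitution `Xᵢ ↦ Xᵢ t`, whose `n`-th coefficient in `t` is the homogeneous component of
degree `n`. -/
noncomputable def homogenize : MvPolynomial σ R →ₐ[R] Polynomial (MvPolynomial σ R) :=
  aeval fun i => Polynomial.C (X i) * Polynomial.X

theorem homogenize_monomial (d : σ →₀ ℕ) (r : R) :
    homogenize (monomial d r) = Polynomial.C (monomial d r) * Polynomial.X ^ d.degree := by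
  rw [homogenize, aeval_monomial, monomial_eq, Finsupp.prod, Finsupp.prod]
  simp only [mul_pow, Finset.prod_mul_distrib, Finset.prod_pow_eq_pow_sum, map_mul, map_prod,
    map_pow]
  rw [mul_assoc]
  rfl

theorem coeff_homogenize (f : MvPolynomial σ R) (n : ℕ) :
    (homogenize f).coeff n = homogeneousComponent n f := by
  induction f using MvPolynomial.induction_on' with
  | monomial d r =>
    rw [homogenize_monomial, Polynomial.coeff_C_mul, Polynomial.coeff_X_pow,
      homogeneousComponent_of_mem (m := n) (n := d.degree)
        ((mem_homogeneousSubmodule _ _).mpr (isHomogeneous_monomial r rfl))]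
    split_ifs <;> simp
  | add p q hp hq => rw [map_add, Polynomial.coeff_add, hp, hq, map_add]

theorem homogenize_of_isHomogeneous {f : MvPolynomial σ R} {n : ℕ} (hf : f.IsHomogeneous n) :
    homogenize f = Polynomial.C f * Polynomial.X ^ n := by
  ext m : 1
  rw [coeff_homogenize, homogeneousComponent_of_mem ((mem_homogeneousSubmodule _ _).mpr hf),
    Polynomial.coeff_C_mul, Polynomial.coeff_X_pow]
  split_ifs <;> simp

theorem isHomogeneous_of_homogenize {f : MvPolynomial σ R} {n : ℕ}
    (h : ∀ m, m ≠ n → (homogenize f).coeff m = 0) : f.IsHomogeneous n := by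
  have : f = homogeneousComponent n f := by
    conv_lhs => rw [← sum_homogeneousComponent f]
    by_cases hn : n ∈ Finset.range (f.totalDegree + 1)
    · exact Finset.sum_eq_single_of_mem n hn fun m _ hm => by rw [← coeff_homogenize, h m hm]
    · rw [homogeneousComponent_eq_zero n f (by simpa using hn)]
      exact Finset.sum_eq_zero fun m hm => by
        rw [← coeff_homogenize, h m (by rintro rfl; exact hn hm)]
  rw [this]
  exact homogeneousComponent_isHomogeneous _ _

/-- A factor of a nonzero homogeneous polynomial is homogeneous. -/
theorem IsHomogeneous.of_dvd [IsDomain R] {f g : MvPolynomial σ R} {n : ℕ}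
    (hf : f.IsHomogeneous n) (h0 : f ≠ 0) (hg : g ∣ f) : ∃ m, g.IsHomogeneous m := by
  obtain ⟨k, rfl⟩ := hg
  have h1 := homogenize_of_isHomogeneous hf
  rw [map_mul] at h1
  have hne : homogenize g * homogenize k ≠ 0 := by
    rw [h1]; exact mul_ne_zero (Polynomial.C_ne_zero.mpr h0) (pow_ne_zero _ Polynomial.X_ne_zero)
  have h2 := congrArg Polynomial.natDegree h1
  have h3 := congrArg Polynomial.natTrailingDegree h1
  rw [Polynomial.natDegree_mul (left_ne_zero_of_mul hne) (right_ne_zero_of_mul hne),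
    Polynomial.natDegree_C_mul_X_pow _ _ h0] at h2
  rw [Polynomial.natTrailingDegree_mul (left_ne_zero_of_mul hne) (right_ne_zero_of_mul hne),
    Polynomial.natTrailingDegree_mul_X_pow (Polynomial.C_ne_zero.mpr h0),
    Polynomial.natTrailingDegree_C, zero_add] at h3
  have h4 := Polynomial.natTrailingDegree_le_natDegree (homogenize g)
  have h5 := Polynomial.natTrailingDegree_le_natDegree (homogenize k)
  refine ⟨(homogenize g).natDegree, isHomogeneous_of_homogenize fun m hm => ?_⟩
  rcases lt_or_gt_of_ne hm with h | h
  · exact Polynomial.coeff_eq_zero_of_lt_natTrailingDegree (by omega)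
  · exact Polynomial.coeff_eq_zero_of_natDegree_lt h

end MvPolynomial

section Graded

variable {K A B : Type*} [CommRing K] [CommRing A] [CommRing B] [Algebra K A] [Algebra K B]
  (𝒜 : ℕ → Submodule K A) [GradedAlgebra 𝒜] (ℬ : ℕ → Submodule K B) [GradedAlgebra ℬ]

/-- A ring homomorphism multiplying degrees by `k > 0` commutes with homogeneous components. -/
theorem decompose_map_mul {k : ℕ} (hk : 0 < k) (f : A →+* B)
    (hf : ∀ n, ∀ a ∈ 𝒜 n, f a ∈ ℬ (k * n)) (a : A) (n : ℕ) :
    (DirectSum.decompose ℬ (f a) (k * n) : B) = f (DirectSum.decompose 𝒜 a n) := by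
  classical
  induction a using DirectSum.Decomposition.inductionOn 𝒜 with
  | zero => simp
  | @homogeneous m a =>
    by_cases h : m = n
    · subst h
      rw [DirectSum.decompose_of_mem_same _ (hf m a a.2), DirectSum.decompose_coe,
        DirectSum.of_eq_same]
    · rw [DirectSum.decompose_of_mem_ne _ (hf m a a.2)
        (fun h' => h (Nat.eq_of_mul_eq_mul_left hk h')), DirectSum.decompose_of_mem_ne _ a.2 h,
        map_zero]
  | add a b ha hb => simp [DirectSum.decompose_add, ha, hb]

theorem isHomogeneous_comap {k : ℕ} (hk : 0 < k) (f : A →+* B)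
    (hf : ∀ n, ∀ a ∈ 𝒜 n, f a ∈ ℬ (k * n)) {I : Ideal B} (hI : I.IsHomogeneous ℬ) :
    (I.comap f).IsHomogeneous 𝒜 := by
  intro n a ha
  rw [Ideal.mem_comap, ← decompose_map_mul 𝒜 ℬ hk f hf]
  exact hI _ ha

theorem eq_zero_of_map_eq_zero {k : ℕ} (hk : 0 < k) (f : A →+* B)
    (hf : ∀ n, ∀ a ∈ 𝒜 n, f a ∈ ℬ (k * n)) (h0 : ∀ n, ∀ a ∈ 𝒜 n, f a = 0 → a = 0) (a : A)
    (ha : f a = 0) : a = 0 := by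
  classical
  rw [← DirectSum.sum_support_decompose 𝒜 a]
  refine Finset.sum_eq_zero fun n _ => h0 n _ (SetLike.coe_mem _) ?_
  rw [← decompose_map_mul 𝒜 ℬ hk f hf, ha]
  simp

/-- A homogeneous prime ideal containing all homogeneous elements of another one contains it. -/
theorem le_of_forall_homogeneous {I J : HomogeneousIdeal 𝒜}
    (h : ∀ n, ∀ a ∈ 𝒜 n, a ∈ I → a ∈ J) : I ≤ J := by
  classical
  intro a ha
  rw [← DirectSum.sum_support_decompose 𝒜 a]
  exact sum_mem fun n _ => h n _ (SetLike.coe_mem _) (I.2 n ha)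

end Graded

theorem exists_prime_mem_of_mem {B : Type*} [CommRing B] [IsDomain B]
    [UniqueFactorizationMonoid B] (P : Ideal B) [hP : P.IsPrime] {a : B} (h0 : a ≠ 0)
    (ha : a ∈ P) : ∃ p, Prime p ∧ p ∣ a ∧ p ∈ P := by
  induction a using UniqueFactorizationMonoid.induction_on_prime with
  | h₁ => exact absurd rfl h0
  | h₂ x hx => exact absurd (P.eq_top_of_isUnit_mem ha hx) hP.ne_top
  | h₃ a p ha0 hp ih =>
    rcases hP.mem_or_mem ha with h | h
    · exact ⟨p, hp, dvd_mul_right _ _, h⟩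
    · obtain ⟨q, hq, hqa, hqP⟩ := ih ha0 h
      exact ⟨q, hq, hqa.mul_left _, hqP⟩

/-! ### Charts of a projective scheme modelled on an open subset of the projective plane -/

section PlaneCharts

open MvPolynomial

attribute [local instance] MvPolynomial.gradedAlgebra

/-- Mutually inverse (up to powers of a quadratic form `δ`) graded maps between the ring `A` and
`K[X₀, X₁, X₂]`: they identify the open subset `D₊(φ δ)` of `Proj 𝒜` with the complement of the
conic `δ = 0` in the projective plane. -/
structure PlaneChart {K A : Type u} [Field K] [CommRing A] [Algebra K A]
    (𝒜 : ℕ → Submodule K A) [GradedAlgebra 𝒜] where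
  /-- The map given by the projection to the plane. -/
  φ : MvPolynomial (Fin 3) K →+* A
  /-- The map given by the cubic parametrization. -/
  ψ : A →+* MvPolynomial (Fin 3) K
  /-- The equation of the conic. -/
  δ : MvPolynomial (Fin 3) K
  φ_mem : ∀ n, ∀ F : MvPolynomial (Fin 3) K, F.IsHomogeneous n → φ F ∈ 𝒜 n
  ψ_mem : ∀ n, ∀ a ∈ 𝒜 n, (ψ a).IsHomogeneous (3 * n)
  ψ_φ : ∀ n, ∀ F : MvPolynomial (Fin 3) K, F.IsHomogeneous n → ψ (φ F) = δ ^ n * F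
  φ_ψ : ∀ n, ∀ a ∈ 𝒜 n, φ (ψ a) = φ δ ^ n * a
  δ_hom : δ.IsHomogeneous 2
  δ_prime : Prime δ

namespace PlaneChart

variable {K A : Type u} [Field K] [CommRing A] [Algebra K A] [IsDomain A]
  {𝒜 : ℕ → Submodule K A} [GradedAlgebra 𝒜] (c : PlaneChart 𝒜)

omit [IsDomain A] in
theorem φ_ne_zero {n : ℕ} {F : MvPolynomial (Fin 3) K} (hF : F.IsHomogeneous n) (h0 : F ≠ 0) :
    c.φ F ≠ 0 := by
  intro h
  have := c.ψ_φ n F hF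
  rw [h, map_zero] at this
  exact mul_ne_zero (pow_ne_zero _ c.δ_prime.ne_zero) h0 this.symm

omit [IsDomain A] in
theorem φ_δ_ne_zero : c.φ c.δ ≠ 0 := c.φ_ne_zero c.δ_hom c.δ_prime.ne_zero

theorem ψ_ne_zero {a : A} (h0 : a ≠ 0) : c.ψ a ≠ 0 := by
  intro h
  refine h0 (eq_zero_of_map_eq_zero 𝒜 (homogeneousSubmodule (Fin 3) K) three_pos c.ψ
    c.ψ_mem (fun n a ha h => ?_) a h)
  have := c.φ_ψ n a ha
  rw [h, map_zero] at this
  exact (mul_eq_zero.mp this.symm).resolve_left (pow_ne_zero _ c.φ_δ_ne_zero)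

include c in
omit [IsDomain A] in
theorem irrelevant_ne_bot : HomogeneousIdeal.irrelevant 𝒜 ≠ ⊥ := by
  intro h
  have h1 : c.φ c.δ ∈ HomogeneousIdeal.irrelevant 𝒜 := by
    rw [HomogeneousIdeal.mem_irrelevant_iff, GradedRing.proj_apply,
      DirectSum.decompose_of_mem_ne 𝒜 (c.φ_mem 2 _ c.δ_hom) (by norm_num)]
  rw [h] at h1
  exact c.φ_δ_ne_zero h1

/-- A homogeneous prime of the polynomial ring other than the equation of the conic. -/
structure IsCurve (p : MvPolynomial (Fin 3) K) : Prop where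
  prime : Prime p
  hom : ∃ n, p.IsHomogeneous n
  not_dvd : ¬ p ∣ c.δ

variable {c}
variable {p : MvPolynomial (Fin 3) K} (hp : c.IsCurve p)

include hp in
omit [IsDomain A] in
theorem IsCurve.not_dvd_pow (n : ℕ) : ¬ p ∣ c.δ ^ n :=
  fun h => hp.not_dvd (hp.prime.dvd_of_dvd_pow h)

include hp in
omit [IsDomain A] in
theorem IsCurve.dvd_ψ_φ_iff {n : ℕ} {F : MvPolynomial (Fin 3) K} (hF : F.IsHomogeneous n) :
    p ∣ c.ψ (c.φ F) ↔ p ∣ F := by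
  rw [c.ψ_φ n F hF, hp.prime.dvd_mul, or_iff_right (hp.not_dvd_pow n)]

include hp in
omit [IsDomain A] in
theorem IsCurve.isHomogeneous :
    ((Ideal.span {p}).comap c.ψ).IsHomogeneous 𝒜 := by
  refine isHomogeneous_comap 𝒜 (homogeneousSubmodule (Fin 3) K) three_pos c.ψ c.ψ_mem ?_
  obtain ⟨n, hn⟩ := hp.hom
  refine Ideal.homogeneous_span _ _ ?_
  rintro _ rfl
  exact ⟨n, hn⟩

/-- The generic point of the curve `p = 0`. -/
noncomputable def IsCurve.point : Proj 𝒜 where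
  asHomogeneousIdeal := ⟨(Ideal.span {p}).comap c.ψ, hp.isHomogeneous⟩
  isPrime := by
    have := (Ideal.span_singleton_prime hp.prime.ne_zero).mpr hp.prime
    exact Ideal.IsPrime.comap c.ψ
  not_irrelevant_le h := by
    have h1 : c.φ c.δ ∈ HomogeneousIdeal.irrelevant 𝒜 := by
      rw [HomogeneousIdeal.mem_irrelevant_iff, GradedRing.proj_apply,
        DirectSum.decompose_of_mem_ne 𝒜 (c.φ_mem 2 _ c.δ_hom) (by norm_num)]
    have h2 : c.ψ (c.φ c.δ) ∈ Ideal.span {p} := h h1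
    rw [Ideal.mem_span_singleton, hp.dvd_ψ_φ_iff c.δ_hom] at h2
    exact hp.not_dvd h2

omit [IsDomain A] in
theorem IsCurve.mem_point {a : A} : a ∈ hp.point.asHomogeneousIdeal ↔ p ∣ c.ψ a :=
  Ideal.mem_span_singleton

omit [IsDomain A] in
theorem IsCurve.φ_mem_point {n : ℕ} {F : MvPolynomial (Fin 3) K} (hF : F.IsHomogeneous n) :
    c.φ F ∈ hp.point.asHomogeneousIdeal ↔ p ∣ F :=
  hp.mem_point.trans (hp.dvd_ψ_φ_iff hF)

omit [IsDomain A] in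
theorem IsCurve.φ_δ_notMem : c.φ c.δ ∉ hp.point.asHomogeneousIdeal := by
  rw [hp.φ_mem_point c.δ_hom]; exact hp.not_dvd

omit [IsDomain A] in
/-- Membership in a homogeneous prime of the chart can be tested in the plane. -/
theorem mem_iff_φ_ψ_mem (x : Proj 𝒜) (hx : c.φ c.δ ∉ x.asHomogeneousIdeal) {n : ℕ} {a : A}
    (ha : a ∈ 𝒜 n) : a ∈ x.asHomogeneousIdeal ↔ c.φ (c.ψ a) ∈ x.asHomogeneousIdeal := by
  rw [c.φ_ψ n a ha]
  refine ⟨fun h => Ideal.mul_mem_left _ _ h, fun h => ?_⟩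
  exact ((Proj.isPrime_toIdeal 𝒜 x).mem_or_mem h).resolve_left
    fun h' => hx ((Proj.isPrime_toIdeal 𝒜 x).mem_of_pow_mem _ h')

omit [IsDomain A] in
theorem IsCurve.point_le (x : Proj 𝒜) (hx : c.φ c.δ ∉ x.asHomogeneousIdeal)
    (h : c.φ p ∈ x.asHomogeneousIdeal) : hp.point.asHomogeneousIdeal ≤ x.asHomogeneousIdeal := by
  refine le_of_forall_homogeneous 𝒜 fun n a ha hap => ?_
  rw [mem_iff_φ_ψ_mem x hx ha]
  obtain ⟨b, hb⟩ := hp.mem_point.mp hap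
  rw [hb, map_mul]
  exact Ideal.mul_mem_right _ _ h

/-- The points of curves are of codimension one: the only homogeneous prime strictly contained
in such a prime is zero. -/
theorem IsCurve.eq_point (x : Proj 𝒜) (hx : x.asHomogeneousIdeal ≤ hp.point.asHomogeneousIdeal)
    {n : ℕ} {a : A} (ha : a ∈ 𝒜 n) (ha0 : a ≠ 0) (hax : a ∈ x.asHomogeneousIdeal) :
    x = hp.point := by
  have hδ : c.φ c.δ ∉ x.asHomogeneousIdeal := fun h => hp.φ_δ_notMem (hx h)
  have hfin : FiniteMultiplicity p (c.ψ a) :=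
    FiniteMultiplicity.of_prime_left hp.prime (c.ψ_ne_zero ha0)
  obtain ⟨b, hb, hpb⟩ := hfin.exists_eq_pow_mul_and_not_dvd
  have hbn : ∃ m, b.IsHomogeneous m :=
    (c.ψ_mem n a ha).of_dvd (c.ψ_ne_zero ha0) (hb ▸ dvd_mul_left _ _)
  obtain ⟨m, hm⟩ := hbn
  have h1 : c.φ (c.ψ a) ∈ x.asHomogeneousIdeal := (mem_iff_φ_ψ_mem x hδ ha).mp hax
  rw [hb, map_mul, map_pow] at h1
  have hprime := Proj.isPrime_toIdeal 𝒜 x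
  have h2 : c.φ p ∈ x.asHomogeneousIdeal := by
    rcases hprime.mem_or_mem h1 with h | h
    · exact hprime.mem_of_pow_mem _ h
    · exact absurd ((hp.φ_mem_point hm).mp (hx h)) hpb
  exact ProjectiveSpectrum.ext (le_antisymm hx (hp.point_le x hδ h2))

omit [IsDomain A] in
theorem IsCurve.associated_of_point_eq {q : MvPolynomial (Fin 3) K} (hq : c.IsCurve q)
    (h : hp.point = hq.point) : Associated p q := by
  obtain ⟨n, hn⟩ := hp.hom
  refine (hq.prime.associated_of_dvd hp.prime ?_).symm
  rw [← hq.φ_mem_point hn, ← h, hp.φ_mem_point hn]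

/-! ### The order along a curve -/

open Classical in
/-- The order of vanishing along the curve `p = 0` of a nonzero element of `A`. -/
noncomputable def ord (c : PlaneChart 𝒜) (p : MvPolynomial (Fin 3) K) (a : A) : ℕ :=
  multiplicity p (c.ψ a)

include hp in
theorem IsCurve.ord_mul {a b : A} (ha : a ≠ 0) (hb : b ≠ 0) :
    c.ord p (a * b) = c.ord p a + c.ord p b := by
  rw [ord, map_mul, multiplicity_mul hp.prime (FiniteMultiplicity.of_prime_left hp.prime
    (mul_ne_zero (c.ψ_ne_zero ha) (c.ψ_ne_zero hb)))]
  rfl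

include hp in
theorem IsCurve.ord_eq_zero_iff {a : A} (ha : a ≠ 0) :
    c.ord p a = 0 ↔ a ∉ hp.point.asHomogeneousIdeal := by
  have := c.ψ_ne_zero ha
  rw [hp.mem_point, ord, multiplicity_eq_zero]

include hp in
omit [IsDomain A] in
theorem IsCurve.ord_φ {n : ℕ} {F : MvPolynomial (Fin 3) K} (hF : F.IsHomogeneous n)
    (h0 : F ≠ 0) : c.ord p (c.φ F) = multiplicity p F := by
  rw [ord, c.ψ_φ n F hF, multiplicity_mul hp.prime (FiniteMultiplicity.of_prime_left hp.prime
    (mul_ne_zero (pow_ne_zero _ c.δ_prime.ne_zero) h0)),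
    multiplicity_eq_zero.mpr (hp.not_dvd_pow n), zero_add]

/-- The order along the curve `p = 0` of an element of the field of fractions. -/
noncomputable def ordFrac (c : PlaneChart 𝒜) (p : MvPolynomial (Fin 3) K) (x : FractionRing A) :
    ℤ :=
  c.ord p (IsLocalization.sec (nonZeroDivisors A) x).1 -
    c.ord p (IsLocalization.sec (nonZeroDivisors A) x).2

include hp in
/-- The order of a fraction does not depend on its presentation. -/
theorem IsCurve.ordFrac_div {a b : A} (ha : a ≠ 0) (hb : b ≠ 0) :
    c.ordFrac p (algebraMap A _ a / algebraMap A _ b) = c.ord p a - c.ord p b := by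
  set x : FractionRing A := algebraMap A _ a / algebraMap A _ b with hx
  have h1 := IsLocalization.sec_spec (nonZeroDivisors A) x
  have hb' : algebraMap A (FractionRing A) b ≠ 0 := by
    rwa [Ne, map_eq_zero_iff _ (IsFractionRing.injective A (FractionRing A))]
  have hd : ((IsLocalization.sec (nonZeroDivisors A) x).2 : A) ≠ 0 :=
    nonZeroDivisors.coe_ne_zero _
  have h2 : a * (IsLocalization.sec (nonZeroDivisors A) x).2 =
      b * (IsLocalization.sec (nonZeroDivisors A) x).1 := by
    apply IsFractionRing.injective A (FractionRing A)
    rw [map_mul, map_mul, ← h1, hx]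
    field_simp
  have hn : (IsLocalization.sec (nonZeroDivisors A) x).1 ≠ 0 := by
    intro h
    rw [h, mul_zero] at h2
    exact mul_ne_zero ha hd h2
  have h3 := congrArg (c.ord p) h2
  rw [hp.ord_mul ha hd, hp.ord_mul hb hn] at h3
  rw [ordFrac]
  omega

theorem exists_div_eq (x : FractionRing A) (hx : x ≠ 0) : ∃ a b : A, a ≠ 0 ∧ b ≠ 0 ∧
    x = algebraMap A _ a / algebraMap A _ b := by
  obtain ⟨a, b, hb, rfl⟩ := IsFractionRing.div_surjective (A := A) x
  refine ⟨a, b, ?_, nonZeroDivisors.ne_zero hb, rfl⟩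
  rintro rfl
  simp at hx

include hp in
theorem IsCurve.ordFrac_mul {x y : FractionRing A} (hx : x ≠ 0) (hy : y ≠ 0) :
    c.ordFrac p (x * y) = c.ordFrac p x + c.ordFrac p y := by
  obtain ⟨a, b, ha, hb, rfl⟩ := exists_div_eq x hx
  obtain ⟨a', b', ha', hb', rfl⟩ := exists_div_eq y hy
  rw [div_mul_div_comm, ← map_mul, ← map_mul, hp.ordFrac_div (mul_ne_zero ha ha')
    (mul_ne_zero hb hb'), hp.ordFrac_div ha hb, hp.ordFrac_div ha' hb', hp.ord_mul ha ha',
    hp.ord_mul hb hb']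
  push_cast
  ring

/-! ### Units and the order -/

/-- Clearing common factors in the plane: a homogeneous fraction of degree zero equals
`φ F / φ G` with `F`, `G` coprime. -/
theorem exists_isRelPrime {n : ℕ} {a b : A} (ha : a ∈ 𝒜 n) (hb : b ∈ 𝒜 n) (ha0 : a ≠ 0)
    (hb0 : b ≠ 0) : ∃ m, ∃ F G : MvPolynomial (Fin 3) K, F.IsHomogeneous m ∧ G.IsHomogeneous m ∧
      F ≠ 0 ∧ G ≠ 0 ∧ IsRelPrime F G ∧ F ∣ c.ψ a ∧ G ∣ c.ψ b ∧ a * c.φ G = b * c.φ F := by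
  obtain ⟨F, G, e, hFG, hF, hG⟩ := UniqueFactorizationMonoid.exists_reduced_factors'
    (c.ψ a) (c.ψ b) (c.ψ_ne_zero hb0)
  have hF0 : F ≠ 0 := by rintro rfl; exact c.ψ_ne_zero ha0 (by rw [← hF, mul_zero])
  have hG0 : G ≠ 0 := by rintro rfl; exact c.ψ_ne_zero hb0 (by rw [← hG, mul_zero])
  have he0 : e ≠ 0 := by rintro rfl; exact c.ψ_ne_zero hb0 (by rw [← hG, zero_mul])
  obtain ⟨m, hm⟩ := (c.ψ_mem n a ha).of_dvd (c.ψ_ne_zero ha0) (hF ▸ dvd_mul_left _ _)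
  obtain ⟨m', hm'⟩ := (c.ψ_mem n b hb).of_dvd (c.ψ_ne_zero hb0) (hG ▸ dvd_mul_left _ _)
  obtain ⟨k, hk⟩ := (c.ψ_mem n b hb).of_dvd (c.ψ_ne_zero hb0) (hG ▸ dvd_mul_right _ _)
  have h1 := (hF ▸ c.ψ_mem n a ha).inj_right (hk.mul hm) (mul_ne_zero he0 hF0)
  have h2 := (hG ▸ c.ψ_mem n b hb).inj_right (hk.mul hm') (mul_ne_zero he0 hG0)
  obtain rfl : m = m' := by omega
  refine ⟨m, F, G, hm, hm', hF0, hG0, hFG, hF ▸ dvd_mul_left _ _, hG ▸ dvd_mul_left _ _, ?_⟩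
  have h3 : c.ψ a * G = c.ψ b * F := by rw [← hF, ← hG]; ring
  have h4 := congrArg c.φ h3
  rw [map_mul, map_mul, c.φ_ψ n a ha, c.φ_ψ n b hb, mul_assoc, mul_assoc] at h4
  exact mul_left_cancel₀ (pow_ne_zero _ c.φ_δ_ne_zero) h4

variable [IsIntegral (Proj 𝒜)]

theorem toFrac_unit_ne_zero (g : (Proj 𝒜).functionFieldˣ) : Proj.toFrac 𝒜 g ≠ 0 := by
  rw [Ne, map_eq_zero_iff _ (Proj.toFrac_injective 𝒜)]
  exact g.ne_zero

theorem exists_toFrac_unit_eq (g : (Proj 𝒜).functionFieldˣ) : ∃ n, ∃ a ∈ 𝒜 n, ∃ b ∈ 𝒜 n,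
    a ≠ 0 ∧ b ≠ 0 ∧ Proj.toFrac 𝒜 g = algebraMap A _ a / algebraMap A _ b := by
  obtain ⟨n, a, ha, b, hb, hb0, h⟩ := Proj.exists_toFrac_eq 𝒜 (g : (Proj 𝒜).functionField)
  refine ⟨n, a, ha, b, hb, ?_, hb0, h⟩
  rintro rfl
  exact toFrac_unit_ne_zero g (by rw [h]; simp)

variable (c) in
include c in
theorem exists_unit_toFrac_eq {n : ℕ} {a b : A} (ha : a ∈ 𝒜 n) (hb : b ∈ 𝒜 n) (ha0 : a ≠ 0)
    (hb0 : b ≠ 0) : ∃ g : (Proj 𝒜).functionFieldˣ,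
      Proj.toFrac 𝒜 g = algebraMap A _ a / algebraMap A _ b := by
  obtain ⟨g, hg⟩ := Proj.exists_eq_toFrac 𝒜 c.irrelevant_ne_bot ha hb hb0
  refine ⟨Units.mk0 g ?_, hg⟩
  rintro rfl
  rw [map_zero, eq_comm, div_eq_zero_iff,
    map_eq_zero_iff _ (IsFractionRing.injective A (FractionRing A)),
    map_eq_zero_iff _ (IsFractionRing.injective A (FractionRing A))] at hg
  exact hg.elim ha0 hb0

theorem div_eq_div_of_mul_eq {a b a' b' : A} (hb : b ≠ 0) (hb' : b' ≠ 0) (h : a * b' = b * a') :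
    algebraMap A (FractionRing A) a / algebraMap A _ b =
      algebraMap A _ a' / algebraMap A _ b' := by
  rw [div_eq_div_iff, ← map_mul, ← map_mul, h, mul_comm]
  · rwa [Ne, map_eq_zero_iff _ (IsFractionRing.injective A (FractionRing A))]
  · rwa [Ne, map_eq_zero_iff _ (IsFractionRing.injective A (FractionRing A))]

/-- In the reduced presentation of a function of order zero along `p = 0`, the prime `p` divides
neither the numerator nor the denominator. -/
theorem IsCurve.mem_localUnits_iff (g : (Proj 𝒜).functionFieldˣ) :
    g ∈ (Proj 𝒜).localUnits hp.point ↔ c.ordFrac p (Proj.toFrac 𝒜 g) = 0 := by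
  constructor
  · intro h
    obtain ⟨n, a, ha, b, hb, hax, hbx, h⟩ := (Proj.mem_localUnits_iff 𝒜 _ _).mp h
    have ha0 : a ≠ 0 := by rintro rfl; exact hax (zero_mem _)
    have hb0 : b ≠ 0 := by rintro rfl; exact hbx (zero_mem _)
    rw [h, hp.ordFrac_div ha0 hb0, (hp.ord_eq_zero_iff ha0).mpr hax,
      (hp.ord_eq_zero_iff hb0).mpr hbx]
    rfl
  · intro h
    obtain ⟨n, a, ha, b, hb, ha0, hb0, hg⟩ := exists_toFrac_unit_eq g
    obtain ⟨m, F, G, hF, hG, hF0, hG0, hFG, -, -, hab⟩ := c.exists_isRelPrime ha hb ha0 hb0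
    rw [div_eq_div_of_mul_eq hb0 (c.φ_ne_zero hG hG0) hab] at hg
    rw [hg, hp.ordFrac_div (c.φ_ne_zero hF hF0) (c.φ_ne_zero hG hG0), hp.ord_φ hF hF0,
      hp.ord_φ hG hG0, sub_eq_zero, Nat.cast_inj] at h
    have hdvd : p ∣ F ↔ p ∣ G := by
      rw [← not_iff_not, ← multiplicity_eq_zero, ← multiplicity_eq_zero, h]
    have hpF : ¬ p ∣ F := fun h' => hp.prime.not_isUnit (hFG h' (hdvd.mp h'))
    refine (Proj.mem_localUnits_iff 𝒜 _ _).mpr ⟨m, _, c.φ_mem m F hF, _, c.φ_mem m G hG, ?_, ?_, hg⟩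
    · rwa [hp.φ_mem_point hF]
    · rwa [hp.φ_mem_point hG, ← hdvd]

/-- A rational function which is a unit at all points of curves through `x` is a unit at `x`. -/
theorem mem_localUnits_of_forall (x : Proj 𝒜) (hx : c.φ c.δ ∉ x.asHomogeneousIdeal)
    (g : (Proj 𝒜).functionFieldˣ)
    (h : ∀ (p : MvPolynomial (Fin 3) K) (hp : c.IsCurve p),
      hp.point.asHomogeneousIdeal ≤ x.asHomogeneousIdeal → g ∈ (Proj 𝒜).localUnits hp.point) :
    g ∈ (Proj 𝒜).localUnits x := by
  obtain ⟨n, a, ha, b, hb, ha0, hb0, hg⟩ := exists_toFrac_unit_eq g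
  obtain ⟨m, F, G, hF, hG, hF0, hG0, hFG, -, -, hab⟩ := c.exists_isRelPrime ha hb ha0 hb0
  rw [div_eq_div_of_mul_eq hb0 (c.φ_ne_zero hG hG0) hab] at hg
  have hpx := Proj.isPrime_toIdeal 𝒜 x
  have key : ∀ {E : MvPolynomial (Fin 3) K}, E.IsHomogeneous m → E ≠ 0 →
      (∀ p, c.IsCurve p → p ∣ E → ¬ c.ordFrac p (Proj.toFrac 𝒜 g) = 0) →
      c.φ E ∉ x.asHomogeneousIdeal := by
    intro E hE hE0 hord hEx
    obtain ⟨p, hp, hpE, hpx'⟩ :=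
      exists_prime_mem_of_mem (x.asHomogeneousIdeal.toIdeal.comap c.φ) hE0 hEx
    have hc : c.IsCurve p := ⟨hp, hE.of_dvd hE0 hpE, fun hd => hx (by
      obtain ⟨e, he⟩ := hd
      rw [he, map_mul]
      exact Ideal.mul_mem_right _ _ hpx')⟩
    exact hord p hc hpE ((hc.mem_localUnits_iff g).mp (h p hc (hc.point_le x hx hpx')))
  refine (Proj.mem_localUnits_iff 𝒜 _ _).mpr ⟨m, _, c.φ_mem m F hF, _, c.φ_mem m G hG, ?_, ?_, hg⟩
  · refine key hF hF0 fun p hp hpF h0 => ?_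
    rw [hg, hp.ordFrac_div (c.φ_ne_zero hF hF0) (c.φ_ne_zero hG hG0), hp.ord_φ hF hF0,
      hp.ord_φ hG hG0, multiplicity_eq_zero.mpr fun hpG => hp.prime.not_isUnit (hFG hpF hpG)] at h0
    exact multiplicity_eq_zero.mp (by omega) hpF
  · refine key hG hG0 fun p hp hpG h0 => ?_
    rw [hg, hp.ordFrac_div (c.φ_ne_zero hF hF0) (c.φ_ne_zero hG hG0), hp.ord_φ hF hF0,
      hp.ord_φ hG hG0, multiplicity_eq_zero.mpr fun hpF => hp.prime.not_isUnit (hFG hpF hpG)] at h0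
    exact multiplicity_eq_zero.mp (by omega) hpG

end PlaneChart

end PlaneCharts

/-! ### Cartier divisors on a projective scheme covered by charts -/

namespace AlgebraicGeometry.Scheme

variable {X : Scheme.{u}} [IsIntegral X]

theorem germDiv_eq_one_iff {x : X} {g : X.functionFieldˣ} :
    X.germDiv x g = 1 ↔ g ∈ X.localUnits x :=
  QuotientGroup.eq_one_iff g

theorem exists_germDiv_eq {x : X} (d : X.CartierStalk x) : ∃ g, X.germDiv x g = d :=
  QuotientGroup.mk'_surjective (X.localUnits x) d

theorem cartierDivisors_ext {D E : X.cartierDivisors} (h : ∀ x, D.1 x = E.1 x) : D = E :=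
  Subtype.ext (funext h)

theorem coe_mul_apply (D E : X.cartierDivisors) (x : X) : (D * E).1 x = D.1 x * E.1 x := rfl

theorem coe_div_apply (D E : X.cartierDivisors) (x : X) : (D / E).1 x = D.1 x / E.1 x := rfl

theorem principalDivisor_apply (g : X.functionFieldˣ) (x : X) :
    (X.principalDivisor g).1 x = X.germDiv x g := rfl

theorem divisorClass_surjective (p : X.PicardGroup) : ∃ D, X.divisorClass D = p :=
  QuotientGroup.mk'_surjective (principalDivisor X).range p

theorem divisorClass_eq_one_iff {D : X.cartierDivisors} :
    X.divisorClass D = 1 ↔ ∃ g, X.principalDivisor g = D :=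
  QuotientGroup.eq_one_iff D

theorem divisorClass_eq_iff {D E : X.cartierDivisors} :
    X.divisorClass D = X.divisorClass E ↔ ∃ g, X.principalDivisor g = D / E := by
  rw [← divisorClass_eq_one_iff, map_div, div_eq_one]

end AlgebraicGeometry.Scheme

open Scheme

namespace PlaneChart

variable {K A : Type u} [Field K] [CommRing A] [Algebra K A] [IsDomain A]
  {𝒜 : ℕ → Submodule K A} [GradedAlgebra 𝒜] [IsIntegral (Proj 𝒜)] {c : PlaneChart 𝒜}
  {p : MvPolynomial (Fin 3) K} (hp : c.IsCurve p)

omit [IsDomain A] [IsIntegral (Proj 𝒜)] in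
theorem IsCurve.point_eq_of_associated {q : MvPolynomial (Fin 3) K} (hq : c.IsCurve q)
    (h : Associated p q) : hp.point = hq.point := by
  refine ProjectiveSpectrum.ext (SetLike.ext fun a => ?_)
  rw [hp.mem_point, hq.mem_point, h.dvd_iff_dvd_left]

/-- The order along the curve `p = 0` of a germ of a Cartier divisor at its generic point. -/
noncomputable def IsCurve.ordStalk (d : (Proj 𝒜).CartierStalk hp.point) : ℤ :=
  c.ordFrac p (Proj.toFrac 𝒜 (exists_germDiv_eq d).choose)

include hp in
theorem IsCurve.ordFrac_toFrac_mul (g g' : (Proj 𝒜).functionFieldˣ) :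
    c.ordFrac p (Proj.toFrac 𝒜 (g * g' : (Proj 𝒜).functionFieldˣ)) =
      c.ordFrac p (Proj.toFrac 𝒜 g) + c.ordFrac p (Proj.toFrac 𝒜 g') := by
  rw [Units.val_mul, map_mul, hp.ordFrac_mul (toFrac_unit_ne_zero g) (toFrac_unit_ne_zero g')]

/-- The order along the curve `p = 0`, as a homomorphism on the units of the function field. -/
noncomputable def IsCurve.ordHom : (Proj 𝒜).functionFieldˣ →* Multiplicative ℤ :=
  MonoidHom.mk' (fun g => Multiplicative.ofAdd (c.ordFrac p (Proj.toFrac 𝒜 g)))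
    (fun g g' => congrArg Multiplicative.ofAdd (hp.ordFrac_toFrac_mul g g'))

include hp in
theorem IsCurve.ordFrac_toFrac_zpow (g : (Proj 𝒜).functionFieldˣ) (n : ℤ) :
    c.ordFrac p (Proj.toFrac 𝒜 (g ^ n : (Proj 𝒜).functionFieldˣ)) =
      n * c.ordFrac p (Proj.toFrac 𝒜 g) :=
  (congrArg Multiplicative.toAdd (map_zpow hp.ordHom g n)).trans (toAdd_zpow _ _)

include hp in
theorem IsCurve.ordFrac_toFrac_div (g g' : (Proj 𝒜).functionFieldˣ) :
    c.ordFrac p (Proj.toFrac 𝒜 (g / g' : (Proj 𝒜).functionFieldˣ)) =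
      c.ordFrac p (Proj.toFrac 𝒜 g) - c.ordFrac p (Proj.toFrac 𝒜 g') :=
  (congrArg Multiplicative.toAdd (map_div hp.ordHom g g')).trans (toAdd_div _ _)

theorem IsCurve.ordStalk_germDiv (g : (Proj 𝒜).functionFieldˣ) :
    hp.ordStalk ((Proj 𝒜).germDiv hp.point g) = c.ordFrac p (Proj.toFrac 𝒜 g) := by
  rw [ordStalk, ← sub_eq_zero, ← hp.ordFrac_toFrac_div, ← hp.mem_localUnits_iff,
    ← germDiv_eq_one_iff, map_div, div_eq_one]
  exact (exists_germDiv_eq ((Proj 𝒜).germDiv hp.point g)).choose_spec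

theorem IsCurve.ordStalk_eq_zero_iff {d : (Proj 𝒜).CartierStalk hp.point} :
    hp.ordStalk d = 0 ↔ d = 1 := by
  obtain ⟨g, rfl⟩ := exists_germDiv_eq d
  rw [hp.ordStalk_germDiv, germDiv_eq_one_iff, hp.mem_localUnits_iff]

theorem IsCurve.ordStalk_mul (d e : (Proj 𝒜).CartierStalk hp.point) :
    hp.ordStalk (d * e) = hp.ordStalk d + hp.ordStalk e := by
  obtain ⟨g, rfl⟩ := exists_germDiv_eq d
  obtain ⟨g', rfl⟩ := exists_germDiv_eq e
  rw [← map_mul, hp.ordStalk_germDiv, hp.ordStalk_germDiv, hp.ordStalk_germDiv,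
    hp.ordFrac_toFrac_mul]

theorem IsCurve.ordStalk_div (d e : (Proj 𝒜).CartierStalk hp.point) :
    hp.ordStalk (d / e) = hp.ordStalk d - hp.ordStalk e := by
  rw [eq_sub_iff_add_eq, ← hp.ordStalk_mul, div_mul_cancel]

/-- A Cartier divisor which is trivial at all points of curves through a point `x` of the chart is
trivial at `x`. -/
theorem apply_eq_one_of_forall (D : (Proj 𝒜).cartierDivisors) (x : Proj 𝒜)
    (hx : c.φ c.δ ∉ x.asHomogeneousIdeal)
    (h : ∀ (p : MvPolynomial (Fin 3) K) (hp : c.IsCurve p),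
      hp.point.asHomogeneousIdeal ≤ x.asHomogeneousIdeal → D.1 hp.point = 1) : D.1 x = 1 := by
  obtain ⟨U, hxU, f, hf⟩ := D.2 x
  rw [hf x hxU, germDiv_eq_one_iff]
  refine c.mem_localUnits_of_forall x hx f fun p hp hpx => ?_
  rw [← germDiv_eq_one_iff, ← hf _ (((Proj.specializes_iff 𝒜).mpr hpx).mem_open U.isOpen hxU)]
  exact h p hp hpx

/-- A Cartier divisor which is trivial along all but the finitely many curves dividing `F`
becomes trivial along all curves other than a given line `H = 0` after the subtraction of a
principal divisor: the curve `q = 0` is moved to the line by `q / H ^ deg q`. -/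
theorem exists_principalDivisor_of_dvd (c : PlaneChart 𝒜) {H : MvPolynomial (Fin 3) K}
    (hH : H.IsHomogeneous 1) (hH0 : H ≠ 0) (F : MvPolynomial (Fin 3) K) (hF : F ≠ 0)
    (D : (Proj 𝒜).cartierDivisors)
    (h : ∀ (p) (hp : c.IsCurve p), ¬ p ∣ H → ¬ p ∣ F → D.1 hp.point = 1) :
    ∃ g, ∀ (p) (hp : c.IsCurve p), ¬ p ∣ H →
      (D / (Proj 𝒜).principalDivisor g).1 hp.point = 1 := by
  induction F using UniqueFactorizationMonoid.induction_on_prime generalizing D with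
  | h₁ => exact absurd rfl hF
  | h₂ F hu =>
    refine ⟨1, fun p hp hpH => ?_⟩
    rw [map_one, div_one]
    exact h p hp hpH fun hd => hp.prime.not_isUnit (isUnit_of_dvd_unit hd hu)
  | h₃ F q hF0 hq ih =>
    by_cases hqc : c.IsCurve q ∧ ¬ q ∣ H
    · obtain ⟨hqc, hqH⟩ := hqc
      obtain ⟨n, hn⟩ := hqc.hom
      have hHn : (H ^ n).IsHomogeneous n := by simpa using hH.pow n
      obtain ⟨g, hg⟩ := c.exists_unit_toFrac_eq (c.φ_mem n q hn) (c.φ_mem n _ hHn)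
        (c.φ_ne_zero hn hq.ne_zero) (c.φ_ne_zero hHn (pow_ne_zero _ hH0))
      have hord : ∀ {p}, c.IsCurve p → ¬ p ∣ H →
          c.ordFrac p (Proj.toFrac 𝒜 g) = multiplicity p q := by
        intro p hp hpH
        rw [hg, hp.ordFrac_div (c.φ_ne_zero hn hq.ne_zero) (c.φ_ne_zero hHn (pow_ne_zero _ hH0)),
          hp.ord_φ hn hq.ne_zero, hp.ord_φ hHn (pow_ne_zero _ hH0),
          multiplicity_eq_zero.mpr fun hd => hpH (hp.prime.dvd_of_dvd_pow hd)]
        simp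
      obtain ⟨g', hg'⟩ := ih hF0
        (D / (Proj 𝒜).principalDivisor (g ^ hqc.ordStalk (D.1 hqc.point))) (by
          intro p hp hpH hpF
          by_cases hpq : p ∣ q
          · rw [hp.point_eq_of_associated hqc (hp.prime.associated_of_dvd hq hpq),
              ← hqc.ordStalk_eq_zero_iff, coe_div_apply, hqc.ordStalk_div,
              principalDivisor_apply, hqc.ordStalk_germDiv, hqc.ordFrac_toFrac_zpow,
              hord hqc hqH, multiplicity_self]
            simp
          · rw [← hp.ordStalk_eq_zero_iff, coe_div_apply, hp.ordStalk_div,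
              principalDivisor_apply, hp.ordStalk_germDiv, hp.ordFrac_toFrac_zpow, hord hp hpH,
              multiplicity_eq_zero.mpr hpq, h p hp hpH fun hd =>
                (hp.prime.dvd_or_dvd hd).elim hpq hpF,
              hp.ordStalk_eq_zero_iff.mpr rfl]
            simp)
      refine ⟨g ^ hqc.ordStalk (D.1 hqc.point) * g', fun p hp hpH => ?_⟩
      rw [map_mul, ← div_div]
      exact hg' p hp hpH
    · refine ih hF0 D fun p hp hpH hpF => h p hp hpH fun hd => ?_
      rcases hp.prime.dvd_or_dvd hd with hpq | hpF'
      · have ha : Associated p q := hp.prime.associated_of_dvd hq hpq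
        refine hqc ⟨⟨hq, ?_, fun hd => hp.not_dvd (hpq.trans hd)⟩, fun hd => hpH (hpq.trans hd)⟩
        obtain ⟨n, hn⟩ := hp.hom
        exact hn.of_dvd hp.prime.ne_zero ha.dvd'
      · exact hpF hpF'

end PlaneChart

/-! ### The plane cubics parametrizing the surface -/

namespace TwoQuadrics

section Cubics

variable {S : Type*} [CommRing S]

/-- The `n`-th coefficient of the second quadric, in a commutative ring. -/
def a (S : Type*) [CommRing S] (n : Fin 5) : S := (coeffs n : S)

/-- The derivative at `a n` of the polynomial with roots `a 0, …, a 4`. -/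
def d (n : Fin 5) : ℤ := ![135, -64, 72, -160, 1728] n

/-- The conic `(1 : t : t²)`. -/
def conic (x y z : S) : S := x * z - y ^ 2

/-- The line through the points of the conic with parameters `s` and `t`. -/
def join (s t x y z : S) : S := s * t * x - (s + t) * y + z

/-- A cubic through the five points of the conic with parameters `a 0, …, a 4`, tangent to the
conic at the point with parameter `b = a n`. The elementary symmetric functions of the other four
parameters are expressed through `b`. -/
def cubic (b x y z : S) : S :=
  let e₁ := 28 - b
  let e₂ := 288 - b * e₁
  let e₃ := 1358 - b * e₂
  let e₄ := 2927 - b * e₃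
  (b ^ 2 * e₃ + 2 * b * e₄) * x ^ 2 * y - b ^ 2 * e₄ * x ^ 3 + (e₄ - b * e₃) * x ^ 2 * z
    - (b ^ 2 * e₂ + b * e₃ + 2 * e₄) * x * y ^ 2 + 2 * b * e₂ * x * y * z
    + (b ^ 2 - b * e₁) * x * z ^ 2 + (b ^ 2 * e₁ + e₃) * y ^ 3
    - (2 * b ^ 2 + b * e₁ + e₂) * y ^ 2 * z + (e₁ + 2 * b) * y * z ^ 2 - z ^ 3

/-- The five indices are distinct. -/
abbrev Distinct (i j k l n : Fin 5) : Prop := [i, j, k, l, n].Nodup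

theorem Distinct.ne {i j k l n : Fin 5} (h : Distinct i j k l n) :
    (i ≠ j ∧ i ≠ k ∧ i ≠ l ∧ i ≠ n) ∧ (j ≠ k ∧ j ≠ l ∧ j ≠ n) ∧ (k ≠ l ∧ k ≠ n) ∧ l ≠ n := by
  simp only [Distinct, List.nodup_cons, List.mem_cons, not_or, List.not_mem_nil] at h
  tauto

theorem Distinct.rotate {i j k l n : Fin 5} (h : Distinct i j k l n) : Distinct i j l n k := by
  simp only [Distinct, List.nodup_cons, List.mem_cons, not_or, List.not_mem_nil] at h ⊢
  tauto

theorem Distinct.cycle {i j k l n : Fin 5} (h : Distinct i j k l n) : Distinct j k l n i := by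
  simp only [Distinct, List.nodup_cons, List.mem_cons, not_or, List.not_mem_nil] at h ⊢
  tauto

/-- The elementary symmetric functions of four of the numbers `2, 3, 5, 7, 11` in terms of the
fifth, from the coefficients of the polynomial with these roots. -/
theorem esymm_int : ∀ n i : Fin 5, i ≠ n → ∀ j, j ≠ n → j ≠ i → ∀ k, k ≠ n → k ≠ i → k ≠ j →
    ∀ l, l ≠ n → l ≠ i → l ≠ j → l ≠ k →
    let b : ℤ := coeffs n
    let s : ℤ := coeffs i
    let t : ℤ := coeffs j
    let v : ℤ := coeffs k
    let w : ℤ := coeffs l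
    28 - b = s + t + v + w ∧ 288 - b * (28 - b) = s * t + s * v + s * w + t * v + t * w + v * w ∧
    1358 - b * (288 - b * (28 - b)) = s * t * v + s * t * w + s * v * w + t * v * w ∧
    2927 - b * (1358 - b * (288 - b * (28 - b))) = s * t * v * w ∧
    d n = (b - s) * (b - t) * (b - v) * (b - w) := by
  decide

theorem esymm {i j k l n : Fin 5} (h : Distinct i j k l n) :
    28 - a S n = a S i + a S j + a S k + a S l ∧
    288 - a S n * (28 - a S n) = a S i * a S j + a S i * a S k + a S i * a S l + a S j * a S k +
      a S j * a S l + a S k * a S l ∧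
    1358 - a S n * (288 - a S n * (28 - a S n)) = a S i * a S j * a S k + a S i * a S j * a S l +
      a S i * a S k * a S l + a S j * a S k * a S l ∧
    2927 - a S n * (1358 - a S n * (288 - a S n * (28 - a S n))) =
      a S i * a S j * a S k * a S l ∧
    (d n : S) = (a S n - a S i) * (a S n - a S j) * (a S n - a S k) * (a S n - a S l) := by
  simp only [Distinct, List.nodup_cons, List.mem_cons, not_or, List.not_mem_nil] at h
  obtain ⟨h1, h2, h3, h4, h5⟩ := esymm_int n i h.1.2.2.2.1 j h.2.1.2.2.1 (Ne.symm h.1.1)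
    k h.2.2.1.2.1 (Ne.symm h.1.2.1) (Ne.symm h.2.1.1) l h.2.2.2.1.1 (Ne.symm h.1.2.2.1)
    (Ne.symm h.2.1.2.1) (Ne.symm h.2.2.1.1)
  have h1 := congrArg (Int.cast : ℤ → S) h1
  have h2 := congrArg (Int.cast : ℤ → S) h2
  have h3 := congrArg (Int.cast : ℤ → S) h3
  have h4 := congrArg (Int.cast : ℤ → S) h4
  have h5 := congrArg (Int.cast : ℤ → S) h5
  push_cast at h1 h2 h3 h4 h5
  exact ⟨h1, h2, h3, h4, h5⟩

/-- For every splitting of the other four points into pairs the cubic lies in the pencil spanned by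
the conic together with the line through the first pair, and by the lines from the two points of
this pair to the `n`-th point together with the line through the second pair. -/
theorem cubic_eq {i j k l n : Fin 5} (h : Distinct i j k l n) (x y z : S) :
    cubic (a S n) x y z =
      (a S n - a S k) * (a S n - a S l) * (conic x y z * join (a S i) (a S j) x y z) -
        join (a S i) (a S n) x y z * join (a S j) (a S n) x y z *
          join (a S k) (a S l) x y z := by
  obtain ⟨h1, h2, h3, h4, -⟩ := esymm (S := S) h
  simp only [cubic]
  rw [h4, h3, h2, h1]
  simp only [conic, join]
  ring

/-- Modulo the equation of the cubic, the product of the four lines from the `n`-th point to the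
other points is `d n` times the square of the conic. This governs the transition map changing one
sign. -/
theorem conic_sq_sub {i j k l n : Fin 5} (h : Distinct i j k l n) (x y z : S) :
    d n * conic x y z ^ 2 - cubic (a S n) x y z * join (a S n) (a S n) x y z =
      join (a S i) (a S n) x y z * join (a S j) (a S n) x y z * join (a S k) (a S n) x y z *
        join (a S l) (a S n) x y z := by
  rw [cubic_eq h, (esymm h).2.2.2.2]
  simp only [conic, join]
  ring

theorem join_mul_join (s t x y z : S) : join s s x y z * join t t x y z =
    join s t x y z ^ 2 + (s - t) ^ 2 * conic x y z := by
  simp only [join, conic]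
  ring

theorem join_comm (s t x y z : S) : join s t x y z = join t s x y z := by
  simp only [join]
  ring

theorem cubic_relation (p q r s t x y z : S) :
    (p - t) * (p - q) * (join q r x y z * join q s x y z * join p t x y z) +
      (q - t) * (q - p) * (join p r x y z * join p s x y z * join q t x y z) -
      (p - t) * (p - q) * ((q - t) * (q - p)) * (conic x y z * join r s x y z) =
    (p - q) ^ 2 * (join p q x y z * join r t x y z * join s t x y z) := by
  simp only [join, conic]
  ring

/-- The identity behind the transition map changing the signs of two coordinates `i` and `j`: the
conic of the second chart becomes a sextic consisting of the line through the `i`-th and the `j`-th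
point, counted three times, and of the three lines through the remaining points. -/
theorem conic_cube_sub [IsDomain S] {i j k l n : Fin 5} (h : Distinct i j k l n) (x y z : S)
    (h0 : conic x y z ≠ 0) :
    d i * d j * conic x y z ^ 3
      - conic x y z * d j * (cubic (a S i) x y z * join (a S i) (a S i) x y z)
      - conic x y z * d i * (cubic (a S j) x y z * join (a S j) (a S j) x y z)
      + (a S i - a S j) ^ 2 * (cubic (a S i) x y z * cubic (a S j) x y z) =
      (a S i - a S j) ^ 2 * (join (a S i) (a S j) x y z ^ 3 * join (a S k) (a S l) x y z *
        join (a S k) (a S n) x y z * join (a S l) (a S n) x y z) := by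
  have hi : Distinct k l n j i := by
    simp only [Distinct, List.nodup_cons, List.mem_cons, not_or, List.not_mem_nil] at h ⊢
    tauto
  have hj : Distinct k l n i j := by
    simp only [Distinct, List.nodup_cons, List.mem_cons, not_or, List.not_mem_nil] at h ⊢
    tauto
  have h1 := conic_sq_sub hi x y z
  have h2 := conic_sq_sub hj x y z
  have h3 := join_mul_join (a S i) (a S j) x y z
  have h4 := cubic_eq hi x y z
  have h5 := cubic_eq hj x y z
  have h6 := cubic_relation (a S i) (a S j) (a S k) (a S l) (a S n) x y z
  rw [join_comm (a S j) (a S i)] at h1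
  rw [join_comm (a S k) (a S i), join_comm (a S l) (a S i)] at h4
  rw [join_comm (a S k) (a S j), join_comm (a S l) (a S j)] at h5
  rw [join_comm (a S k) (a S i), join_comm (a S l) (a S i)] at h1
  rw [join_comm (a S k) (a S j), join_comm (a S l) (a S j)] at h2
  rw [join_comm (a S n) (a S i)] at h1
  rw [join_comm (a S n) (a S j)] at h2
  rw [join_comm (a S n) (a S j)] at h4
  rw [join_comm (a S n) (a S i)] at h5
  apply mul_left_cancel₀ h0
  generalize join (a S i) (a S j) x y z = Hij at *
  generalize join (a S i) (a S i) x y z = Hii at *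
  generalize join (a S j) (a S j) x y z = Hjj at *
  generalize join (a S i) (a S k) x y z = Hik at *
  generalize join (a S i) (a S l) x y z = Hil at *
  generalize join (a S i) (a S n) x y z = Hin at *
  generalize join (a S j) (a S k) x y z = Hjk at *
  generalize join (a S j) (a S l) x y z = Hjl at *
  generalize join (a S j) (a S n) x y z = Hjn at *
  generalize join (a S k) (a S l) x y z = Hkl at *
  generalize join (a S k) (a S n) x y z = Hkn at *
  generalize join (a S l) (a S n) x y z = Hln at *
  generalize cubic (a S i) x y z = Ci at *
  generalize cubic (a S j) x y z = Cj at *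
  generalize conic x y z = D at *
  generalize a S i = ai at *
  generalize a S j = aj at *
  generalize a S n = an at *
  generalize (d i : S) = di at *
  generalize (d j : S) = dj at *
  have h7 : D * (di * dj * D ^ 3 - D * dj * (Ci * Hii) - D * di * (Cj * Hjj) +
      (ai - aj) ^ 2 * (Ci * Cj)) = Hij ^ 2 * ((Hik * Hil * Hjn) * (Hjk * Hjl * Hin) - Ci * Cj) := by
    linear_combination (dj * D ^ 2 - Cj * Hjj) * h1 + Hik * Hil * Hin * Hij * h2 - Ci * Cj * h3
  rw [h7, h4, h5]
  linear_combination Hij ^ 2 * D * Hkl * h6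

/-- The power sums `∑ (a n) ^ m * y n`. -/
def powerSum (m : ℕ) (y : Fin 5 → S) : S := ∑ n, a S n ^ m * y n

/-- Up to the conic, the cubics recover the coordinates `y n` from their power sums, modulo the two
equations `∑ d * y² = 0` and `∑ a * d * y² = 0`. -/
theorem cubic_powerSum (y : Fin 5 → S) (n : Fin 5) :
    cubic (a S n) (powerSum 0 y) (powerSum 1 y) (powerSum 2 y) =
      2 * d n * conic (powerSum 0 y) (powerSum 1 y) (powerSum 2 y) * y n +
      (∑ m, (a S n - a S m) * a S m * y m) * ∑ m, d m * y m ^ 2 -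
      (∑ m, (a S n - a S m) * y m) * ∑ m, a S m * d m * y m ^ 2 := by
  simp only [powerSum, Fin.sum_univ_five]
  fin_cases n <;> simp [cubic, conic, a, d, coeffs] <;> ring

/-- Up to the conic, the power sums recover the coordinates of the plane from the cubics. The
coefficients are `8640 / d n`. -/
theorem sum_cubic (x y z : S) (m : Fin 3) :
    64 * a S 0 ^ (m : ℕ) * cubic (a S 0) x y z - 135 * a S 1 ^ (m : ℕ) * cubic (a S 1) x y z +
      120 * a S 2 ^ (m : ℕ) * cubic (a S 2) x y z - 54 * a S 3 ^ (m : ℕ) * cubic (a S 3) x y z +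
      5 * a S 4 ^ (m : ℕ) * cubic (a S 4) x y z = 17280 * conic x y z * ![x, y, z] m := by
  fin_cases m <;> simp [cubic, conic, a, coeffs] <;> ring

/-- The cubics parametrize the surface. -/
theorem sum_cubic_sq (x y z : S) (m : Fin 2) :
    64 * a S 0 ^ (m : ℕ) * cubic (a S 0) x y z ^ 2 -
      135 * a S 1 ^ (m : ℕ) * cubic (a S 1) x y z ^ 2 +
      120 * a S 2 ^ (m : ℕ) * cubic (a S 2) x y z ^ 2 -
      54 * a S 3 ^ (m : ℕ) * cubic (a S 3) x y z ^ 2 +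
      5 * a S 4 ^ (m : ℕ) * cubic (a S 4) x y z ^ 2 = 0 := by
  fin_cases m <;> simp [cubic, a, coeffs] <;> ring

section Map

variable {S' : Type*} [CommRing S'] (f : S →+* S')

theorem map_a (n : Fin 5) : f (a S n) = a S' n := map_natCast f _

theorem map_conic (x y z : S) : f (conic x y z) = conic (f x) (f y) (f z) := by
  simp [conic]

theorem map_join (s t x y z : S) : f (join s t x y z) = join (f s) (f t) (f x) (f y) (f z) := by
  simp [join]

theorem map_cubic (b x y z : S) : f (cubic b x y z) = cubic (f b) (f x) (f y) (f z) := by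
  simp [cubic, map_ofNat]

theorem map_powerSum (m : ℕ) (y : Fin 5 → S) :
    f (powerSum m y) = powerSum m fun n => f (y n) := by
  simp [powerSum, map_a]

end Map

end Cubics
end TwoQuadrics

/-! ### The sixteen projections to the plane -/

namespace MvPolynomial

theorem IsHomogeneous.map_eq_pow_mul {σ R S : Type*} [CommRing R] [CommRing S]
    {F : MvPolynomial σ R} {n : ℕ} (hF : F.IsHomogeneous n) (e e' : MvPolynomial σ R →+* S) (t : S)
    (hC : ∀ r, e (C r) = e' (C r)) (hX : ∀ i, e (X i) = t * e' (X i)) : e F = t ^ n * e' F := by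
  have h : e = (Polynomial.eval₂RingHom e' t).comp (homogenize : _ →ₐ[R] _).toRingHom := by
    refine ringHom_ext (fun r => ?_) fun i => ?_
    · change _ = Polynomial.eval₂ e' t (homogenize (C r))
      rw [← algebraMap_eq, AlgHom.commutes]
      exact (hC r).trans (Polynomial.eval₂_C _ _).symm
    · change _ = Polynomial.eval₂ e' t (homogenize (X i))
      rw [homogenize, aeval_X, Polynomial.eval₂_mul, Polynomial.eval₂_C, Polynomial.eval₂_X, hX,
        mul_comm]
  rw [h]
  change Polynomial.eval₂ e' t (homogenize F) = _
  rw [homogenize_of_isHomogeneous hF, Polynomial.eval₂_mul, Polynomial.eval₂_C,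
    Polynomial.eval₂_X_pow, mul_comm]

end MvPolynomial

namespace TwoQuadrics

open MvPolynomial

noncomputable section

/-- Square roots of the numbers `d n`. -/
structure Roots (K : Type u) [Field K] where
  /-- The square root of `d n`. -/
  c : Fin 5 → K
  sq : ∀ n, c n ^ 2 = d n

theorem d_eq : d 0 = 135 ∧ d 1 = -64 ∧ d 2 = 72 ∧ d 3 = -160 ∧ d 4 = 1728 := by decide

theorem d_ne_zero (n : Fin 5) : d n ≠ 0 := by revert n; decide

variable {K : Type u} [Field K]

/-- The coordinate functions of the surface. -/
def T (n : Fin 5) : CoordRing K := Ideal.Quotient.mk _ (X n)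

theorem T_mem (n : Fin 5) : (T n : CoordRing K) ∈ grading K 1 :=
  ⟨X n, isHomogeneous_X _ _, rfl⟩

theorem sum_T_sq : ∑ n, (T n : CoordRing K) ^ 2 = 0 := by
  have h : Ideal.Quotient.mk (ideal K) (q₁ K) = 0 :=
    Ideal.Quotient.eq_zero_iff_mem.mpr (Ideal.subset_span (Or.inl rfl))
  rw [← h]
  simp [q₁, T]

theorem sum_a_mul_T_sq : ∑ n, a (CoordRing K) n * (T n : CoordRing K) ^ 2 = 0 := by
  have h : Ideal.Quotient.mk (ideal K) (q₂ K) = 0 :=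
    Ideal.Quotient.eq_zero_iff_mem.mpr (Ideal.subset_span (Or.inr rfl))
  rw [← h]
  simp [q₂, T, a]

/-- The homomorphism from the coordinate ring given by the images of the coordinates. -/
def lift {S : Type*} [CommRing S] [Algebra K S] (t : Fin 5 → S) (h₁ : ∑ n, t n ^ 2 = 0)
    (h₂ : ∑ n, a S n * t n ^ 2 = 0) : CoordRing K →ₐ[K] S :=
  Ideal.Quotient.liftₐ _ (aeval t) (by
    intro p hp
    have : ideal K ≤ RingHom.ker (aeval t : MvPolynomial (Fin 5) K →ₐ[K] S) := by
      rw [ideal, Ideal.span_le]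
      rintro _ (rfl | rfl)
      · simpa [q₁, RingHom.mem_ker] using h₁
      · simpa [q₂, RingHom.mem_ker, a] using h₂
    exact this hp)

theorem lift_T {S : Type*} [CommRing S] [Algebra K S] (t : Fin 5 → S) (h₁ h₂) (n : Fin 5) :
    lift (K := K) t h₁ h₂ (T n) = t n := by
  rw [lift, T]
  exact (Ideal.Quotient.liftₐ_apply _ _ _ _).trans (aeval_X _ _)

theorem coordRing_hom_ext {S : Type*} [CommRing S] {f g : CoordRing K →+* S}
    (hC : ∀ r : K, f (algebraMap K _ r) = g (algebraMap K _ r)) (hT : ∀ n, f (T n) = g (T n)) :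
    f = g :=
  Ideal.Quotient.ringHom_ext (MvPolynomial.ringHom_ext hC hT)

theorem coordRing_hom_eq_pow_mul {S : Type*} [CommRing S] {f g : CoordRing K →+* S} {t : S}
    (hC : ∀ r : K, f (algebraMap K _ r) = g (algebraMap K _ r))
    (hT : ∀ n, f (T n) = t * g (T n)) {n : ℕ} {x : CoordRing K} (hx : x ∈ grading K n) :
    f x = t ^ n * g x := by
  obtain ⟨p, hp, rfl⟩ := hx
  exact IsHomogeneous.map_eq_pow_mul hp (f.comp (Ideal.Quotient.mk _))
    (g.comp (Ideal.Quotient.mk _)) t hC hT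

/-- The automorphism of the coordinate ring changing the signs of the coordinates. -/
def signAct (τ : Fin 5 → ℤˣ) : CoordRing K →ₐ[K] CoordRing K :=
  lift (fun n => ((τ n : ℤ) : CoordRing K) * T n)
    (by
      rw [← sum_T_sq]
      refine Finset.sum_congr rfl fun n _ => ?_
      rcases Int.units_eq_one_or (τ n) with h | h <;> (simp [h]; try ring))
    (by
      rw [← sum_a_mul_T_sq]
      refine Finset.sum_congr rfl fun n _ => ?_
      rcases Int.units_eq_one_or (τ n) with h | h <;> (simp [h]; try ring))

theorem signAct_T (τ : Fin 5 → ℤˣ) (n : Fin 5) :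
    signAct τ (T n : CoordRing K) = ((τ n : ℤ) : CoordRing K) * T n := lift_T _ _ _ _

theorem signAct_signAct (σ τ : Fin 5 → ℤˣ) (x : CoordRing K) :
    signAct σ (signAct τ x) = signAct (σ * τ) x := by
  have : (signAct (K := K) σ).toRingHom.comp (signAct (K := K) τ).toRingHom =
      (signAct (K := K) (σ * τ)).toRingHom := by
    refine coordRing_hom_ext (fun r => by simp) fun n => ?_
    simp [signAct_T, mul_assoc, mul_left_comm]
  exact RingHom.congr_fun this x

theorem signAct_one (x : CoordRing K) : signAct 1 x = x := by
  have : (signAct (K := K) 1).toRingHom = RingHom.id _ := by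
    refine coordRing_hom_ext (fun r => by simp) fun n => ?_
    simp [signAct_T]
  exact RingHom.congr_fun this x

theorem signAct_mem (τ : Fin 5 → ℤˣ) {n : ℕ} {x : CoordRing K} (hx : x ∈ grading K n) :
    signAct τ x ∈ grading K n := by
  obtain ⟨p, hp, rfl⟩ := hx
  refine ⟨aeval (fun n => C ((τ n : ℤ) : K) * X n) p, ?_, ?_⟩
  · have := IsHomogeneous.aeval (n := 1) (S := K) hp (fun n => C ((τ n : ℤ) : K) * X n)
      fun n => (zero_add 1) ▸ (isHomogeneous_C _ _).mul (isHomogeneous_X _ _)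
    simpa using this
  · have : ((Ideal.Quotient.mkₐ K (ideal K)).comp (aeval (fun n => C ((τ n : ℤ) : K) * X n))) =
        (signAct τ).comp (Ideal.Quotient.mkₐ K (ideal K)) := by
      refine MvPolynomial.algHom_ext fun n => ?_
      simp only [AlgHom.comp_apply, aeval_X, map_mul]
      refine Eq.trans ?_ (signAct_T τ n).symm
      simp [T]
    exact DFunLike.congr_fun this p

variable (r : Roots K)

/-- The normalized coordinates. -/
def y (n : Fin 5) : CoordRing K := algebraMap K _ (r.c n)⁻¹ * T n

theorem signAct_y (τ : Fin 5 → ℤˣ) (n : Fin 5) :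
    signAct τ (y r n) = ((τ n : ℤ) : CoordRing K) * y r n := by
  rw [y, map_mul, signAct_T, AlgHom.commutes]
  ring

variable [CharZero K]

theorem d_ne_zero' (n : Fin 5) : (d n : K) ≠ 0 := Int.cast_ne_zero.mpr (d_ne_zero n)

theorem c_ne_zero (n : Fin 5) : r.c n ≠ 0 := by
  intro h
  have := r.sq n
  rw [h, zero_pow two_ne_zero] at this
  exact d_ne_zero' n this.symm

theorem T_eq (n : Fin 5) : T n = algebraMap K _ (r.c n) * y r n := by
  rw [y, ← mul_assoc, ← map_mul, mul_inv_cancel₀ (c_ne_zero r n), map_one, one_mul]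

theorem T_sq_eq (n : Fin 5) : T n ^ 2 = (d n : CoordRing K) * y r n ^ 2 := by
  rw [T_eq r, mul_pow, ← map_pow, r.sq, map_intCast]

theorem sum_y_sq : ∑ n, (d n : CoordRing K) * y r n ^ 2 = 0 := by
  rw [← sum_T_sq]
  exact Finset.sum_congr rfl fun n _ => (T_sq_eq r n).symm

theorem sum_a_mul_y_sq : ∑ n, a (CoordRing K) n * (d n : CoordRing K) * y r n ^ 2 = 0 := by
  rw [← sum_a_mul_T_sq]
  exact Finset.sum_congr rfl fun n _ => by rw [T_sq_eq r n, mul_assoc]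

/-- The homomorphism of the projection to the plane. -/
def φ : MvPolynomial (Fin 3) K →ₐ[K] CoordRing K := aeval fun m => powerSum m (y r)

omit [CharZero K] in
theorem φ_X (m : Fin 3) : φ r (X m) = powerSum m (y r) := aeval_X _ _

/-- The cubics in the coordinates of the plane. -/
def cub (n : Fin 5) : MvPolynomial (Fin 3) K := cubic (a _ n) (X 0) (X 1) (X 2)

variable (K) in
/-- The conic in the plane. -/
def δ : MvPolynomial (Fin 3) K := conic (X 0) (X 1) (X 2)

variable (K) in
/-- The line in the plane through the points of the conic with parameters `a i` and `a j`. -/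
def H (i j : Fin 5) : MvPolynomial (Fin 3) K := join (a _ i) (a _ j) (X 0) (X 1) (X 2)

theorem c_mul (n : Fin 5) (m : ℕ) (w : K) (hw : w = 8640 / d n) :
    a (MvPolynomial (Fin 3) K) n ^ m * (C (2 * r.c n)⁻¹ * cub n) ^ 2 * C (4 * 8640) =
      C w * a (MvPolynomial (Fin 3) K) n ^ m * cub n ^ 2 := by
  have : C (2 * r.c n)⁻¹ ^ 2 * C (4 * 8640) = (C w : MvPolynomial (Fin 3) K) := by
    rw [← map_pow, ← map_mul, hw, inv_pow, mul_pow, r.sq]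
    congr 1
    have := d_ne_zero' (K := K) n
    field_simp
    norm_num
  rw [← this]
  ring

/-- The images of the coordinates satisfy the equations of the surface. -/
theorem sum_ψ_sq (m : Fin 2) :
    ∑ n, a (MvPolynomial (Fin 3) K) n ^ (m : ℕ) * (C (2 * r.c n)⁻¹ * cub n) ^ 2 = 0 := by
  have h : (C (4 * 8640) : MvPolynomial (Fin 3) K) ≠ 0 := by
    rw [Ne, C_eq_zero]; norm_num
  apply mul_right_cancel₀ h
  rw [zero_mul, Finset.sum_mul, Fin.sum_univ_five, c_mul r 0 m 64 (by norm_num [d_eq]),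
    c_mul r 1 m (-135) (by norm_num [d_eq]), c_mul r 2 m 120 (by norm_num [d_eq]),
    c_mul r 3 m (-54) (by norm_num [d_eq]), c_mul r 4 m 5 (by norm_num [d_eq]), ← sum_cubic_sq (X 0)
      (X 1) (X 2) m]
  simp only [map_neg, map_ofNat, cub]
  ring

/-- The homomorphism of the parametrization of the surface by cubics. -/
def ψ : CoordRing K →ₐ[K] MvPolynomial (Fin 3) K :=
  lift (fun n => C (2 * r.c n)⁻¹ * cub n) (by simpa using sum_ψ_sq r 0)
    (by simpa using sum_ψ_sq r 1)

theorem ψ_T (n : Fin 5) : ψ r (T n) = C (2 * r.c n)⁻¹ * cub n := lift_T _ _ _ _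

theorem ψ_y (n : Fin 5) : ψ r (y r n) = C (2 * d n : K)⁻¹ * cub n := by
  rw [y, map_mul, ψ_T, AlgHom.commutes, algebraMap_eq, ← mul_assoc, ← map_mul, ← r.sq]
  congr 2
  field_simp

/-- The projection to the plane, after the parametrization, is the identity up to the factor `δ`. -/
theorem ψ_powerSum (m : Fin 3) : ψ r (powerSum m (y r)) = δ K * X m := by
  have h : (C (2 * 8640) : MvPolynomial (Fin 3) K) ≠ 0 := by
    rw [Ne, C_eq_zero]; norm_num
  have h2 : ∀ n, ∀ w : K, w = 8640 / d n → (C (2 * 8640) : MvPolynomial (Fin 3) K) *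
      (a _ n ^ (m : ℕ) * (C (2 * d n : K)⁻¹ * cub n)) = C w * a _ n ^ (m : ℕ) * cub n := by
    intro n w hw
    have : C (2 * 8640) * C (2 * d n : K)⁻¹ = (C w : MvPolynomial (Fin 3) K) := by
      rw [← map_mul, hw]
      congr 1
      have := d_ne_zero' (K := K) n
      field_simp
    rw [← this]
    ring
  have ha : ∀ n, ψ r (a _ n) = a _ n := fun n => by simp [a]
  apply mul_left_cancel₀ h
  simp only [powerSum, map_sum, map_mul, map_pow, ha, ψ_y]
  simp only [← map_mul]
  rw [Finset.mul_sum, Fin.sum_univ_five, h2 0 64 (by norm_num [d_eq]),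
    h2 1 (-135) (by norm_num [d_eq]), h2 2 120 (by norm_num [d_eq]),
    h2 3 (-54) (by norm_num [d_eq]), h2 4 5 (by norm_num [d_eq])]
  have := sum_cubic (X 0 : MvPolynomial (Fin 3) K) (X 1) (X 2) m
  have hX : (![X 0, X 1, X 2] m : MvPolynomial (Fin 3) K) = X m := by fin_cases m <;> rfl
  rw [hX] at this
  simp only [map_mul, map_neg, map_ofNat, cub, δ]
  linear_combination this

omit [CharZero K] in
theorem φ_δ : φ r (δ K) = conic (powerSum 0 (y r)) (powerSum 1 (y r)) (powerSum 2 (y r)) := by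
  simp [δ, conic, φ_X]

theorem φ_cub (n : Fin 5) : φ r (cub n) = 2 * d n * φ r (δ K) * y r n := by
  have := cubic_powerSum (y r) n
  rw [sum_y_sq, sum_a_mul_y_sq, ← φ_δ, mul_zero, mul_zero, add_zero, sub_zero] at this
  rw [← this]
  refine (map_cubic (φ r).toRingHom _ _ _ _).trans ?_
  rw [map_a]
  change cubic _ (φ r (X 0)) (φ r (X 1)) (φ r (X 2)) = _
  rw [φ_X, φ_X, φ_X]
  rfl

/-- The parametrization, after the projection to the plane, is the identity up to the factor `φ δ`.
-/
theorem φ_ψ_T (n : Fin 5) : φ r (ψ r (T n)) = φ r (δ K) * T n := by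
  rw [ψ_T, map_mul, φ_cub, T_eq r, ← algebraMap_eq, AlgHom.commutes]
  have : algebraMap K (CoordRing K) (2 * r.c n)⁻¹ * (2 * d n) = algebraMap K _ (r.c n) := by
    rw [← map_intCast (algebraMap K (CoordRing K)), ← map_ofNat (algebraMap K (CoordRing K)) 2,
      ← map_mul, ← map_mul, ← r.sq]
    congr 1
    have := c_ne_zero r n
    field_simp
  rw [← this]
  ring

omit [CharZero K] in
theorem a_eq (n : Fin 5) : a (MvPolynomial (Fin 3) K) n = C (a K n) := (map_a C n).symm

omit [CharZero K] in
theorem H_eq (i j : Fin 5) : H K i j = C 1 * X 2 + (C (a K i * a K j) * X 0 -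
    C (a K i + a K j) * X 1) := by
  rw [H, join, a_eq, a_eq]
  simp only [map_mul, map_add, map_one]
  ring

omit [CharZero K] in
theorem H_isHomogeneous (i j : Fin 5) : (H K i j).IsHomogeneous 1 := by
  have h : ∀ (c : K) (i : Fin 3), (C c * X i : MvPolynomial (Fin 3) K).IsHomogeneous 1 :=
    fun c i => (zero_add 1) ▸ (isHomogeneous_C _ _).mul (isHomogeneous_X _ _)
  rw [H_eq]
  exact (h _ _).add ((h _ _).sub (h _ _))

omit [CharZero K] in
theorem H_comm (i j : Fin 5) : H K i j = H K j i := join_comm _ _ _ _ _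

omit [CharZero K] in
theorem δ_isHomogeneous : (δ K).IsHomogeneous 2 :=
  ((isHomogeneous_X _ 0).mul (isHomogeneous_X _ 2)).sub ((isHomogeneous_X _ 1).pow 2)

omit [CharZero K] in
theorem cub_isHomogeneous (n : Fin 5) : (cub n : MvPolynomial (Fin 3) K).IsHomogeneous 3 := by
  have h : Distinct (n + 1) (n + 2) (n + 3) (n + 4) n := by revert n; decide
  have hC : (C ((a K n - a K (n + 3)) * (a K n - a K (n + 4))) *
      (δ K * H K (n + 1) (n + 2))).IsHomogeneous 3 :=
    (isHomogeneous_C _ _).mul (δ_isHomogeneous.mul (H_isHomogeneous _ _))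
  rw [cub, cubic_eq h]
  simp only [map_mul, map_sub, ← a_eq] at hC
  exact hC.sub (((H_isHomogeneous _ _).mul (H_isHomogeneous _ _)).mul (H_isHomogeneous _ _))

omit [CharZero K] in
/-- Lines in the plane, in the coordinates of a point. -/
theorem eval_H (v : Fin 3 → K) (i j : Fin 5) :
    eval v (H K i j) = join (a K i) (a K j) (v 0) (v 1) (v 2) := by
  refine (map_join (eval v) _ _ _ _ _).trans ?_
  simp [map_a]

omit [CharZero K] in
theorem eval_δ (v : Fin 3 → K) : eval v (δ K) = conic (v 0) (v 1) (v 2) := by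
  refine (map_conic (eval v) _ _ _).trans ?_
  simp

omit [CharZero K] in
theorem H_prime (i j : Fin 5) : Prime (H K i j) := by
  rw [← irreducible_iff_prime, H_eq]
  refine irreducible_mul_X_add _ _ _ (by simp) (by simp) (fun h => ?_)
    (fun x hx _ => isUnit_of_dvd_unit hx (by simp))
  have := vars_sub_subset _ h
  rw [Finset.mem_union] at this
  rcases this with h | h <;>
  · have := vars_mul _ _ h
    rw [vars_C, vars_X, Finset.mem_union] at this
    simp at this

omit [CharZero K] in
theorem δ_prime : Prime (δ K) := by
  have : δ K = X 0 * X 2 + -(X 1 ^ 2) := by rw [δ, conic]; ring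
  rw [← irreducible_iff_prime, this]
  refine irreducible_mul_X_add _ _ _ (X_ne_zero _) (by simp [vars_X]) (by
    rw [vars_neg]
    intro h
    have := vars_pow _ _ h
    simp [vars_X] at this) ?_
  have h0 : Irreducible (X 0 : MvPolynomial (Fin 3) K) := (X_prime).irreducible
  refine (h0.isRelPrime_iff_not_dvd).mpr fun h => ?_
  rw [dvd_neg] at h
  have h1 := (X_prime (R := K) (i := (0 : Fin 3))).dvd_of_dvd_pow h
  rw [X_dvd_X] at h1
  simp at h1

omit [CharZero K] in
theorem φ_mem {n : ℕ} {F : MvPolynomial (Fin 3) K} (hF : F.IsHomogeneous n) :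
    φ r F ∈ grading K n := by
  have h : ∀ m : ℕ, (∑ n, C (a K n ^ m * (r.c n)⁻¹) * X n :
    MvPolynomial (Fin 5) K).IsHomogeneous 1 :=
    fun m => IsHomogeneous.sum _ _ _ fun n _ =>
      (zero_add 1) ▸ (isHomogeneous_C _ _).mul (isHomogeneous_X _ _)
  refine ⟨aeval (fun m : Fin 3 => ∑ n, C (a K n ^ (m : ℕ) * (r.c n)⁻¹) * X n) F, ?_, ?_⟩
  · simpa using hF.aeval _ fun m => h m
  · have : ((Ideal.Quotient.mkₐ K (ideal K)).comp (aeval (fun m : Fin 3 =>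
        ∑ n, C (a K n ^ (m : ℕ) * (r.c n)⁻¹) * X n))) = φ r := by
      refine MvPolynomial.algHom_ext fun m => ?_
      rw [AlgHom.comp_apply, aeval_X, φ_X, map_sum]
      refine Finset.sum_congr rfl fun n _ => ?_
      simp only [map_mul, map_pow, ← algebraMap_eq, AlgHom.commutes, y, map_a]
      rw [mul_assoc]
      rfl
    exact DFunLike.congr_fun this F

theorem ψ_mem {n : ℕ} {x : CoordRing K} (hx : x ∈ grading K n) :
    (ψ r x).IsHomogeneous (3 * n) := by
  obtain ⟨p, hp, rfl⟩ := hx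
  have : (ψ r).comp (Ideal.Quotient.mkₐ K (ideal K)) =
      aeval fun n => C (2 * r.c n)⁻¹ * cub n := by
    refine MvPolynomial.algHom_ext fun m => ?_
    rw [AlgHom.comp_apply, aeval_X]
    exact ψ_T r m
  change (((ψ r).comp (Ideal.Quotient.mkₐ K (ideal K))) p).IsHomogeneous _
  rw [this]
  refine IsHomogeneous.aeval hp _ fun n => ?_
  have := (isHomogeneous_C (Fin 3) (2 * r.c n)⁻¹).mul (cub_isHomogeneous n)
  rwa [zero_add] at this

theorem ψ_φ {n : ℕ} {F : MvPolynomial (Fin 3) K} (hF : F.IsHomogeneous n) :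
    ψ r (φ r F) = δ K ^ n * F :=
  hF.map_eq_pow_mul ((ψ r).comp (φ r)).toRingHom (RingHom.id _) (δ K)
    (fun t => ((ψ r).comp (φ r)).commutes t)
    (fun m => (congrArg (ψ r) (φ_X r m)).trans (ψ_powerSum r m))

theorem φ_ψ {n : ℕ} {x : CoordRing K} (hx : x ∈ grading K n) :
    φ r (ψ r x) = φ r (δ K) ^ n * x :=
  coordRing_hom_eq_pow_mul (f := ((φ r).comp (ψ r)).toRingHom) (g := RingHom.id _)
    (fun t => ((φ r).comp (ψ r)).commutes t) (φ_ψ_T r) hx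

/-- The chart of the surface given by the projection to the plane composed with a change of
signs. -/
def chart (τ : Fin 5 → ℤˣ) : PlaneChart (grading K) where
  φ := (signAct τ).toRingHom.comp (φ r).toRingHom
  ψ := (ψ r).toRingHom.comp (signAct τ).toRingHom
  δ := δ K
  φ_mem n F hF := signAct_mem τ (φ_mem r hF)
  ψ_mem n a ha := ψ_mem r (signAct_mem τ ha)
  ψ_φ n F hF := by
    change ψ r (signAct τ (signAct τ (φ r F))) = _
    rw [signAct_signAct, ← sq, show τ ^ 2 = 1 from funext fun n => Int.units_sq _, signAct_one,
      ψ_φ r hF]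
  φ_ψ n a ha := by
    change signAct τ (φ r (ψ r (signAct τ a))) = _
    rw [φ_ψ r (signAct_mem τ ha), map_mul, map_pow, signAct_signAct, ← sq,
      show τ ^ 2 = 1 from funext fun n => Int.units_sq _, signAct_one]
    rfl
  δ_hom := δ_isHomogeneous
  δ_prime := δ_prime

theorem chart_φ (τ : Fin 5 → ℤˣ) (F) : (chart r τ).φ F = signAct τ (φ r F) := rfl

theorem chart_ψ (τ : Fin 5 → ℤˣ) (x) : (chart r τ).ψ x = ψ r (signAct τ x) := rfl

theorem chart_δ (τ : Fin 5 → ℤˣ) : (chart r τ).δ = δ K := rfl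

omit [CharZero K] in
theorem a_ne [CharZero K] {i j : Fin 5} (h : i ≠ j) : a K i ≠ a K j := by
  have : ∀ i j : Fin 5, i ≠ j → coeffs i ≠ coeffs j := by decide
  exact Nat.cast_injective.ne (this i j h)

/-! ### The factorization of the transition maps between the projections -/

theorem sum_distinct {S : Type*} [AddCommMonoid S] {i j k l n : Fin 5} (h : Distinct i j k l n)
    (f : Fin 5 → S) : ∑ m, f m = f i + f j + f k + f l + f n := by
  have hu : (Finset.univ : Finset (Fin 5)) = [i, j, k, l, n].toFinset :=
    (Finset.eq_univ_of_card _ (by rw [List.toFinset_card_of_nodup h]; rfl)).symm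
  rw [hu, List.sum_toFinset _ h]
  simp [add_assoc]

omit [CharZero K] in
theorem signAct_φ_H (τ : Fin 5 → ℤˣ) (i j : Fin 5) : signAct τ (φ r (H K i j)) =
    ∑ m, (a _ m - a _ i) * (a _ m - a _ j) * ((τ m : ℤ) : CoordRing K) * y r m := by
  have h1 : φ r (H K i j) = ∑ m, (a _ m - a _ i) * (a _ m - a _ j) * y r m := by
    refine (map_join (φ r).toRingHom _ _ _ _ _).trans ?_
    rw [map_a, map_a]
    change join _ _ (φ r (X 0)) (φ r (X 1)) (φ r (X 2)) = _
    rw [φ_X, φ_X, φ_X]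
    simp only [join, powerSum, Finset.mul_sum, ← Finset.sum_add_distrib, ← Finset.sum_sub_distrib]
    refine Finset.sum_congr rfl fun m _ => ?_
    simp
    ring
  rw [h1, map_sum]
  refine Finset.sum_congr rfl fun m _ => ?_
  have ha : ∀ n, signAct τ (a (CoordRing K) n) = a _ n := map_a (signAct τ).toRingHom
  rw [map_mul, map_mul, map_sub, map_sub, ha, ha, ha, signAct_y]
  ring

omit [CharZero K] in
theorem isUnit_C {s : K} (h : s ≠ 0) : IsUnit (C s : MvPolynomial (Fin 3) K) :=
  (isUnit_iff_ne_zero.mpr h).map C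

omit [CharZero K] in
theorem associated_of_C_mul_eq {s t : K} (hs : s ≠ 0) (ht : t ≠ 0) {F G : MvPolynomial (Fin 3) K}
    (h : C s * F = C t * G) : Associated F G :=
  (associated_unit_mul_left F _ (isUnit_C hs)).symm.trans
    (h ▸ associated_unit_mul_left G _ (isUnit_C ht))

theorem units_ne_zero (u : ℤˣ) : ((u : ℤ) : K) ≠ 0 := Int.cast_ne_zero.mpr u.ne_zero

variable {i j k l n : Fin 5} (h : Distinct i j k l n) {τ : Fin 5 → ℤˣ}

include h in
/-- The line through the `i`-th and the `j`-th point in another chart, if the change of signs is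
constant outside `i` and `j`: it is the same line. -/
theorem ψ_signAct_H_of_eq (h₁ : τ k = τ l) (h₂ : τ n = τ l) :
    Associated (ψ r (signAct τ (φ r (H K i j)))) (δ K * H K i j) := by
  have h3 : signAct τ (φ r (H K i j)) = algebraMap K _ ((τ l : ℤ) : K) * φ r (H K i j) := by
    have h4 := signAct_φ_H r 1 i j
    rw [signAct_one] at h4
    rw [signAct_φ_H, h4, sum_distinct h, sum_distinct h, h₁, h₂]
    simp
    ring
  rw [h3, map_mul, AlgHom.commutes, ψ_φ r (H_isHomogeneous i j), pow_one, algebraMap_eq]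
  exact associated_unit_mul_left _ _ (isUnit_C (units_ne_zero _))

include h in
/-- The line through the `i`-th and the `j`-th point in another chart, if the change of signs is not
constant outside `i` and `j`: its pullback is a cubic consisting of three lines. -/
theorem ψ_signAct_H_of_ne (h₁ : τ k = τ l) (h₂ : τ n = -τ l) :
    Associated (ψ r (signAct τ (φ r (H K i j)))) (H K i n * H K j n * H K k l) := by
  have h3 : signAct τ (φ r (H K i j)) = algebraMap K _ ((τ l : ℤ) : K) * (φ r (H K i j) -
      2 * (a _ n - a _ i) * (a _ n - a _ j) * y r n) := by
    have h4 := signAct_φ_H r 1 i j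
    rw [signAct_one] at h4
    rw [signAct_φ_H, h4, sum_distinct h, sum_distinct h, h₁, h₂]
    simp
    ring
  have ha : ∀ n, ψ r (a (CoordRing K) n) = a _ n := map_a (ψ r).toRingHom
  have hd : (d n : K) = _ := (esymm h).2.2.2.2
  have h4 : (a K n - a K k) * (a K n - a K l) ≠ 0 := by
    intro h0
    exact d_ne_zero' (K := K) n (by rw [hd, mul_assoc, h0, mul_zero])
  refine associated_of_C_mul_eq h4 (units_ne_zero (τ l)) ?_
  have h5 : ψ r (2 * (a _ n - a _ i) * (a _ n - a _ j) * y r n) =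
      C ((a K n - a K k) * (a K n - a K l))⁻¹ * cub n := by
    simp only [map_mul, map_sub, ha, ψ_y]
    rw [← mul_assoc]
    congr 1
    have := d_ne_zero' (K := K) n
    have h2 : ψ r 2 = C 2 := (map_ofNat (ψ r).toRingHom 2).trans (map_ofNat C 2).symm
    rw [h2, a_eq, a_eq, a_eq,
      ← map_sub, ← map_sub, ← map_mul, ← map_mul, ← map_mul]
    congr 1
    apply eq_inv_of_mul_eq_one_left
    field_simp
    rw [hd]
  have h6 : (cub n : MvPolynomial (Fin 3) K) = _ := cubic_eq h _ _ _
  have h7 : C ((a K n - a K k) * (a K n - a K l)) * C ((a K n - a K k) * (a K n - a K l))⁻¹ =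
      (1 : MvPolynomial (Fin 3) K) := by
    rw [← map_mul, mul_inv_cancel₀ h4, map_one]
  rw [h3, map_mul (ψ r), AlgHom.commutes, map_sub (ψ r), h5, ψ_φ r (H_isHomogeneous i j), pow_one,
    algebraMap_eq]
  have h8 : C ((a K n - a K k) * (a K n - a K l)) * (δ K * H K i j) - cub n =
      H K i n * H K j n * H K k l := by
    rw [h6, map_mul, map_sub, map_sub, ← a_eq, ← a_eq, ← a_eq]
    simp only [δ, H]
    ring
  rw [← h8]
  linear_combination (-C ((τ l : ℤ) : K) * cub n) * h7

omit [CharZero K] in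
theorem signAct_φ_δ (τ : Fin 5 → ℤˣ) : signAct τ (φ r (δ K)) =
    conic (powerSum 0 fun m => ((τ m : ℤ) : CoordRing K) * y r m)
      (powerSum 1 fun m => ((τ m : ℤ) : CoordRing K) * y r m)
      (powerSum 2 fun m => ((τ m : ℤ) : CoordRing K) * y r m) := by
  rw [φ_δ]
  refine (map_conic (signAct τ).toRingHom _ _ _).trans ?_
  simp only [map_powerSum]
  change conic (powerSum 0 fun n => signAct τ (y r n)) (powerSum 1 fun n => signAct τ (y r n))
    (powerSum 2 fun n => signAct τ (y r n)) = _
  simp only [signAct_y]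

/-- The image of `2 * y n` under the parametrization. -/
def z (n : Fin 5) : MvPolynomial (Fin 3) K := C (d n : K)⁻¹ * cub n

theorem d_mul_z (n : Fin 5) : (d n : MvPolynomial (Fin 3) K) * z n = cub n := by
  rw [z, ← mul_assoc, ← map_intCast (C : K →+* MvPolynomial (Fin 3) K), ← map_mul,
    mul_inv_cancel₀ (d_ne_zero' n), map_one, one_mul]

theorem ψ_y' (n : Fin 5) : 2 * ψ r (y r n) = z n := by
  rw [ψ_y, z, ← mul_assoc, ← map_ofNat (C : K →+* MvPolynomial (Fin 3) K) 2, ← map_mul]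
  congr 2
  have := d_ne_zero' (K := K) n
  field_simp

include h in
theorem ψ_signAct_powerSum_one (h₁ : τ j = τ i) (h₂ : τ k = τ i) (h₃ : τ l = τ i)
    (h₄ : τ n = - τ i) (m : Fin 3) : ψ r (powerSum m fun m => ((τ m : ℤ) : CoordRing K) * y r m) =
      C ((τ i : ℤ) : K) * (δ K * X m - a _ n ^ (m : ℕ) * z n) := by
  rw [← ψ_powerSum r m, ← ψ_y' r]
  have ha : ∀ n, ψ r (a (CoordRing K) n) = a _ n := map_a (ψ r).toRingHom
  simp only [powerSum, sum_distinct h, map_add, map_mul, map_pow, ha, h₁, h₂, h₃, h₄]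
  simp
  ring

include h in
theorem ψ_signAct_powerSum_two (h₁ : τ i = - τ l) (h₂ : τ j = - τ l) (h₃ : τ k = τ l)
    (h₄ : τ n = τ l) (m : Fin 3) : ψ r (powerSum m fun m => ((τ m : ℤ) : CoordRing K) * y r m) =
      C ((τ l : ℤ) : K) * (δ K * X m - a _ i ^ (m : ℕ) * z i - a _ j ^ (m : ℕ) * z j) := by
  rw [← ψ_powerSum r m, ← ψ_y' r, ← ψ_y' r]
  have ha : ∀ n, ψ r (a (CoordRing K) n) = a _ n := map_a (ψ r).toRingHom
  simp only [powerSum, sum_distinct h, map_add, map_mul, map_pow, ha, h₁, h₂, h₃, h₄]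
  simp
  ring

omit [CharZero K] in
theorem C_units_sq (u : ℤˣ) : (C ((u : ℤ) : K) : MvPolynomial (Fin 3) K) ^ 2 = 1 := by
  rcases Int.units_eq_one_or u with h | h <;> simp [h]

theorem ψ_signAct_δ_eq (τ : Fin 5 → ℤˣ) : ψ r (signAct τ (φ r (δ K))) =
    conic (ψ r (powerSum (0 : Fin 3) fun m => ((τ m : ℤ) : CoordRing K) * y r m))
      (ψ r (powerSum (1 : Fin 3) fun m => ((τ m : ℤ) : CoordRing K) * y r m))
      (ψ r (powerSum (2 : Fin 3) fun m => ((τ m : ℤ) : CoordRing K) * y r m)) := by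
  rw [signAct_φ_δ]
  exact map_conic (ψ r).toRingHom _ _ _

include h in
/-- The conic of the chart which differs by the change of the sign of one coordinate `n`. -/
theorem ψ_signAct_δ_one (h₁ : τ j = τ i) (h₂ : τ k = τ i) (h₃ : τ l = τ i)
    (h₄ : τ n = - τ i) : Associated (ψ r (signAct τ (φ r (δ K))))
      (δ K * (H K i n * H K j n * H K k n * H K l n)) := by
  refine associated_of_C_mul_eq (d_ne_zero' n) one_ne_zero ?_
  rw [ψ_signAct_δ_eq, ψ_signAct_powerSum_one r h h₁ h₂ h₃ h₄,
    ψ_signAct_powerSum_one r h h₁ h₂ h₃ h₄,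
    ψ_signAct_powerSum_one r h h₁ h₂ h₃ h₄, map_one, one_mul, map_intCast]
  have h5 := conic_sq_sub h (X 0 : MvPolynomial (Fin 3) K) (X 1) (X 2)
  have h6 := d_mul_z (K := K) n
  have h7 := C_units_sq (K := K) (τ i)
  change _ = δ K * (join _ _ _ _ _ * join _ _ _ _ _ * join _ _ _ _ _ * join _ _ _ _ _)
  rw [← h5]
  change _ = δ K * ((d n : MvPolynomial (Fin 3) K) * δ K ^ 2 - cub n * _)
  rw [← h6]
  have h8 : δ K = X 0 * X 2 - X 1 ^ 2 := rfl
  have h9 : ∀ t : MvPolynomial (Fin 3) K, conic (t * (δ K * X 0 - a _ n ^ 0 * z n))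
      (t * (δ K * X 1 - a _ n ^ 1 * z n)) (t * (δ K * X 2 - a _ n ^ 2 * z n)) =
      t ^ 2 * (δ K * (δ K ^ 2 - z n * join (a _ n) (a _ n) (X 0) (X 1) (X 2))) := by
    intro t
    simp only [conic, join]
    linear_combination (-t ^ 2 * δ K ^ 2) * h8
  refine (congrArg _ (h9 _)).trans ?_
  rw [h7]
  ring

include h in
/-- The conic of the chart which differs by the changes of the signs of two coordinates `i` and `j`.
-/
theorem ψ_signAct_δ_two (h₁ : τ i = - τ l) (h₂ : τ j = - τ l) (h₃ : τ k = τ l)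
    (h₄ : τ n = τ l) : Associated (ψ r (signAct τ (φ r (δ K))))
      (H K i j ^ 3 * H K k l * H K k n * H K l n) := by
  have hij : i ≠ j := by rintro rfl; simp [Distinct] at h
  refine associated_of_C_mul_eq (mul_ne_zero (d_ne_zero' i) (d_ne_zero' j))
    (pow_ne_zero 2 (sub_ne_zero.mpr (a_ne hij))) ?_
  rw [ψ_signAct_δ_eq, ψ_signAct_powerSum_two r h h₁ h₂ h₃ h₄,
    ψ_signAct_powerSum_two r h h₁ h₂ h₃ h₄,
    ψ_signAct_powerSum_two r h h₁ h₂ h₃ h₄, map_mul, map_pow, map_sub, map_intCast, map_intCast,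
    ← a_eq, ← a_eq]
  have h5 := conic_cube_sub h (X 0 : MvPolynomial (Fin 3) K) (X 1) (X 2) δ_prime.ne_zero
  refine Eq.trans ?_ h5
  change _ = (d i : MvPolynomial (Fin 3) K) * (d j : MvPolynomial (Fin 3) K) * δ K ^ 3 -
    δ K * (d j : MvPolynomial (Fin 3) K) * (cub i * _) -
    δ K * (d i : MvPolynomial (Fin 3) K) * (cub j * _) +
    _ * (cub i * cub j)
  rw [← d_mul_z, ← d_mul_z]
  have h7 := C_units_sq (K := K) (τ l)
  have h8 : δ K = X 0 * X 2 - X 1 ^ 2 := rfl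
  have h9 : ∀ t u v : MvPolynomial (Fin 3) K, conic (t * (δ K * X 0 - a _ i ^ 0 * u -
    a _ j ^ 0 * v))
      (t * (δ K * X 1 - a _ i ^ 1 * u - a _ j ^ 1 * v))
      (t * (δ K * X 2 - a _ i ^ 2 * u - a _ j ^ 2 * v)) =
      t ^ 2 * (δ K ^ 3 - δ K * (u * join (a _ i) (a _ i) (X 0) (X 1) (X 2)) -
        δ K * (v * join (a _ j) (a _ j) (X 0) (X 1) (X 2)) + (a _ i - a _ j) ^ 2 * (u * v)) := by
    intro t u v
    simp only [conic, join]
    linear_combination (-t ^ 2 * δ K ^ 2) * h8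
  refine (congrArg _ (h9 _ _ _)).trans ?_
  rw [h7]
  ring

theorem ψ_signAct_δ_of_eq (h₁ : ∀ m, τ m = τ 0) :
    Associated (ψ r (signAct τ (φ r (δ K)))) (δ K ^ 3) := by
  refine associated_of_C_mul_eq one_ne_zero one_ne_zero ?_
  congr 1
  have h2 : ∀ m : Fin 3, ψ r (powerSum m fun m => ((τ m : ℤ) : CoordRing K) * y r m) =
      C ((τ 0 : ℤ) : K) * (δ K * X m) := by
    intro m
    rw [← ψ_powerSum r m]
    have ha : ∀ n, ψ r (a (CoordRing K) n) = a _ n := map_a (ψ r).toRingHom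
    simp only [powerSum, map_sum, Finset.mul_sum, map_mul, map_pow, ha]
    refine Finset.sum_congr rfl fun n _ => ?_
    rw [h₁ n]
    simp
    ring
  rw [ψ_signAct_δ_eq, h2, h2, h2]
  have h7 := C_units_sq (K := K) (τ 0)
  have h8 : δ K = X 0 * X 2 - X 1 ^ 2 := rfl
  simp only [conic]
  linear_combination (δ K ^ 3) * h7 - (C ((τ 0 : ℤ) : K)) ^ 2 * δ K ^ 2 * h8

end
end TwoQuadrics

/-! ### The generic points of the lines and the orders along them -/

namespace TwoQuadrics

open MvPolynomial

noncomputable section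

/-- The change of the sign of the `i`-th coordinate. -/
def flip (i : Fin 5) : Fin 5 → ℤˣ := fun j => if j = i then -1 else 1

theorem sign_mul_self (τ : Fin 5 → ℤˣ) : τ * τ = 1 := funext fun n => by
  rw [Pi.mul_apply, ← sq, Int.units_sq]; rfl

/-- The indicator of `{i, j} = {0, 1}`. -/
def isFirst (i j : Fin 5) : ℕ := if (i = 0 ∧ j = 1) ∨ (i = 1 ∧ j = 0) then 1 else 0

theorem isFirst_of_flip : ∀ i j : Fin 5, i ≠ j → ∀ k, k ≠ i → k ≠ j → ∀ l, l ≠ i → l ≠ j →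
    l ≠ k → ∀ n, n ≠ i → n ≠ j → n ≠ k → n ≠ l →
    ((flip 0 * flip 1) k = (flip 0 * flip 1) l → (flip 0 * flip 1) n = (flip 0 * flip 1) l →
      isFirst i j = 1) ∧
    (¬ ((flip 0 * flip 1) k = (flip 0 * flip 1) l ∧ (flip 0 * flip 1) n = (flip 0 * flip 1) l) →
      isFirst i j = 0) := by
  decide

theorem isFirst_add_of_flip : ∀ i j : Fin 5, i ≠ j → ∀ k, k ≠ i → k ≠ j → ∀ l, l ≠ i → l ≠ j →
    l ≠ k → ∀ n, n ≠ i → n ≠ j → n ≠ k → n ≠ l →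
    ((flip 0 * flip 1) k = (flip 0 * flip 1) l → (flip 0 * flip 1) n = -(flip 0 * flip 1) l →
      isFirst i n + isFirst j n + isFirst k l = 1) ∧
    (¬ ((flip 0 * flip 1) k = (flip 0 * flip 1) l ∧ (flip 0 * flip 1) n = -(flip 0 * flip 1) l) →
      isFirst i n + isFirst j n + isFirst k l = 0) := by
  decide

theorem exists_distinct {i j : Fin 5} (h : i ≠ j) : ∃ k l n, Distinct i j k l n := by
  have hc : ({i, j}ᶜ : Finset (Fin 5)).card = 3 := by
    rw [Finset.card_compl, Finset.card_pair h]; rfl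
  obtain ⟨k, l, n, hkl, hkn, hln, hs⟩ := Finset.card_eq_three.mp hc
  have hm : ∀ m, m ∈ ({k, l, n} : Finset (Fin 5)) → m ≠ i ∧ m ≠ j := fun m hm => by
    rw [← hs] at hm; simpa using hm
  have hk := hm k (by simp)
  have hl := hm l (by simp)
  have hn := hm n (by simp)
  refine ⟨k, l, n, ?_⟩
  simp only [Distinct, List.nodup_cons, List.mem_cons, not_or, List.not_mem_nil]
  tauto

theorem sign_cases_aux : ∀ a b c d e : ℤˣ, (∀ m, ![a, b, c, d, e] m = ![a, b, c, d, e] 0) ∨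
    (∃ n, ∀ m, m ≠ n → ![a, b, c, d, e] m = - ![a, b, c, d, e] n) ∨
    (∃ i j, i ≠ j ∧ ![a, b, c, d, e] i = ![a, b, c, d, e] j ∧
      ∀ m, m ≠ i → m ≠ j → ![a, b, c, d, e] m = - ![a, b, c, d, e] i) := by
  decide

/-- Up to a common sign, a sign vector changes none, one or two of the signs. -/
theorem sign_cases (τ : Fin 5 → ℤˣ) : (∀ m, τ m = τ 0) ∨
    (∃ n, ∀ m, m ≠ n → τ m = - τ n) ∨
    (∃ i j, i ≠ j ∧ τ i = τ j ∧ ∀ m, m ≠ i → m ≠ j → τ m = - τ i) := by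
  have := sign_cases_aux (τ 0) (τ 1) (τ 2) (τ 3) (τ 4)
  have h : ![τ 0, τ 1, τ 2, τ 3, τ 4] = τ := by
    funext m; fin_cases m <;> rfl
  rwa [h] at this

variable {K : Type u} [Field K] [CharZero K]

theorem H_not_dvd_δ (i j : Fin 5) : ¬ H K i j ∣ δ K := by
  rintro ⟨F, hF⟩
  have := congrArg (eval ![0, 1, a K i + a K j]) hF
  rw [map_mul, eval_H, eval_δ] at this
  simp [join, conic] at this

/-- The lines joining different pairs of points are different: a line meets the conic exactly in the
two points which it joins. -/
theorem H_dvd_H {i j k l : Fin 5} (hij : i ≠ j) (h : H K i j ∣ H K k l) :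
    (i = k ∨ i = l) ∧ (j = k ∨ j = l) := by
  obtain ⟨F, hF⟩ := h
  have key : ∀ m, m = i ∨ m = j → m = k ∨ m = l := by
    intro m hm
    have := congrArg (eval ![1, a K m, a K m ^ 2]) hF
    rw [map_mul, eval_H, eval_H] at this
    have h1 : ∀ s t : K, join s t 1 (a K m) (a K m ^ 2) = (a K m - s) * (a K m - t) := by
      intro s t; simp only [join]; ring
    simp only [Matrix.cons_val] at this
    rw [h1, h1] at this
    have h2 : (a K m - a K i) * (a K m - a K j) = 0 := by
      rcases hm with rfl | rfl <;> simp
    rw [h2, zero_mul, mul_eq_zero, sub_eq_zero, sub_eq_zero] at this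
    by_contra hne
    rw [not_or] at hne
    exact this.elim (a_ne hne.1) (a_ne hne.2)
  exact ⟨key i (Or.inl rfl), key j (Or.inr rfl)⟩

theorem multiplicity_H {i j : Fin 5} (hij : i ≠ j) :
    multiplicity (H K 0 1) (H K i j) = isFirst i j := by
  rw [isFirst]
  split_ifs with h
  · rcases h with ⟨rfl, rfl⟩ | ⟨rfl, rfl⟩
    · exact multiplicity_self
    · rw [H_comm 1 0]; exact multiplicity_self
  · refine multiplicity_eq_zero.mpr fun hd => h ?_
    obtain ⟨h1, h2⟩ := H_dvd_H (by decide) hd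
    have : ∀ i j : Fin 5, i ≠ j → (0 = i ∨ 0 = j) → (1 = i ∨ 1 = j) →
        (i = 0 ∧ j = 1) ∨ (i = 1 ∧ j = 0) := by decide
    exact this i j hij h1 h2

omit [CharZero K] in
theorem multiplicity_mul_H {F G : MvPolynomial (Fin 3) K} (hF : F ≠ 0) (hG : G ≠ 0) :
    multiplicity (H K 0 1) (F * G) = multiplicity (H K 0 1) F + multiplicity (H K 0 1) G :=
  multiplicity_mul (H_prime 0 1) (FiniteMultiplicity.of_prime_left (H_prime 0 1)
    (mul_ne_zero hF hG))

omit [CharZero K] in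
theorem multiplicity_congr {p F G : MvPolynomial (Fin 3) K} (h : Associated F G) :
    multiplicity p F = multiplicity p G := by
  rw [multiplicity, multiplicity, emultiplicity_eq_of_associated_right h]

theorem multiplicity_H_δ : multiplicity (H K 0 1) (δ K) = 0 :=
  multiplicity_eq_zero.mpr (H_not_dvd_δ 0 1)

theorem isCurve_H (r : Roots K) (τ : Fin 5 → ℤˣ) (i j : Fin 5) :
    (chart r τ).IsCurve (H K i j) :=
  ⟨H_prime i j, ⟨1, H_isHomogeneous i j⟩, H_not_dvd_δ i j⟩

variable (r : Roots K)

/-- The order along the line with sign vector `ε`: this line is the curve `H 0 1 = 0` in the chart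
with the first two signs changed. -/
def lineOrd (ε : Fin 5 → ℤˣ) (x : CoordRing K) : ℕ :=
  (chart r (ε * (flip 0 * flip 1))).ord (H K 0 1) x

theorem lineOrd_eq (ε : Fin 5 → ℤˣ) (x : CoordRing K) : lineOrd r ε x =
    multiplicity (H K 0 1) (ψ r (signAct (ε * (flip 0 * flip 1)) x)) := rfl

theorem lineOrd_signAct (ε τ : Fin 5 → ℤˣ) (x : CoordRing K) :
    lineOrd r ε (signAct τ x) = lineOrd r (ε * τ) x := by
  rw [lineOrd_eq, lineOrd_eq, signAct_signAct, mul_right_comm]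

/-- The hyperplane `φ (H i j) = 0` contains the line with signs `ε` if and only if `ε` is constant
outside `i` and `j`, and its order along each line which it contains is one. -/
theorem lineOrd_φ_H (ε : Fin 5 → ℤˣ) {i j k l n : Fin 5} (h : Distinct i j k l n) :
    lineOrd r ε (φ r (H K i j)) = if ε k = ε l ∧ ε n = ε l then 1 else 0 := by
  -- two of the three signs of the transition map outside `i`, `j` agree
  have key : ∀ {k l n : Fin 5}, Distinct i j k l n →
      (ε * (flip 0 * flip 1)) k = (ε * (flip 0 * flip 1)) l →
      lineOrd r ε (φ r (H K i j)) = if ε k = ε l ∧ ε n = ε l then 1 else 0 := by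
    intro k l n h hkl
    obtain ⟨⟨hij, hik, hil, hin⟩, ⟨hjk, hjl, hjn⟩, ⟨hkl', hkn⟩, hln⟩ := h.ne
    have c1 := isFirst_of_flip i j hij k (Ne.symm hik) (Ne.symm hjk) l (Ne.symm hil) (Ne.symm hjl)
      (Ne.symm hkl') n (Ne.symm hin) (Ne.symm hjn) (Ne.symm hkn) (Ne.symm hln)
    have c2 := isFirst_add_of_flip i j hij k (Ne.symm hik) (Ne.symm hjk) l (Ne.symm hil)
      (Ne.symm hjl) (Ne.symm hkl') n (Ne.symm hin) (Ne.symm hjn) (Ne.symm hkn) (Ne.symm hln)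
    rw [lineOrd_eq]
    have hk' := hkl
    rw [Pi.mul_apply, Pi.mul_apply ε _ l] at hk'
    by_cases hn : (ε * (flip 0 * flip 1)) n = (ε * (flip 0 * flip 1)) l
    · rw [multiplicity_congr (ψ_signAct_H_of_eq r h hkl hn),
        multiplicity_mul_H δ_prime.ne_zero (H_prime _ _).ne_zero, multiplicity_H_δ, zero_add,
        multiplicity_H hij]
      rw [Pi.mul_apply, Pi.mul_apply ε _ l] at hn
      split_ifs with hs
      · rw [hs.1, mul_right_inj] at hk'
        rw [hs.2, mul_right_inj] at hn
        exact c1.1 hk' hn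
      · refine c1.2 fun hf => hs ?_
        rw [hf.1, mul_left_inj] at hk'
        rw [hf.2, mul_left_inj] at hn
        exact ⟨hk', hn⟩
    · replace hn : (ε * (flip 0 * flip 1)) n = -(ε * (flip 0 * flip 1)) l :=
        (Int.units_ne_iff_eq_neg).mp hn
      rw [multiplicity_congr (ψ_signAct_H_of_ne r h hkl hn),
        multiplicity_mul_H (mul_ne_zero (H_prime _ _).ne_zero (H_prime _ _).ne_zero)
          (H_prime _ _).ne_zero,
        multiplicity_mul_H (H_prime _ _).ne_zero (H_prime _ _).ne_zero,
        multiplicity_H hin, multiplicity_H hjn, multiplicity_H hkl']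
      rw [Pi.mul_apply, Pi.mul_apply ε _ l, ← mul_neg] at hn
      split_ifs with hs
      · rw [hs.1, mul_right_inj] at hk'
        rw [hs.2, mul_right_inj] at hn
        exact c2.1 hk' hn
      · refine c2.2 fun hf => hs ?_
        rw [hf.1, mul_left_inj] at hk'
        rw [hf.2, mul_left_inj] at hn
        exact ⟨hk', hn⟩
  have pig : ∀ s t u : ℤˣ, s = t ∨ t = u ∨ u = s := by decide
  rcases pig ((ε * (flip 0 * flip 1)) k) ((ε * (flip 0 * flip 1)) l)
    ((ε * (flip 0 * flip 1)) n) with h1 | h1 | h1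
  · exact key h h1
  · rw [key h.rotate h1]
    exact if_congr ⟨fun h => ⟨h.2.trans h.1.symm, h.1.symm⟩,
      fun h => ⟨h.2.symm, h.1.trans h.2.symm⟩⟩ rfl rfl
  · rw [key h.rotate.rotate h1]
    exact if_congr ⟨fun h => ⟨h.2.symm, h.1.trans h.2.symm⟩,
      fun h => ⟨h.2.trans h.1.symm, h.1.symm⟩⟩ rfl rfl

theorem lineOrd_φ_δ_of_one (ε : Fin 5 → ℤˣ) {i j k l n : Fin 5} (h : Distinct i j k l n)
    (hε : ∀ m, m ≠ n → (ε * (flip 0 * flip 1)) m = -(ε * (flip 0 * flip 1)) n) :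
    lineOrd r ε (φ r (δ K)) = isFirst i n + isFirst j n + isFirst k n + isFirst l n := by
  obtain ⟨⟨hij, hik, hil, hin⟩, ⟨hjk, hjl, hjn⟩, ⟨hkl, hkn⟩, hln⟩ := h.ne
  have H0 : ∀ i j : Fin 5, H K i j ≠ 0 := fun i j => (H_prime i j).ne_zero
  rw [lineOrd_eq, multiplicity_congr (ψ_signAct_δ_one r h ((hε j hjn).trans (hε i hin).symm)
    ((hε k hkn).trans (hε i hin).symm) ((hε l hln).trans (hε i hin).symm)
    (by rw [hε i hin, neg_neg])),
    multiplicity_mul_H δ_prime.ne_zero (by simp [H0]), multiplicity_H_δ,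
    multiplicity_mul_H (by simp [H0]) (H0 _ _), multiplicity_mul_H (by simp [H0]) (H0 _ _),
    multiplicity_mul_H (H0 _ _) (H0 _ _), multiplicity_H hin, multiplicity_H hjn,
    multiplicity_H hkn, multiplicity_H hln, zero_add]

theorem lineOrd_φ_δ_of_two (ε : Fin 5 → ℤˣ) {i j k l n : Fin 5} (h : Distinct i j k l n)
    (hi : (ε * (flip 0 * flip 1)) i = (ε * (flip 0 * flip 1)) j)
    (hε : ∀ m, m ≠ i → m ≠ j → (ε * (flip 0 * flip 1)) m = -(ε * (flip 0 * flip 1)) i) :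
    lineOrd r ε (φ r (δ K)) = 3 * isFirst i j + isFirst k l + isFirst k n + isFirst l n := by
  obtain ⟨⟨hij, hik, hil, hin⟩, ⟨hjk, hjl, hjn⟩, ⟨hkl, hkn⟩, hln⟩ := h.ne
  have H0 : ∀ i j : Fin 5, H K i j ≠ 0 := fun i j => (H_prime i j).ne_zero
  have hl := hε l (Ne.symm hil) (Ne.symm hjl)
  have hk := hε k (Ne.symm hik) (Ne.symm hjk)
  have hn := hε n (Ne.symm hin) (Ne.symm hjn)
  rw [lineOrd_eq, multiplicity_congr (ψ_signAct_δ_two r h (by rw [hl, neg_neg])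
    (by rw [hl, neg_neg, hi]) (hk.trans hl.symm) (hn.trans hl.symm)),
    multiplicity_mul_H (by simp [H0]) (H0 _ _), multiplicity_mul_H (by simp [H0]) (H0 _ _),
    multiplicity_mul_H (by simp [H0]) (H0 _ _), multiplicity_H hkl, multiplicity_H hkn,
    multiplicity_H hln, pow_succ, pow_two, multiplicity_mul_H (by simp [H0]) (H0 _ _),
    multiplicity_mul_H (H0 _ _) (H0 _ _), multiplicity_H hij]
  ring

theorem lineOrd_φ_δ_of_const (ε : Fin 5 → ℤˣ)
    (hε : ∀ m, (ε * (flip 0 * flip 1)) m = (ε * (flip 0 * flip 1)) 0) :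
    lineOrd r ε (φ r (δ K)) = 0 := by
  rw [lineOrd_eq, multiplicity_congr (ψ_signAct_δ_of_eq r hε), multiplicity_eq_zero]
  exact fun h => H_not_dvd_δ 0 1 ((H_prime 0 1).dvd_of_dvd_pow h)

/-- The quadric section `φ δ = 0` is three times the line with signs `1`, which the projection maps
onto the conic, and the sum of the five lines `flip i` meeting it, which are contracted to the five
points. -/
theorem lineOrd_one_φ_δ : lineOrd r 1 (φ r (δ K)) = 3 :=
  lineOrd_φ_δ_of_two r 1 (i := 0) (j := 1) (k := 2) (l := 3) (n := 4) (by decide) (by decide)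
    (by decide)

theorem lineOrd_flip_φ_δ (i : Fin 5) : lineOrd r (flip i) (φ r (δ K)) = 1 := by
  fin_cases i
  · exact lineOrd_φ_δ_of_one r _ (i := 0) (j := 2) (k := 3) (l := 4) (n := 1) (by decide)
        (by decide)
  · exact lineOrd_φ_δ_of_one r _ (i := 1) (j := 2) (k := 3) (l := 4) (n := 0) (by decide)
        (by decide)
  · exact lineOrd_φ_δ_of_two r _ (i := 3) (j := 4) (k := 0) (l := 1) (n := 2) (by decide)
      (by decide) (by decide)
  · exact lineOrd_φ_δ_of_two r _ (i := 2) (j := 4) (k := 0) (l := 1) (n := 3) (by decide)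
      (by decide) (by decide)
  · exact lineOrd_φ_δ_of_two r _ (i := 2) (j := 3) (k := 0) (l := 1) (n := 4) (by decide)
      (by decide) (by decide)

theorem lineOrd_flip_mul_flip_φ_δ {i j : Fin 5} (hij : i ≠ j) :
    lineOrd r (flip i * flip j) (φ r (δ K)) = 0 := by
  wlog hlt : i < j generalizing i j
  · rw [mul_comm]
    exact this hij.symm (lt_of_le_of_ne (not_lt.mp hlt) hij.symm)
  fin_cases i <;> fin_cases j <;> try exact absurd hlt (by decide)
  · exact lineOrd_φ_δ_of_const r _ (by decide)
  · exact lineOrd_φ_δ_of_two r _ (i := 1) (j := 2) (k := 0) (l := 3) (n := 4) (by decide)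
      (by decide) (by decide)
  · exact lineOrd_φ_δ_of_two r _ (i := 1) (j := 3) (k := 0) (l := 2) (n := 4) (by decide)
      (by decide) (by decide)
  · exact lineOrd_φ_δ_of_two r _ (i := 1) (j := 4) (k := 0) (l := 2) (n := 3) (by decide)
      (by decide) (by decide)
  · exact lineOrd_φ_δ_of_two r _ (i := 0) (j := 2) (k := 1) (l := 3) (n := 4) (by decide)
      (by decide) (by decide)
  · exact lineOrd_φ_δ_of_two r _ (i := 0) (j := 3) (k := 1) (l := 2) (n := 4) (by decide)
      (by decide) (by decide)
  · exact lineOrd_φ_δ_of_two r _ (i := 0) (j := 4) (k := 1) (l := 2) (n := 3) (by decide)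
      (by decide) (by decide)
  · exact lineOrd_φ_δ_of_one r _ (i := 0) (j := 1) (k := 2) (l := 3) (n := 4) (by decide)
        (by decide)
  · exact lineOrd_φ_δ_of_one r _ (i := 0) (j := 1) (k := 2) (l := 4) (n := 3) (by decide)
        (by decide)
  · exact lineOrd_φ_δ_of_one r _ (i := 0) (j := 1) (k := 3) (l := 4) (n := 2) (by decide)
        (by decide)

theorem lineOrd_one_φ_H {i j : Fin 5} (hij : i ≠ j) : lineOrd r 1 (φ r (H K i j)) = 1 := by
  obtain ⟨k, l, n, h⟩ := exists_distinct hij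
  rw [lineOrd_φ_H r 1 h]
  simp

theorem lineOrd_flip_φ_H {i j : Fin 5} (hij : i ≠ j) (m : Fin 5) :
    lineOrd r (flip m) (φ r (H K i j)) = if m = i ∨ m = j then 1 else 0 := by
  obtain ⟨k, l, n, h⟩ := exists_distinct hij
  rw [lineOrd_φ_H r _ h]
  refine if_congr ?_ rfl rfl
  have : ∀ i j : Fin 5, i ≠ j → ∀ k, k ≠ i → k ≠ j → ∀ l, l ≠ i → l ≠ j →
    l ≠ k → ∀ n, n ≠ i → n ≠ j → n ≠ k → n ≠ l → ∀ m,
    (flip m k = flip m l ∧ flip m n = flip m l ↔ m = i ∨ m = j) := by decide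
  obtain ⟨⟨-, hik, hil, hin⟩, ⟨hjk, hjl, hjn⟩, ⟨hkl, hkn⟩, hln⟩ := h.ne
  exact this i j hij k hik.symm hjk.symm l hil.symm hjl.symm hkl.symm n hin.symm hjn.symm hkn.symm
    hln.symm m

theorem lineOrd_flip_mul_flip_φ_H {i j : Fin 5} (hij : i ≠ j) {k l : Fin 5} (hkl : k ≠ l) :
    lineOrd r (flip k * flip l) (φ r (H K i j)) =
      if (k = i ∧ l = j) ∨ (k = j ∧ l = i) then 1 else 0 := by
  obtain ⟨p, q, n, h⟩ := exists_distinct hij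
  rw [lineOrd_φ_H r _ h]
  refine if_congr ?_ rfl rfl
  have : ∀ i j : Fin 5, i ≠ j → ∀ k, k ≠ i → k ≠ j → ∀ l, l ≠ i → l ≠ j →
    l ≠ k → ∀ n, n ≠ i → n ≠ j → n ≠ k → n ≠ l → ∀ p q, p ≠ q →
    ((flip p * flip q) k = (flip p * flip q) l ∧ (flip p * flip q) n = (flip p * flip q) l ↔
      (p = i ∧ q = j) ∨ (p = j ∧ q = i)) := by decide
  obtain ⟨⟨-, hik, hil, hin⟩, ⟨hjk, hjl, hjn⟩, ⟨hkl', hkn⟩, hln⟩ := h.ne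
  exact this i j hij p hik.symm hjk.symm q hil.symm hjl.symm hkl'.symm n hin.symm hjn.symm hkn.symm
    hln.symm k l hkl

/-- Changing all signs does not change a line. -/
theorem lineOrd_neg (ε : Fin 5 → ℤˣ) (x : CoordRing K) {n : ℕ} (hx : x ∈ grading K n) :
    lineOrd r (-ε) x = lineOrd r ε x := by
  rw [lineOrd_eq, lineOrd_eq, neg_mul]
  refine multiplicity_congr ?_
  have : signAct (-(ε * (flip 0 * flip 1))) x =
      (-1) ^ n * signAct (ε * (flip 0 * flip 1)) x := by
    refine coordRing_hom_eq_pow_mul (f := (signAct (-(ε * (flip 0 * flip 1)))).toRingHom)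
      (g := (signAct (ε * (flip 0 * flip 1))).toRingHom) (fun t => ?_) (fun m => ?_) hx
    · exact ((signAct _).commutes t).trans ((signAct _).commutes t).symm
    · refine (signAct_T _ m).trans (Eq.trans ?_ (congrArg _ (signAct_T _ m)).symm)
      simp
      ring
  rw [this, map_mul, map_pow, map_neg, map_one]
  exact associated_unit_mul_left _ _ ((isUnit_one.neg).pow n)

/-! ### Points of curves and of lines -/

omit [CharZero K] in
theorem signAct_ne_zero (τ : Fin 5 → ℤˣ) {x : CoordRing K} (hx : x ≠ 0) : signAct τ x ≠ 0 := by
  intro h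
  apply hx
  rw [← signAct_one x, ← sign_mul_self τ, ← signAct_signAct, h, map_zero]

theorem φ_ne_zero {n : ℕ} {F : MvPolynomial (Fin 3) K} (hF : F.IsHomogeneous n) (h0 : F ≠ 0) :
    φ r F ≠ 0 := fun h =>
  (chart r 1).φ_ne_zero hF h0 ((signAct_one _).trans h)

/-- The generic point of the line with sign vector `ε`. -/
def linePoint (ε : Fin 5 → ℤˣ) : surface K := (isCurve_H r (ε * (flip 0 * flip 1)) 0 1).point

theorem mem_linePoint_iff [IsDomain (CoordRing K)] (ε : Fin 5 → ℤˣ) {x : CoordRing K}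
    (hx : x ≠ 0) : x ∈ (linePoint r ε).asHomogeneousIdeal ↔ lineOrd r ε x ≠ 0 :=
  (not_iff_comm.mp ((isCurve_H r (ε * (flip 0 * flip 1)) 0 1).ord_eq_zero_iff hx).symm).symm

variable [IsDomain (CoordRing K)]

/-- In each of the sixteen projections, the line `H i j = 0` in the plane is the image of a line. -/
theorem point_isCurve_H (τ : Fin 5 → ℤˣ) {i j : Fin 5} (hij : i ≠ j) :
    (isCurve_H r τ i j).point = linePoint r (τ * (flip i * flip j)) := by
  have hτ : τ * (flip i * flip j) * τ = flip i * flip j := by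
    rw [mul_right_comm, sign_mul_self, one_mul]
  have h0 := φ_ne_zero r (H_isHomogeneous i j) (H_prime i j).ne_zero
  refine (isCurve_H r (τ * (flip i * flip j) * (flip 0 * flip 1)) 0 1).eq_point _
    ((isCurve_H r τ i j).point_le (linePoint r (τ * (flip i * flip j))) ?_ ?_)
    ((chart r τ).φ_mem 1 _ (H_isHomogeneous i j)) (signAct_ne_zero τ h0)
    (((isCurve_H r τ i j).φ_mem_point (H_isHomogeneous i j)).mpr dvd_rfl)
  · rw [chart_φ, chart_δ, mem_linePoint_iff r _ (signAct_ne_zero τ (φ_ne_zero r δ_isHomogeneous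
      δ_prime.ne_zero)), lineOrd_signAct, hτ, lineOrd_flip_mul_flip_φ_δ r hij, not_not]
  · rw [chart_φ, mem_linePoint_iff r _ (signAct_ne_zero τ h0), lineOrd_signAct, hτ,
      lineOrd_flip_mul_flip_φ_H r hij hij]
    simp

variable {r}

/-- If the point of a curve of a chart is not the generic point of a line, then the equation of the
curve is associated to none of the `H i j`. -/
theorem not_dvd_H_of_forall_ne {τ : Fin 5 → ℤˣ} {p : MvPolynomial (Fin 3) K}
    (hp : (chart r τ).IsCurve p) (h : ∀ ε, hp.point ≠ linePoint r ε) {i j : Fin 5} (hij : i ≠ j) :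
    ¬ p ∣ H K i j := fun hd =>
  h _ ((hp.point_eq_of_associated (isCurve_H r τ i j)
    (hp.prime.associated_of_dvd (H_prime i j) hd)).trans (point_isCurve_H r τ hij))

omit [IsDomain (CoordRing K)] in
theorem not_dvd_δ {τ : Fin 5 → ℤˣ} {p : MvPolynomial (Fin 3) K}
    (hp : (chart r τ).IsCurve p) : ¬ p ∣ δ K := hp.not_dvd

/-- The forms `H i j` of all sixteen projections vanish only along lines. -/
theorem φ_H_notMem {τ : Fin 5 → ℤˣ} {p : MvPolynomial (Fin 3) K}
    (hp : (chart r τ).IsCurve p) (h : ∀ ε, hp.point ≠ linePoint r ε) (σ : Fin 5 → ℤˣ)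
    {i j : Fin 5} (hij : i ≠ j) : (chart r σ).φ (H K i j) ∉ hp.point.asHomogeneousIdeal := by
  rw [hp.mem_point, chart_ψ, chart_φ, signAct_signAct]
  have key : ∀ {k l n : Fin 5}, Distinct i j k l n → (τ * σ) k = (τ * σ) l →
      ¬ p ∣ ψ r (signAct (τ * σ) (φ r (H K i j))) := by
    intro k l n hd hkl
    obtain ⟨⟨-, -, -, hin⟩, ⟨-, -, hjn⟩, ⟨hkl', -⟩, -⟩ := hd.ne
    by_cases hn : (τ * σ) n = (τ * σ) l
    · rw [(ψ_signAct_H_of_eq r hd hkl hn).dvd_iff_dvd_right, hp.prime.dvd_mul, not_or]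
      exact ⟨not_dvd_δ hp, not_dvd_H_of_forall_ne hp h hij⟩
    · rw [(ψ_signAct_H_of_ne r hd hkl (Int.units_ne_iff_eq_neg.mp hn)).dvd_iff_dvd_right,
        hp.prime.dvd_mul, hp.prime.dvd_mul, not_or, not_or]
      exact ⟨⟨not_dvd_H_of_forall_ne hp h hin, not_dvd_H_of_forall_ne hp h hjn⟩,
        not_dvd_H_of_forall_ne hp h hkl'⟩
  obtain ⟨k, l, n, hd⟩ := exists_distinct hij
  have pig : ∀ s t u : ℤˣ, s = t ∨ t = u ∨ u = s := by decide
  rcases pig ((τ * σ) k) ((τ * σ) l) ((τ * σ) n) with h1 | h1 | h1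
  · exact key hd h1
  · exact key hd.rotate h1
  · exact key hd.rotate.rotate h1

/-- The conics of all sixteen projections vanish only along lines. -/
theorem φ_δ_notMem {τ : Fin 5 → ℤˣ} {p : MvPolynomial (Fin 3) K}
    (hp : (chart r τ).IsCurve p) (h : ∀ ε, hp.point ≠ linePoint r ε) (σ : Fin 5 → ℤˣ) :
    (chart r σ).φ (δ K) ∉ hp.point.asHomogeneousIdeal := by
  rw [hp.mem_point, chart_ψ, chart_φ, signAct_signAct]
  have hH : ∀ {i j : Fin 5}, i ≠ j → ¬ p ∣ H K i j := fun hij => not_dvd_H_of_forall_ne hp h hij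
  rcases sign_cases (τ * σ) with h1 | ⟨n, h1⟩ | ⟨i, j, hij, h1, h2⟩
  · rw [(ψ_signAct_δ_of_eq r h1).dvd_iff_dvd_right]
    exact fun hd => not_dvd_δ hp (hp.prime.dvd_of_dvd_pow hd)
  · obtain ⟨i, hi⟩ := exists_ne n
    obtain ⟨j, k, l, hd⟩ := exists_distinct hi.symm
    have hd' := hd.cycle
    obtain ⟨⟨-, -, -, hin⟩, ⟨-, -, hjn⟩, ⟨-, hkn⟩, hln⟩ := hd'.ne
    rw [(ψ_signAct_δ_one r hd' ((h1 j hjn).trans (h1 i hin).symm)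
      ((h1 k hkn).trans (h1 i hin).symm) ((h1 l hln).trans (h1 i hin).symm)
      (by rw [h1 i hin, neg_neg])).dvd_iff_dvd_right]
    simp only [hp.prime.dvd_mul, not_or]
    exact ⟨not_dvd_δ hp, ⟨⟨hH hin, hH hjn⟩, hH hkn⟩, hH hln⟩
  · obtain ⟨k, l, n, hd⟩ := exists_distinct hij
    obtain ⟨⟨-, hik, hil, hin⟩, ⟨hjk, hjl, hjn⟩, ⟨hkl, hkn⟩, hln⟩ := hd.ne
    have hl := h2 l hil.symm hjl.symm
    have hk := h2 k hik.symm hjk.symm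
    have hn := h2 n hin.symm hjn.symm
    rw [(ψ_signAct_δ_two r hd (by rw [hl, neg_neg]) (by rw [hl, neg_neg, h1])
      (hk.trans hl.symm) (hn.trans hl.symm)).dvd_iff_dvd_right]
    simp only [hp.prime.dvd_mul, not_or]
    exact ⟨⟨⟨fun hd => hH hij (hp.prime.dvd_of_dvd_pow hd), hH hkl⟩, hH hkn⟩, hH hln⟩

omit [IsDomain (CoordRing K)] in
/-- Only the mixed term of the two coordinates survives the alternating sum of the conics over the
changes of their signs. -/
theorem four_mul_y_mul_y (r : Roots K) {i j : Fin 5} (hij : i ≠ j) :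
    4 * (a _ i - a _ j) ^ 2 * (y r i * y r j) =
      (chart r 1).φ (δ K) - (chart r (flip i)).φ (δ K) - (chart r (flip j)).φ (δ K) +
        (chart r (flip i * flip j)).φ (δ K) := by
  obtain ⟨k, l, n, h⟩ := exists_distinct hij
  obtain ⟨⟨-, hik, hil, hin⟩, ⟨hjk, hjl, hjn⟩, -, -⟩ := h.ne
  simp only [chart_φ, signAct_φ_δ, powerSum, sum_distinct h, conic]
  simp [flip, hij, hij.symm, hik.symm, hil.symm, hin.symm, hjk.symm, hjl.symm, hjn.symm]
  ring

omit [CharZero K] [IsDomain (CoordRing K)] in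
theorem irrelevant_le_of_T_mem (x : surface K) (h : ∀ n, T n ∈ x.asHomogeneousIdeal) :
    HomogeneousIdeal.irrelevant (grading K) ≤ x.asHomogeneousIdeal := by
  refine le_of_forall_homogeneous (grading K) fun n b hb hbi => ?_
  rcases Nat.eq_zero_or_pos n with rfl | hn
  · have hb0 : b = 0 := by
      rw [HomogeneousIdeal.mem_irrelevant_iff, GradedRing.proj_apply,
        DirectSum.decompose_of_mem_same _ hb] at hbi
      exact hbi
    rw [hb0]
    exact zero_mem _
  · obtain ⟨p, hp, rfl⟩ := hb
    have hps : p ∈ Ideal.span (X '' Set.univ : Set (MvPolynomial (Fin 5) K)) := by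
      rw [mem_ideal_span_X_image]
      intro m hm
      by_contra! hm0
      have : m = 0 := Finsupp.ext fun i => hm0 i trivial
      rw [this] at hm
      have := hp (mem_support_iff.mp hm)
      simp at this
      omega
    have hle : Ideal.span (X '' Set.univ : Set (MvPolynomial (Fin 5) K)) ≤
        x.asHomogeneousIdeal.toIdeal.comap (Ideal.Quotient.mk (ideal K)) := by
      rw [Ideal.span_le]
      rintro _ ⟨i, -, rfl⟩
      exact h i
    exact hle hps

omit [IsDomain (CoordRing K)] in
/-- The sixteen charts cover the surface. -/
theorem exists_φ_δ_notMem (r : Roots K) (x : surface K) :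
    ∃ τ, (chart r τ).φ (δ K) ∉ x.asHomogeneousIdeal := by
  by_contra! hx
  have hprime := Proj.isPrime_toIdeal (grading K) x
  have hunit : ∀ (t : K) (b : CoordRing K), t ≠ 0 →
      algebraMap K _ t * b ∈ x.asHomogeneousIdeal → b ∈ x.asHomogeneousIdeal := by
    intro t b ht hb
    have := Ideal.mul_mem_left x.asHomogeneousIdeal.toIdeal (algebraMap K _ t⁻¹) hb
    rwa [← mul_assoc, ← map_mul, inv_mul_cancel₀ ht, map_one, one_mul] at this
  -- averaging over the signs of two coordinates isolates their product
  have hy : ∀ i j, i ≠ j → y r i * y r j ∈ x.asHomogeneousIdeal := by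
    intro i j hij
    refine hunit (4 * (a K i - a K j) ^ 2) _
      (mul_ne_zero (by norm_num) (pow_ne_zero 2 (sub_ne_zero.mpr (a_ne hij)))) ?_
    have : algebraMap K (CoordRing K) (4 * (a K i - a K j) ^ 2) = 4 * (a _ i - a _ j) ^ 2 := by
      rw [map_mul, map_pow, map_sub, map_a, map_a]
      rfl
    rw [this, four_mul_y_mul_y r hij]
    exact x.asHomogeneousIdeal.toIdeal.add_mem (x.asHomogeneousIdeal.toIdeal.sub_mem
      (x.asHomogeneousIdeal.toIdeal.sub_mem (hx _) (hx _)) (hx _)) (hx _)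
  have hsq : ∀ i, (∀ j, j ≠ i → y r j ∈ x.asHomogeneousIdeal) → y r i ∈ x.asHomogeneousIdeal := by
    intro i hi
    have h0 := sum_y_sq r
    rw [← Finset.add_sum_erase _ _ (Finset.mem_univ i), add_eq_zero_iff_eq_neg] at h0
    have h1 : (d i : CoordRing K) * y r i ^ 2 ∈ x.asHomogeneousIdeal := by
      rw [h0]
      refine x.asHomogeneousIdeal.toIdeal.neg_mem (Ideal.sum_mem _ fun j hj => ?_)
      exact Ideal.mul_mem_left _ _ (Ideal.pow_mem_of_mem _ (hi j (Finset.ne_of_mem_erase hj)) 2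
        two_pos)
    refine hprime.mem_of_pow_mem 2 (hunit (d i) _ (d_ne_zero' i) ?_)
    rwa [map_intCast]
  have hall : ∀ i, y r i ∈ x.asHomogeneousIdeal := by
    intro i
    by_contra hi
    exact hi (hsq i fun j hj => (hprime.mem_or_mem (hy j i hj)).resolve_right hi)
  refine x.not_irrelevant_le (irrelevant_le_of_T_mem x fun n => ?_)
  rw [T_eq r]
  exact Ideal.mul_mem_left _ _ (hall n)

end
end TwoQuadrics

/-! ### Divisors supported on the lines -/

namespace TwoQuadrics

open MvPolynomial Scheme

noncomputable section

variable {K : Type u} [Field K] [CharZero K] [IsDomain (CoordRing K)] [IsIntegral (surface K)]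

/-- A Cartier divisor is supported on the lines if it is trivial at the generic points of all
curves of the charts other than lines. -/
def SupportedOnLines (r : Roots K) (D : (surface K).cartierDivisors) : Prop :=
  ∀ (τ : Fin 5 → ℤˣ) (p : MvPolynomial (Fin 3) K) (hp : (chart r τ).IsCurve p),
    (∀ ε, hp.point ≠ linePoint r ε) → D.1 hp.point = 1

variable {r : Roots K}

omit [IsDomain (CoordRing K)] in
theorem SupportedOnLines.mul {D E : (surface K).cartierDivisors} (hD : SupportedOnLines r D)
    (hE : SupportedOnLines r E) : SupportedOnLines r (D * E) := fun τ p hp h => by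
  rw [coe_mul_apply, hD τ p hp h, hE τ p hp h, mul_one]

omit [IsDomain (CoordRing K)] in
theorem SupportedOnLines.inv {D : (surface K).cartierDivisors} (hD : SupportedOnLines r D) :
    SupportedOnLines r D⁻¹ := fun τ p hp h => by
  change (D.1 hp.point)⁻¹ = 1
  rw [hD τ p hp h, inv_one]

omit [IsDomain (CoordRing K)] in
theorem SupportedOnLines.div {D E : (surface K).cartierDivisors} (hD : SupportedOnLines r D)
    (hE : SupportedOnLines r E) : SupportedOnLines r (D / E) := by
  rw [div_eq_mul_inv]; exact hD.mul hE.inv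

omit [IsDomain (CoordRing K)] in
theorem SupportedOnLines.zpow {D : (surface K).cartierDivisors} (hD : SupportedOnLines r D)
    (n : ℤ) :
    SupportedOnLines r (D ^ n) := fun τ p hp h => by
  have : ((D ^ n).1 hp.point) = (D.1 hp.point) ^ n := rfl
  rw [this, hD τ p hp h, one_zpow]

/-- Every Cartier divisor is linearly equivalent to one supported on the lines. -/
theorem exists_supportedOnLines (r : Roots K) (D : (surface K).cartierDivisors) :
    ∃ g, SupportedOnLines r (D / (surface K).principalDivisor g) := by
  obtain ⟨U, hU, f, hf⟩ := D.2 (genericPoint _)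
  obtain ⟨_, ⟨s, rfl⟩, hs, hsU⟩ :=
    (ProjectiveSpectrum.isTopologicalBasis_basic_opens (grading K)).exists_subset_of_mem_open
      hU U.isOpen
  have hs0 : s ≠ 0 := by rintro rfl; exact hs (zero_mem _)
  obtain ⟨g, hg⟩ := (chart r 1).exists_principalDivisor_of_dvd (H_isHomogeneous 0 1)
    (H_prime 0 1).ne_zero _ ((chart r 1).ψ_ne_zero hs0) (D / (surface K).principalDivisor f) (by
      intro p hp _ hps
      rw [coe_div_apply, principalDivisor_apply, hf, div_self']
      exact hsU fun hm => hps (hp.mem_point.mp hm))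
  refine ⟨f * g, fun τ p hp h => ?_⟩
  rw [map_mul, ← div_div]
  refine PlaneChart.apply_eq_one_of_forall (c := chart r 1) _ _ (φ_δ_notMem hp h 1) fun q hq hqp =>
    ?_
  refine hg q hq fun hd => φ_H_notMem hp h 1 (i := 0) (j := 1) (by decide) (hqp ?_)
  exact (hq.φ_mem_point (H_isHomogeneous 0 1)).mpr hd

/-- A divisor supported on the lines is determined by its germs at the generic points of the lines,
since every point lies in one of the charts. -/
theorem SupportedOnLines.eq_one {D : (surface K).cartierDivisors} (hD : SupportedOnLines r D)
    (h : ∀ ε, D.1 (linePoint r ε) = 1) : D = 1 := by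
  refine cartierDivisors_ext fun x => ?_
  obtain ⟨τ, hτ⟩ := exists_φ_δ_notMem r x
  refine PlaneChart.apply_eq_one_of_forall (c := chart r τ) _ _ hτ fun p hp _ => ?_
  by_cases hl : ∀ ε, hp.point ≠ linePoint r ε
  · exact hD τ p hp hl
  · push Not at hl
    obtain ⟨ε, hε⟩ := hl
    rw [hε]
    exact h ε

variable (r)

/-- The multiplicity of a Cartier divisor along the line with sign vector `ε`. -/
def lineMult (ε : Fin 5 → ℤˣ) (D : (surface K).cartierDivisors) : ℤ :=
  (isCurve_H r (ε * (flip 0 * flip 1)) 0 1).ordStalk (D.1 (linePoint r ε))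

theorem lineMult_mul (ε : Fin 5 → ℤˣ) (D E : (surface K).cartierDivisors) :
    lineMult r ε (D * E) = lineMult r ε D + lineMult r ε E :=
  (isCurve_H r (ε * (flip 0 * flip 1)) 0 1).ordStalk_mul _ _

/-- The multiplicity along a line, as a homomorphism. -/
def lineMultHom (ε : Fin 5 → ℤˣ) : (surface K).cartierDivisors →* Multiplicative ℤ :=
  MonoidHom.mk' (fun D => Multiplicative.ofAdd (lineMult r ε D))
    fun D E => congrArg Multiplicative.ofAdd (lineMult_mul r ε D E)

theorem lineMult_div (ε : Fin 5 → ℤˣ) (D E : (surface K).cartierDivisors) :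
    lineMult r ε (D / E) = lineMult r ε D - lineMult r ε E :=
  (congrArg Multiplicative.toAdd (map_div (lineMultHom r ε) D E)).trans (toAdd_div _ _)

theorem lineMult_zpow (ε : Fin 5 → ℤˣ) (D : (surface K).cartierDivisors) (n : ℤ) :
    lineMult r ε (D ^ n) = n * lineMult r ε D :=
  (congrArg Multiplicative.toAdd (map_zpow (lineMultHom r ε) D n)).trans (toAdd_zpow _ _)

theorem lineMult_eq_zero_iff (ε : Fin 5 → ℤˣ) (D : (surface K).cartierDivisors) :
    lineMult r ε D = 0 ↔ D.1 (linePoint r ε) = 1 :=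
  (isCurve_H r (ε * (flip 0 * flip 1)) 0 1).ordStalk_eq_zero_iff

theorem lineMult_of_germ (ε : Fin 5 → ℤˣ) {D : (surface K).cartierDivisors}
    {f : (surface K).functionFieldˣ} (hf : D.1 (linePoint r ε) = (surface K).germDiv _ f)
    {a b : CoordRing K} (ha : a ≠ 0) (hb : b ≠ 0) (h : Proj.toFrac (grading K) f =
      algebraMap _ (FractionRing (CoordRing K)) a / algebraMap _ _ b) :
    lineMult r ε D = lineOrd r ε a - lineOrd r ε b := by
  rw [lineMult, hf]
  refine ((isCurve_H r (ε * (flip 0 * flip 1)) 0 1).ordStalk_germDiv f).trans ?_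
  rw [h]
  exact (isCurve_H r (ε * (flip 0 * flip 1)) 0 1).ordFrac_div ha hb

theorem lineMult_principalDivisor (ε : Fin 5 → ℤˣ) {f : (surface K).functionFieldˣ}
    {a b : CoordRing K} (ha : a ≠ 0) (hb : b ≠ 0) (h : Proj.toFrac (grading K) f =
      algebraMap _ (FractionRing (CoordRing K)) a / algebraMap _ _ b) :
    lineMult r ε ((surface K).principalDivisor f) = lineOrd r ε a - lineOrd r ε b :=
  lineMult_of_germ r ε rfl ha hb h

omit [IsIntegral (surface K)] in
theorem linePoint_neg (ε : Fin 5 → ℤˣ) : linePoint r (-ε) = linePoint r ε := by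
  have key : ∀ ε : Fin 5 → ℤˣ, (linePoint r ε).asHomogeneousIdeal ≤
      (linePoint r (-ε)).asHomogeneousIdeal := by
    refine fun ε => le_of_forall_homogeneous (grading K) fun n x hx hxm => ?_
    rcases eq_or_ne x 0 with rfl | hx0
    · exact zero_mem _
    · rw [mem_linePoint_iff r _ hx0, lineOrd_neg r ε x hx]
      exact (mem_linePoint_iff r _ hx0).mp hxm
  refine ProjectiveSpectrum.ext (le_antisymm ?_ (key ε))
  have := key (-ε)
  rwa [neg_neg] at this

theorem lineMult_neg (ε : Fin 5 → ℤˣ) (D : (surface K).cartierDivisors) :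
    lineMult r (-ε) D = lineMult r ε D := by
  obtain ⟨U, hU, f, hf⟩ := D.2 (linePoint r ε)
  obtain ⟨n, a, ha, b, hb, ha0, hb0, h⟩ := PlaneChart.exists_toFrac_unit_eq f
  rw [lineMult_of_germ r ε (hf _ hU) ha0 hb0 h,
    lineMult_of_germ r (-ε) (hf _ (by rw [linePoint_neg]; exact hU)) ha0 hb0 h,
    lineOrd_neg r ε a ha, lineOrd_neg r ε b hb]

/-- The intersection number of a divisor supported on the lines with the line with sign vector
`τ`, which has self-intersection `-1` and meets the five lines differing from it by one sign. -/
def lineDeg (τ : Fin 5 → ℤˣ) (D : (surface K).cartierDivisors) : ℤ :=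
  ∑ i, lineMult r (τ * flip i) D - lineMult r τ D

theorem lineDeg_div (τ : Fin 5 → ℤˣ) (D E : (surface K).cartierDivisors) :
    lineDeg r τ (D / E) = lineDeg r τ D - lineDeg r τ E := by
  simp only [lineDeg, lineMult_div, Finset.sum_sub_distrib]
  ring

theorem lineDeg_zpow (τ : Fin 5 → ℤˣ) (D : (surface K).cartierDivisors) (n : ℤ) :
    lineDeg r τ (D ^ n) = n * lineDeg r τ D := by
  simp only [lineDeg, lineMult_zpow, ← Finset.mul_sum]
  ring

theorem lineDeg_neg (τ : Fin 5 → ℤˣ) (D : (surface K).cartierDivisors) :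
    lineDeg r (-τ) D = lineDeg r τ D := by
  simp only [lineDeg, neg_mul, lineMult_neg]

/-! ### Principal divisors supported on the lines -/

omit [IsIntegral (surface K)] in
theorem lineOrd_mul (ε : Fin 5 → ℤˣ) {a b : CoordRing K} (ha : a ≠ 0) (hb : b ≠ 0) :
    lineOrd r ε (a * b) = lineOrd r ε a + lineOrd r ε b :=
  (isCurve_H r (ε * (flip 0 * flip 1)) 0 1).ord_mul ha hb

omit [IsDomain (CoordRing K)] [IsIntegral (surface K)] in
theorem lineOrd_congr (ε : Fin 5 → ℤˣ) {a b : CoordRing K} (h : Associated a b) :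
    lineOrd r ε a = lineOrd r ε b := by
  rw [lineOrd_eq, lineOrd_eq]
  exact multiplicity_congr ((h.map (signAct _)).map (ψ r))

omit [CharZero K] [IsDomain (CoordRing K)] [IsIntegral (surface K)] in
theorem isHomogeneous_of_associated {F G : MvPolynomial (Fin 3) K} (h : Associated F G) {m : ℕ}
    (hF : F.IsHomogeneous m) : G.IsHomogeneous m := by
  obtain ⟨u, rfl⟩ := h
  obtain ⟨c, -, hc⟩ := (MvPolynomial.isUnit_iff_eq_C_of_isReduced).mp u.isUnit
  rw [hc]
  simpa using hF.mul (isHomogeneous_C _ c)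

omit [IsIntegral (surface K)] in
/-- The intersection number of a line with the divisor of a product of the forms `δ` and `H i j` is
the degree of the product. -/
theorem sum_lineOrd_flip (F : MvPolynomial (Fin 3) K) (hF : F ≠ 0) {n : ℕ} (hn : F.IsHomogeneous n)
    (h : ∀ p, Prime p → p ∣ F → Associated p (δ K) ∨ ∃ i j, i ≠ j ∧ Associated p (H K i j)) :
    ∑ i, (lineOrd r (flip i) (φ r F) : ℤ) - lineOrd r 1 (φ r F) = n := by
  induction F using UniqueFactorizationMonoid.induction_on_prime generalizing n with
  | h₁ => exact absurd rfl hF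
  | h₂ F hu =>
    have hu' : ∀ ε, lineOrd r ε (φ r F) = 0 := by
      intro ε
      rw [lineOrd_eq, multiplicity_eq_zero]
      exact fun hd => (H_prime 0 1).not_isUnit
        (isUnit_of_dvd_unit hd (((hu.map (φ r)).map (signAct _)).map (ψ r)))
    obtain ⟨c, -, rfl⟩ := (MvPolynomial.isUnit_iff_eq_C_of_isReduced).mp hu
    obtain rfl : n = 0 := hn.inj_right (isHomogeneous_C _ c) hF
    simp only [hu']
    simp
  | h₃ F p hF0 hp ih =>
    obtain ⟨m, hm⟩ := hn.of_dvd hF (dvd_mul_right _ _)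
    obtain ⟨k, hk⟩ := hn.of_dvd hF (dvd_mul_left _ _)
    obtain rfl : n = m + k := hn.inj_right (hm.mul hk) hF
    have h1 := ih hF0 hk fun q hq hqF => h q hq (hqF.mul_left p)
    have h2 : ∑ i, (lineOrd r (flip i) (φ r p) : ℤ) - lineOrd r 1 (φ r p) = m := by
      rcases h p hp (dvd_mul_right _ _) with ha | ⟨i, j, hij, ha⟩
      · obtain rfl : m = 2 :=
          hm.inj_right (isHomogeneous_of_associated ha.symm δ_isHomogeneous) hp.ne_zero
        simp only [lineOrd_congr r _ (ha.map (φ r)), lineOrd_one_φ_δ, lineOrd_flip_φ_δ]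
        simp
      · obtain rfl : m = 1 :=
          hm.inj_right (isHomogeneous_of_associated ha.symm (H_isHomogeneous i j)) hp.ne_zero
        simp only [lineOrd_congr r _ (ha.map (φ r)), lineOrd_one_φ_H r hij,
          lineOrd_flip_φ_H r hij]
        have : ∀ i j : Fin 5, i ≠ j →
            ∑ m, (((if m = i ∨ m = j then 1 else 0 : ℕ)) : ℤ) - (1 : ℕ) = (1 : ℕ) := by decide
        exact this i j hij
    have h3 : ∀ ε, lineOrd r ε (φ r (p * F)) = lineOrd r ε (φ r p) + lineOrd r ε (φ r F) := by
      intro ε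
      rw [map_mul, lineOrd_mul r ε (φ_ne_zero r hm hp.ne_zero) (φ_ne_zero r hk hF0)]
    simp only [h3, Nat.cast_add, Finset.sum_add_distrib]
    linear_combination h1 + h2

omit [IsDomain (CoordRing K)] [IsIntegral (surface K)] in
/-- The sixteen lines are the centre of the projection to the plane, the five lines meeting it, and
the ten lines which map to the lines joining two of the five points. -/
theorem sign_cases_flip (τ : Fin 5 → ℤˣ) : (τ = 1 ∨ τ = -1) ∨
    (∃ i, τ = flip i ∨ τ = -flip i) ∨
    (∃ i j, i ≠ j ∧ (τ = flip i * flip j ∨ τ = -(flip i * flip j))) := by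
  have h2 := Int.units_eq_one_or
  rcases sign_cases τ with h | ⟨n, h⟩ | ⟨i, j, hij, h, h'⟩
  · left
    rcases h2 (τ 0) with h0 | h0
    · exact Or.inl (funext fun m => (h m).trans h0)
    · exact Or.inr (funext fun m => (h m).trans h0)
  · right; left
    refine ⟨n, ?_⟩
    rcases h2 (τ n) with h0 | h0
    · refine Or.inr (funext fun m => ?_)
      by_cases hm : m = n
      · subst hm; simp [flip, h0]
      · simp [flip, hm, h m hm, h0]
    · refine Or.inl (funext fun m => ?_)
      by_cases hm : m = n
      · subst hm; simp [flip, h0]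
      · simp [flip, hm, h m hm, h0]
  · right; right
    refine ⟨i, j, hij, ?_⟩
    rcases h2 (τ i) with h0 | h0
    · refine Or.inr (funext fun m => ?_)
      by_cases hm : m = i
      · subst hm; simp [flip, h0, hij]
      · by_cases hm' : m = j
        · subst hm'; simp [flip, ← h, h0, hm]
        · simp [flip, hm, hm', h' m hm hm', h0]
    · refine Or.inl (funext fun m => ?_)
      by_cases hm : m = i
      · subst hm; simp [flip, h0, hij]
      · by_cases hm' : m = j
        · subst hm'; simp [flip, ← h, h0, hm]
        · simp [flip, hm, hm', h' m hm hm', h0]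

omit [IsIntegral (surface K)] in
/-- A curve of a chart whose generic point is that of a line is one of the lines `H i j = 0`. -/
theorem exists_associated_of_point_eq {τ ε : Fin 5 → ℤˣ} {p : MvPolynomial (Fin 3) K}
    (hp : (chart r τ).IsCurve p) (h : hp.point = linePoint r ε) :
    ∃ i j, i ≠ j ∧ Associated p (H K i j) := by
  have h1 : (chart r τ).φ (δ K) ∉ (linePoint r ε).asHomogeneousIdeal := h ▸ hp.φ_δ_notMem
  rw [chart_φ, mem_linePoint_iff r _ (signAct_ne_zero τ (φ_ne_zero r δ_isHomogeneous
    δ_prime.ne_zero)), lineOrd_signAct, not_not] at h1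
  have hn := fun ε => lineOrd_neg r ε _ (φ_mem r (δ_isHomogeneous (K := K)))
  have hτ : τ * (ε * τ) = ε := by rw [mul_left_comm, sign_mul_self, mul_one]
  rcases sign_cases_flip (ε * τ) with (h2 | h2) | ⟨i, h2 | h2⟩ | ⟨i, j, hij, h2⟩
  · rw [h2, lineOrd_one_φ_δ] at h1; simp at h1
  · rw [h2, hn, lineOrd_one_φ_δ] at h1; simp at h1
  · rw [h2, lineOrd_flip_φ_δ] at h1; simp at h1
  · rw [h2, hn, lineOrd_flip_φ_δ] at h1; simp at h1
  · refine ⟨i, j, hij, hp.associated_of_point_eq (isCurve_H r τ i j) ?_⟩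
    rw [h, point_isCurve_H r τ hij]
    rcases h2 with h2 | h2
    · rw [← h2, hτ]
    · rw [← neg_eq_iff_eq_neg] at h2
      rw [← h2, mul_neg, hτ, linePoint_neg]

/-- A principal divisor supported on the lines has intersection number zero with every line. -/
theorem lineDeg_principalDivisor (τ : Fin 5 → ℤˣ) {f : (surface K).functionFieldˣ}
    (hf : SupportedOnLines r ((surface K).principalDivisor f)) :
    lineDeg r τ ((surface K).principalDivisor f) = 0 := by
  obtain ⟨n, a, ha, b, hb, ha0, hb0, h⟩ := PlaneChart.exists_toFrac_unit_eq f
  obtain ⟨m, F, G, hF, hG, hF0, hG0, hFG, -, -, hab⟩ :=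
    PlaneChart.exists_isRelPrime (c := chart r τ) ha hb ha0 hb0
  have hF1 := (chart r τ).φ_ne_zero hF hF0
  have hG1 := (chart r τ).φ_ne_zero hG hG0
  rw [PlaneChart.div_eq_div_of_mul_eq hb0 hG1 hab] at h
  -- in the reduced fraction only lines occur, apart from the conic
  have hord : ∀ {p}, (chart r τ).IsCurve p → multiplicity p F ≠ multiplicity p G →
      ∃ i j, i ≠ j ∧ Associated p (H K i j) := by
    intro p hp hne
    by_cases hl : ∀ ε, hp.point ≠ linePoint r ε
    · have h1 := hf τ p hp hl
      rw [principalDivisor_apply, germDiv_eq_one_iff, hp.mem_localUnits_iff, h,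
        hp.ordFrac_div hF1 hG1, hp.ord_φ hF hF0, hp.ord_φ hG hG0] at h1
      exact absurd (by omega) hne
    · push Not at hl
      exact exists_associated_of_point_eq r hp hl.choose_spec
  have hF2 : ∀ p, Prime p → p ∣ F →
      Associated p (δ K) ∨ ∃ i j, i ≠ j ∧ Associated p (H K i j) := by
    intro p hp hpF
    by_cases hpδ : p ∣ δ K
    · exact Or.inl (hp.associated_of_dvd δ_prime hpδ)
    · refine Or.inr (hord ⟨hp, hF.of_dvd hF0 hpF, hpδ⟩ fun he => ?_)
      rw [multiplicity_eq_zero.mpr fun hpG => hp.not_isUnit (hFG hpF hpG)] at he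
      exact multiplicity_eq_zero.mp he hpF
  have hG2 : ∀ p, Prime p → p ∣ G →
      Associated p (δ K) ∨ ∃ i j, i ≠ j ∧ Associated p (H K i j) := by
    intro p hp hpG
    by_cases hpδ : p ∣ δ K
    · exact Or.inl (hp.associated_of_dvd δ_prime hpδ)
    · refine Or.inr (hord ⟨hp, hG.of_dvd hG0 hpG, hpδ⟩ fun he => ?_)
      rw [multiplicity_eq_zero.mpr fun hpF => hp.not_isUnit (hFG hpF hpG)] at he
      exact multiplicity_eq_zero.mp he.symm hpG
  have h1 := sum_lineOrd_flip r F hF0 hF hF2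
  have h2 := sum_lineOrd_flip r G hG0 hG hG2
  have h3 : ∀ σ, τ * σ * τ = σ := fun σ => by rw [mul_right_comm, sign_mul_self, one_mul]
  simp only [lineDeg, lineMult_principalDivisor r _ hF1 hG1 h, chart_φ, lineOrd_signAct, h3,
    sign_mul_self, Finset.sum_sub_distrib]
  linarith

end
end TwoQuadrics

/-! ### Divisors of intersection number zero -/

namespace TwoQuadrics

open MvPolynomial Scheme

noncomputable section

variable {K : Type u} [Field K] [CharZero K] [IsDomain (CoordRing K)] [IsIntegral (surface K)]
  (r : Roots K)

theorem lineMult_one_right (ε : Fin 5 → ℤˣ) : lineMult r ε 1 = 0 :=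
  (lineMult_eq_zero_iff r ε 1).mpr rfl

theorem lineMult_prod {ι : Type*} (ε : Fin 5 → ℤˣ) (s : Finset ι)
    (D : ι → (surface K).cartierDivisors) :
    lineMult r ε (∏ i ∈ s, D i) = ∑ i ∈ s, lineMult r ε (D i) := by
  classical
  induction s using Finset.induction_on with
  | empty => simp [lineMult_one_right]
  | insert i s hi ih => rw [Finset.prod_insert hi, Finset.sum_insert hi, lineMult_mul, ih]

omit [IsDomain (CoordRing K)] in
variable {r} in
theorem SupportedOnLines.prod {ι : Type*} {s : Finset ι}
    {D : ι → (surface K).cartierDivisors} (h : ∀ i ∈ s, SupportedOnLines r (D i)) :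
    SupportedOnLines r (∏ i ∈ s, D i) := by
  classical
  induction s using Finset.induction_on with
  | empty => exact fun _ _ _ _ => rfl
  | insert i s hi ih =>
    rw [Finset.prod_insert hi]
    exact (h i (Finset.mem_insert_self _ _)).mul
      (ih fun j hj => h j (Finset.mem_insert_of_mem hj))

variable {r} in
theorem supportedOnLines_of_notMem {f : (surface K).functionFieldˣ} {n : ℕ} {a b : CoordRing K}
    (ha : a ∈ grading K n) (hb : b ∈ grading K n)
    (h : Proj.toFrac (grading K) f =
      algebraMap _ (FractionRing (CoordRing K)) a / algebraMap _ _ b)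
    (hab : ∀ (τ : Fin 5 → ℤˣ) (p : MvPolynomial (Fin 3) K) (hp : (chart r τ).IsCurve p),
      (∀ ε, hp.point ≠ linePoint r ε) →
        a ∉ hp.point.asHomogeneousIdeal ∧ b ∉ hp.point.asHomogeneousIdeal) :
    SupportedOnLines r ((surface K).principalDivisor f) := fun τ p hp hl => by
  rw [principalDivisor_apply, germDiv_eq_one_iff, Proj.mem_localUnits_iff]
  exact ⟨n, a, ha, b, hb, (hab τ p hp hl).1, (hab τ p hp hl).2, h⟩

/-- The function given by the quotient of two forms of the plane of the same degree, the divisors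
of which consist of lines. -/
theorem exists_unit_of_forms {F G : MvPolynomial (Fin 3) K} {n : ℕ} (hF : F.IsHomogeneous n)
    (hG : G.IsHomogeneous n) (hF0 : F ≠ 0) (hG0 : G ≠ 0)
    (h : ∀ (τ : Fin 5 → ℤˣ) (p : MvPolynomial (Fin 3) K) (hp : (chart r τ).IsCurve p),
      (∀ ε, hp.point ≠ linePoint r ε) →
        φ r F ∉ hp.point.asHomogeneousIdeal ∧ φ r G ∉ hp.point.asHomogeneousIdeal) :
    ∃ u, SupportedOnLines r ((surface K).principalDivisor u) ∧ ∀ ε,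
      lineMult r ε ((surface K).principalDivisor u) =
        lineOrd r ε (φ r F) - lineOrd r ε (φ r G) := by
  obtain ⟨u, hu⟩ := (chart r 1).exists_unit_toFrac_eq (φ_mem r hF) (φ_mem r hG)
    (φ_ne_zero r hF hF0) (φ_ne_zero r hG hG0)
  exact ⟨u, supportedOnLines_of_notMem (φ_mem r hF) (φ_mem r hG) hu h, fun ε =>
    lineMult_principalDivisor r ε (φ_ne_zero r hF hF0) (φ_ne_zero r hG hG0) hu⟩

omit [IsIntegral (surface K)] in
variable {r} in
theorem φ_H_notMem' {τ : Fin 5 → ℤˣ} {p : MvPolynomial (Fin 3) K}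
    (hp : (chart r τ).IsCurve p) (h : ∀ ε, hp.point ≠ linePoint r ε)
    {i j : Fin 5} (hij : i ≠ j) : φ r (H K i j) ∉ hp.point.asHomogeneousIdeal := by
  have := φ_H_notMem hp h 1 hij
  rwa [chart_φ, signAct_one] at this

omit [IsIntegral (surface K)] in
variable {r} in
theorem φ_δ_notMem' {τ : Fin 5 → ℤˣ} {p : MvPolynomial (Fin 3) K}
    (hp : (chart r τ).IsCurve p) (h : ∀ ε, hp.point ≠ linePoint r ε) :
    φ r (δ K) ∉ hp.point.asHomogeneousIdeal := by
  have := φ_δ_notMem hp h 1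
  rwa [chart_φ, signAct_one] at this

theorem flip_mul_comm (i j : Fin 5) : flip i * flip j = flip j * flip i := mul_comm _ _

variable {r} in
/-- A divisor supported on the lines is principal if its intersection numbers with the lines
vanish. The linear relations between its multiplicities which express this for the line with
signs `1` and its neighbours `flip i` determine the function as a product of powers of `φ δ` and
the `φ (H i j)`. -/
theorem SupportedOnLines.exists_principalDivisor_eq {D : (surface K).cartierDivisors}
    (hD : SupportedOnLines r D) (h : ∀ τ, lineDeg r τ D = 0) :
    ∃ g, (surface K).principalDivisor g = D := by
  have h01 : (0 : Fin 5) ≠ 1 := by decide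
  have hu : ∀ i j : Fin 5, ∃ u : (surface K).functionFieldˣ, i ≠ j →
      SupportedOnLines r ((surface K).principalDivisor u) ∧ ∀ ε,
        lineMult r ε ((surface K).principalDivisor u) =
          lineOrd r ε (φ r (H K i j)) - lineOrd r ε (φ r (H K 0 1)) := by
    intro i j
    by_cases hij : i = j
    · exact ⟨1, fun h => absurd hij h⟩
    · obtain ⟨u, hu⟩ := exists_unit_of_forms r (H_isHomogeneous i j) (H_isHomogeneous 0 1)
        (H_prime i j).ne_zero (H_prime 0 1).ne_zero
        fun τ p hp hl => ⟨φ_H_notMem' hp hl hij, φ_H_notMem' hp hl h01⟩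
      exact ⟨u, fun _ => hu⟩
  choose u hu using hu
  -- forms of the plane become functions after division by a power of `H 0 1`
  obtain ⟨v, hv, hv'⟩ := exists_unit_of_forms r (δ_isHomogeneous (K := K))
    (by simpa using (H_isHomogeneous (K := K) 0 1).pow 2) δ_prime.ne_zero
    (pow_ne_zero 2 (H_prime 0 1).ne_zero) fun τ p hp hl => ⟨φ_δ_notMem' hp hl, fun hm =>
      φ_H_notMem' hp hl h01 ((Proj.isPrime_toIdeal (grading K) _).mem_of_pow_mem 2
        (by rwa [map_pow] at hm))⟩
  have h0 := φ_ne_zero r (H_isHomogeneous 0 1) (H_prime 0 1).ne_zero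
  simp only [sq, map_mul, lineOrd_mul r _ h0 h0] at hv'
  -- the multiplicities of `D`
  set N : (Fin 5 → ℤˣ) → ℤ := fun ε => lineMult r ε D with hN
  set e : Fin 5 → Fin 5 → ℤ := fun i j => if i < j then N (flip i * flip j) else 0 with he
  set g := v ^ N 1 * ∏ i, ∏ j, u i j ^ e i j with hg
  have hdiv : (surface K).principalDivisor g = (surface K).principalDivisor v ^ N 1 *
      ∏ i, ∏ j, (surface K).principalDivisor (u i j) ^ e i j := by
    simp only [hg, map_mul, map_zpow, map_prod]
  have hsupp : SupportedOnLines r ((surface K).principalDivisor g) := by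
    rw [hdiv]
    refine (hv.zpow _).mul (.prod fun i _ => .prod fun j _ => ?_)
    by_cases hij : i < j
    · exact (hu i j hij.ne).1.zpow _
    · simp only [he, hij, if_false, zpow_zero]
      exact fun _ _ _ _ => rfl
  have hmult : ∀ ε, lineMult r ε ((surface K).principalDivisor g) =
      N 1 * (lineOrd r ε (φ r (δ K)) - 2 * lineOrd r ε (φ r (H K 0 1))) +
      ∑ i, ∑ j, e i j * (lineOrd r ε (φ r (H K i j)) - lineOrd r ε (φ r (H K 0 1))) := by
    intro ε
    rw [hdiv, lineMult_mul, lineMult_zpow, hv', lineMult_prod]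
    congr 1
    · push_cast; ring
    · refine Finset.sum_congr rfl fun i _ => ?_
      rw [lineMult_prod]
      refine Finset.sum_congr rfl fun j _ => ?_
      rw [lineMult_zpow]
      by_cases hij : i < j
      · rw [(hu i j hij.ne).2]
      · simp [he, hij]
  have hcomm : ∀ i j, N (flip i * flip j) = N (flip j * flip i) := fun i j => by
    rw [flip_mul_comm]
  -- the relations between the multiplicities of `D` given by the lines `1` and `flip i`
  have hone : ∑ i, N (flip i) = N 1 := by
    have := h 1
    simp only [lineDeg, one_mul] at this
    linarith
  have hflip : ∀ i, N (flip i) = N 1 + (∑ j, (e i j + e j i)) := by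
    intro i
    have := h (flip i)
    simp only [lineDeg] at this
    rw [sub_eq_zero] at this
    refine (Eq.symm this).trans ?_
    change ∑ j, N (flip i * flip j) = _
    rw [← Finset.add_sum_erase _ _ (Finset.mem_univ i), sign_mul_self,
      ← Finset.add_sum_erase Finset.univ (fun j => e i j + e j i) (Finset.mem_univ i)]
    simp only [he, lt_irrefl, if_false, add_zero, zero_add]
    congr 1
    refine Finset.sum_congr rfl fun j hj => ?_
    rcases lt_or_gt_of_ne (Finset.ne_of_mem_erase hj) with hji | hij
    · rw [if_neg hji.asymm, if_pos hji, zero_add, hcomm]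
    · rw [if_pos hij, if_neg hij.asymm, add_zero]
  -- the powers of `H 0 1` in the denominators of `g` cancel
  have hsum : ∑ i, ∑ j, e i j = -2 * N 1 := by
    simp only [hflip, Finset.sum_add_distrib] at hone
    rw [Finset.sum_comm (f := fun i j => e j i)] at hone
    simp only [Finset.sum_const, Finset.card_univ, Fintype.card_fin] at hone
    simp at hone
    linarith
  have hmult' : ∀ ε, lineMult r ε ((surface K).principalDivisor g) =
      N 1 * lineOrd r ε (φ r (δ K)) + ∑ i, ∑ j, e i j * lineOrd r ε (φ r (H K i j)) := by
    intro ε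
    rw [hmult]
    simp only [mul_sub, Finset.sum_sub_distrib, ← Finset.sum_mul, hsum]
    ring
  have hmono : ∀ (f : Fin 5 → Fin 5 → ℕ) (ε), (∀ i j, i ≠ j →
      lineOrd r ε (φ r (H K i j)) = f i j) → lineMult r ε ((surface K).principalDivisor g) =
      N 1 * lineOrd r ε (φ r (δ K)) + ∑ i, ∑ j, e i j * f i j := by
    intro f ε hf
    rw [hmult']
    congr 1
    refine Finset.sum_congr rfl fun i _ => Finset.sum_congr rfl fun j _ => ?_
    by_cases hij : i < j
    · rw [hf i j hij.ne]
    · simp [he, hij]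
  -- `D` and the divisor of `g` have the same multiplicities along the three types of lines
  have hcases : ∀ ε, lineMult r ε ((surface K).principalDivisor g) = N ε := by
    have hpos1 : lineMult r 1 ((surface K).principalDivisor g) = N 1 := by
      rw [hmono (fun _ _ => 1) 1 fun i j hij => lineOrd_one_φ_H r hij, lineOrd_one_φ_δ]
      simp only [Nat.cast_one, mul_one, hsum]
      push_cast; ring
    have hpos2 : ∀ m, lineMult r (flip m) ((surface K).principalDivisor g) = N (flip m) := by
      intro m
      rw [hmono (fun i j => if m = i ∨ m = j then 1 else 0) _
        fun i j hij => lineOrd_flip_φ_H r hij m, lineOrd_flip_φ_δ, hflip]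
      simp only [Nat.cast_one, mul_one, add_right_inj]
      have : ∀ i j, e i j * ((if m = i ∨ m = j then 1 else 0 : ℕ) : ℤ) =
          (if m = i then e i j else 0) + (if m = j then e i j else 0) := by
        intro i j
        rcases eq_or_ne i j with rfl | hij
        · simp [he]
        · by_cases h1 : m = i
          · subst h1; simp [hij]
          · simp [h1]
      simp only [this, Finset.sum_add_distrib]
      congr 1
      · rw [Finset.sum_comm]; simp
      · simp
    have hpos3 : ∀ k l, k ≠ l → lineMult r (flip k * flip l)
        ((surface K).principalDivisor g) = N (flip k * flip l) := by
      intro k l hkl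
      wlog hlt : k < l generalizing k l
      · rw [flip_mul_comm]
        exact this l k hkl.symm (lt_of_le_of_ne (not_lt.mp hlt) hkl.symm)
      rw [hmono (fun i j => if (k = i ∧ l = j) ∨ (k = j ∧ l = i) then 1 else 0) _
        fun i j hij => lineOrd_flip_mul_flip_φ_H r hij hkl, lineOrd_flip_mul_flip_φ_δ r hkl]
      have : ∀ i j, e i j * ((if (k = i ∧ l = j) ∨ (k = j ∧ l = i) then 1 else 0 : ℕ) : ℤ) =
          if k = i then (if l = j then e i j else 0) else 0 := by
        intro i j
        by_cases h1 : k = i ∧ l = j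
        · simp [h1]
        · by_cases h2 : k = j ∧ l = i
          · obtain ⟨rfl, rfl⟩ := h2
            simp [he, hlt.asymm, hlt.ne]
          · rw [if_neg (not_or.mpr ⟨h1, h2⟩)]
            rcases not_and_or.mp h1 with h1 | h1 <;> simp [h1]
      simp only [this]
      simp [he, hlt]
    have hneg : ∀ ε, N (-ε) = N ε := fun ε => lineMult_neg r ε D
    intro ε
    rcases sign_cases_flip ε with (rfl | rfl) | ⟨i, rfl | rfl⟩ | ⟨i, j, hij, rfl | rfl⟩
    · exact hpos1
    · rw [lineMult_neg, hneg, hpos1]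
    · exact hpos2 i
    · rw [lineMult_neg, hneg, hpos2]
    · exact hpos3 i j hij
    · rw [lineMult_neg, hneg, hpos3 i j hij]
  refine ⟨g, (div_eq_one.mp ((hD.div hsupp).eq_one fun ε => ?_)).symm⟩
  rw [← lineMult_eq_zero_iff, lineMult_div, hcases, sub_self]

end
end TwoQuadrics

/-! ### Hyperplane sections -/

namespace TwoQuadrics

open MvPolynomial Scheme

noncomputable section

section Hyperplane

variable {K : Type u} [Field K] [CharZero K] [IsDomain (CoordRing K)] [IsIntegral (surface K)]
  {h : CoordRing K}

omit [CharZero K] [IsDomain (CoordRing K)] [IsIntegral (surface K)] in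
theorem exists_T_notMem [CharZero K] (x : surface K) : ∃ n, T n ∉ x.asHomogeneousIdeal := by
  by_contra! hx
  exact x.not_irrelevant_le (irrelevant_le_of_T_mem x hx)

omit [CharZero K] [IsDomain (CoordRing K)] [IsIntegral (surface K)] in
theorem exists_unit_toFrac_eq [CharZero K] [IsDomain (CoordRing K)] [IsIntegral (surface K)]
    (r : Roots K) {n : ℕ} {a b : CoordRing K} (ha : a ∈ grading K n) (hb : b ∈ grading K n)
    (ha0 : a ≠ 0) (hb0 : b ≠ 0) : ∃ g : (surface K).functionFieldˣ,
      Proj.toFrac (grading K) g = algebraMap _ _ a / algebraMap _ _ b :=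
  (chart r 1).exists_unit_toFrac_eq ha hb ha0 hb0

theorem exists_hyperplane_eq (r : Roots K) (hh : h ∈ grading K 1) (h0 : h ≠ 0) (x : surface K) :
    ∃ f : (surface K).functionFieldˣ, ∃ b ∈ grading K 1, b ∉ x.asHomogeneousIdeal ∧
      Proj.toFrac (grading K) f = algebraMap _ _ h / algebraMap _ _ b := by
  obtain ⟨n, hn⟩ := exists_T_notMem x
  obtain ⟨f, hf⟩ := exists_unit_toFrac_eq r hh (T_mem n) h0 fun hT => hn (hT ▸ zero_mem _)
  exact ⟨f, T n, T_mem n, hn, hf⟩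

omit [CharZero K] in
/-- Two fractions with the same numerator and with denominators of the same degree which do not
vanish at `x` have the same divisor at `x`. -/
theorem germDiv_eq_germDiv {x : surface K} {f g : (surface K).functionFieldˣ} {m n : ℕ}
    {a b c e : CoordRing K} (hx : b ∉ x.asHomogeneousIdeal) (hx' : e ∉ x.asHomogeneousIdeal)
    (ha : a ≠ 0) (hb : b ∈ grading K m) (he : e ∈ grading K n) (hmn : m = n) (hac : a = c)
    (hf : Proj.toFrac (grading K) f = algebraMap _ _ a / algebraMap _ _ b)
    (hg : Proj.toFrac (grading K) g = algebraMap _ _ c / algebraMap _ _ e) :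
    (surface K).germDiv x f = (surface K).germDiv x g := by
  subst hac hmn
  rw [← div_eq_one, ← map_div, germDiv_eq_one_iff, Proj.mem_localUnits_iff]
  refine ⟨m, e, he, b, hb, hx', hx, ?_⟩
  have hne : ∀ {b : CoordRing K}, b ≠ 0 → algebraMap _ (FractionRing (CoordRing K)) b ≠ 0 :=
    fun hb h0 => hb ((map_eq_zero_iff _ (IsFractionRing.injective _ _)).mp h0)
  rw [Units.val_div_eq_div_val, map_div₀, hf, hg]
  have h1 := hne ha
  have h2 := hne (b := b) fun h => hx (h ▸ zero_mem _)
  have h3 := hne (b := e) fun h => hx' (h ▸ zero_mem _)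
  field_simp

/-- The divisor of the section `h` of `𝒪(1)`. -/
def hyperplane (r : Roots K) (hh : h ∈ grading K 1) (h0 : h ≠ 0) :
    (surface K).cartierDivisors :=
  ⟨fun x => (surface K).germDiv x (exists_hyperplane_eq r hh h0 x).choose, fun x => by
    obtain ⟨b, hb, hbx, hf⟩ := (exists_hyperplane_eq r hh h0 x).choose_spec
    refine ⟨ProjectiveSpectrum.basicOpen (grading K) b, hbx,
      (exists_hyperplane_eq r hh h0 x).choose, fun y hy => ?_⟩
    obtain ⟨b', hb', hbx', hf'⟩ := (exists_hyperplane_eq r hh h0 y).choose_spec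
    exact germDiv_eq_germDiv hbx' hy h0 hb' hb rfl rfl hf' hf⟩

theorem hyperplane_apply (r : Roots K) (hh : h ∈ grading K 1) (h0 : h ≠ 0) {x : surface K}
    {f : (surface K).functionFieldˣ} {b : CoordRing K} (hb : b ∈ grading K 1)
    (hbx : b ∉ x.asHomogeneousIdeal)
    (hf : Proj.toFrac (grading K) f = algebraMap _ _ h / algebraMap _ _ b) :
    (hyperplane r hh h0).1 x = (surface K).germDiv x f := by
  obtain ⟨b', hb', hbx', hf'⟩ := (exists_hyperplane_eq r hh h0 x).choose_spec
  exact germDiv_eq_germDiv hbx' hbx h0 hb' hb rfl rfl hf' hf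

/-- All hyperplane sections are linearly equivalent. -/
theorem divisorClass_hyperplane (r : Roots K) {h' : CoordRing K} (hh : h ∈ grading K 1)
    (h0 : h ≠ 0) (hh' : h' ∈ grading K 1) (h0' : h' ≠ 0) :
    (surface K).divisorClass (hyperplane r hh h0) =
      (surface K).divisorClass (hyperplane r hh' h0') := by
  obtain ⟨g, hg⟩ := exists_unit_toFrac_eq r hh hh' h0 h0'
  refine divisorClass_eq_iff.mpr ⟨g, cartierDivisors_ext fun x => ?_⟩
  obtain ⟨f, b, hb, hbx, hf⟩ := exists_hyperplane_eq r hh' h0' x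
  have hne : algebraMap _ (FractionRing (CoordRing K)) h' ≠ 0 :=
    fun h => h0' ((map_eq_zero_iff _ (IsFractionRing.injective _ _)).mp h)
  have hgf : Proj.toFrac (grading K) (g * f : (surface K).functionFieldˣ) =
      algebraMap _ _ h / algebraMap _ _ b := by
    rw [Units.val_mul, map_mul, hg, hf, div_mul_div_cancel₀ hne]
  rw [coe_div_apply, principalDivisor_apply, hyperplane_apply r hh' h0' hb hbx hf,
    hyperplane_apply r hh h0 hb hbx hgf, map_mul, mul_div_cancel_right]

theorem lineMult_hyperplane (r : Roots K) (hh : h ∈ grading K 1) (h0 : h ≠ 0)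
    (ε : Fin 5 → ℤˣ) : lineMult r ε (hyperplane r hh h0) = lineOrd r ε h := by
  obtain ⟨f, b, hb, hbx, hf⟩ := exists_hyperplane_eq r hh h0 (linePoint r ε)
  have hb0 : b ≠ 0 := by rintro rfl; exact hbx (zero_mem _)
  rw [lineMult_of_germ r ε (hyperplane_apply r hh h0 hb hbx hf) h0 hb0 hf]
  rw [mem_linePoint_iff r ε hb0, not_not] at hbx
  rw [hbx, Nat.cast_zero, sub_zero]

/-- The section of the surface by the hyperplane through the centre of the projection which lies
over the line `H 0 1 = 0` of the plane: it is the sum of the four lines of a quadrilateral. -/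
def quadrilateral (r : Roots K) : (surface K).cartierDivisors :=
  hyperplane r (φ_mem r (H_isHomogeneous 0 1)) (φ_ne_zero r (H_isHomogeneous 0 1)
    (H_prime 0 1).ne_zero)

theorem supportedOnLines_quadrilateral (r : Roots K) :
    SupportedOnLines r (quadrilateral r) := fun τ p hp hl => by
  obtain ⟨f, b, hb, hbx, hf⟩ := exists_hyperplane_eq r (φ_mem r (H_isHomogeneous 0 1))
    (φ_ne_zero r (H_isHomogeneous 0 1) (H_prime 0 1).ne_zero) hp.point
  rw [quadrilateral, hyperplane_apply r _ _ hb hbx hf, germDiv_eq_one_iff,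
    Proj.mem_localUnits_iff]
  exact ⟨1, _, φ_mem r (H_isHomogeneous 0 1), b, hb, φ_H_notMem' hp hl (by decide), hbx, hf⟩

/-- A hyperplane section has intersection number one with every line. -/
theorem lineDeg_quadrilateral (r : Roots K) (τ : Fin 5 → ℤˣ) :
    lineDeg r τ (quadrilateral r) = 1 := by
  have h : Distinct 0 1 2 3 4 := by decide
  have key : ∀ s t u : ℤˣ, ∑ i, ((if s * flip i 2 = t * flip i 3 ∧ u * flip i 4 = t * flip i 3
      then 1 else 0 : ℕ) : ℤ) - ((if s = t ∧ u = t then 1 else 0 : ℕ) : ℤ) = 1 := by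
    decide
  simp only [lineDeg, quadrilateral, lineMult_hyperplane, lineOrd_φ_H r _ h]
  exact key (τ 2) (τ 3) (τ 4)

end Hyperplane

/-! ### The action of field automorphisms -/

section Galois

variable {K : Type u} [Field K]

theorem coordMap_algebraMap (σ : K ≃+* K) (t : K) :
    coordMap σ (algebraMap K (CoordRing K) t) = algebraMap K _ (σ t) :=
  congrArg (Ideal.Quotient.mk (ideal K)) (map_C _ t)

theorem coordMap_T (σ : K ≃+* K) (n : Fin 5) : coordMap σ (T n) = T n :=
  congrArg (Ideal.Quotient.mk (ideal K)) (map_X _ n)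

theorem coordMap_injective (σ : K ≃+* K) : Function.Injective (coordMap σ) := fun x y h => by
  have : ∀ x, coordMap σ.symm (coordMap σ x) = x :=
    DFunLike.congr_fun (coordMap_comp σ.symm σ σ.symm_apply_apply)
  rw [← this x, h, this]

theorem coordMap_ne_zero (σ : K ≃+* K) {x : CoordRing K} (hx : x ≠ 0) : coordMap σ x ≠ 0 :=
  fun h => hx (coordMap_injective σ (h.trans (map_zero _).symm))

theorem mem_fieldAut_iff (σ : K ≃+* K) (x : surface K) (a : CoordRing K) :
    a ∈ (fieldAut σ x).asHomogeneousIdeal ↔ coordMap σ a ∈ x.asHomogeneousIdeal := Iff.rfl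

theorem map_cub (σ : K ≃+* K) (n : Fin 5) : MvPolynomial.map (σ : K →+* K) (cub n) = cub n := by
  rw [cub, map_cubic, map_a]; simp

theorem map_H (σ : K ≃+* K) (i j : Fin 5) :
    MvPolynomial.map (σ : K →+* K) (H K i j) = H K i j := by
  rw [H, map_join, map_a, map_a]; simp

theorem map_δ (σ : K ≃+* K) : MvPolynomial.map (σ : K →+* K) (δ K) = δ K := by
  rw [δ, map_conic]; simp

variable [CharZero K] (r : Roots K)

/-- A field automorphism which changes the signs of the square roots by `s` moves the
parametrization to that of another chart. -/
theorem ψ_signAct_coordMap {σ : K ≃+* K} {s : Fin 5 → ℤˣ}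
    (hs : ∀ n, σ (r.c n) = (s n : ℤ) * r.c n) (τ : Fin 5 → ℤˣ) (x : CoordRing K) :
    ψ r (signAct τ (coordMap σ x)) =
      MvPolynomial.map (σ : K →+* K) (ψ r (signAct (τ * s) x)) := by
  have : ((ψ r).toRingHom.comp (signAct (K := K) τ).toRingHom).comp (coordMap σ).toRingHom =
      (MvPolynomial.map (σ : K →+* K)).comp
        ((ψ r).toRingHom.comp (signAct (K := K) (τ * s)).toRingHom) := by
    refine coordRing_hom_ext (fun t => ?_) fun n => ?_
    · change ψ r (signAct τ (coordMap σ (algebraMap K _ t))) = MvPolynomial.map (σ : K →+* K)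
        (ψ r (signAct (τ * s) (algebraMap K _ t)))
      rw [coordMap_algebraMap, AlgHom.commutes, AlgHom.commutes, AlgHom.commutes, AlgHom.commutes,
        algebraMap_eq, map_C]
      rfl
    · change ψ r (signAct τ (coordMap σ (T n))) = MvPolynomial.map (σ : K →+* K)
        (ψ r (signAct (τ * s) (T n)))
      rw [coordMap_T, signAct_T, signAct_T, map_mul, map_mul, map_mul, ψ_T, map_mul, map_C, map_cub,
        map_intCast, map_intCast, map_intCast]
      have h1 : (σ : K →+* K) (2 * r.c n)⁻¹ = (s n : ℤ) * (2 * r.c n)⁻¹ := by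
        change σ (2 * r.c n)⁻¹ = _
        rw [map_inv₀, map_mul, map_ofNat, hs]
        rcases Int.units_eq_one_or (s n) with h | h <;> simp [h]
      rw [h1, map_mul, Pi.mul_apply]
      rcases Int.units_eq_one_or (s n) with h | h <;> simp [h]
  exact RingHom.congr_fun this x

variable {r} {σ : K ≃+* K} {s : Fin 5 → ℤˣ} (hs : ∀ n, σ (r.c n) = (s n : ℤ) * r.c n)

include hs in
theorem dvd_ψ_signAct_coordMap_iff (τ : Fin 5 → ℤˣ) (p : MvPolynomial (Fin 3) K)
    (x : CoordRing K) : MvPolynomial.map (σ : K →+* K) p ∣ ψ r (signAct τ (coordMap σ x)) ↔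
      p ∣ ψ r (signAct (τ * s) x) := by
  rw [ψ_signAct_coordMap r hs]
  exact map_dvd_iff (MvPolynomial.mapEquiv (Fin 3) σ)

include hs in
theorem lineOrd_coordMap (ε : Fin 5 → ℤˣ) (x : CoordRing K) :
    lineOrd r ε (coordMap σ x) = lineOrd r (ε * s) x := by
  rw [lineOrd_eq, lineOrd_eq, ψ_signAct_coordMap r hs, mul_right_comm ε]
  nth_rw 1 [← map_H σ]
  exact multiplicity_map_eq (MvPolynomial.mapEquiv (Fin 3) σ)

include hs in
theorem fieldAut_linePoint [IsDomain (CoordRing K)] (ε : Fin 5 → ℤˣ) :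
    fieldAut σ (linePoint r ε) = linePoint r (ε * s) := by
  refine ProjectiveSpectrum.ext (SetLike.ext fun a => ?_)
  rw [mem_fieldAut_iff]
  rcases eq_or_ne a 0 with rfl | ha
  · exact ⟨fun _ => zero_mem _, fun _ => by rw [map_zero]; exact zero_mem _⟩
  · rw [mem_linePoint_iff r _ ha, mem_linePoint_iff r _ (coordMap_ne_zero σ ha),
      lineOrd_coordMap hs]

include hs in
/-- A field automorphism multiplying the square roots by the signs `s` maps the curves of the chart
with signs `τ` to curves of the chart with signs `τ * s`. -/
theorem fieldAut_point {τ : Fin 5 → ℤˣ} {p : MvPolynomial (Fin 3) K}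
    (hp : (chart r τ).IsCurve p) :
    ∃ (q : _) (hq : (chart r (τ * s)).IsCurve q), fieldAut σ hp.point = hq.point := by
  obtain ⟨q, rfl⟩ := (MvPolynomial.mapEquiv (Fin 3) σ).surjective p
  have hq : (chart r (τ * s)).IsCurve q := by
    refine ⟨(MulEquiv.prime_iff (MvPolynomial.mapEquiv (Fin 3) σ)).mp hp.prime, ?_, fun hd => ?_⟩
    · obtain ⟨n, hn⟩ := hp.hom
      have := IsHomogeneous.map hn (σ.symm : K →+* K)
      exact ⟨n, (MvPolynomial.mapEquiv (Fin 3) σ).symm_apply_apply q ▸ this⟩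
    · refine hp.not_dvd ?_
      rw [chart_δ] at hd ⊢
      have := map_dvd (MvPolynomial.map (σ : K →+* K)) hd
      rwa [map_δ] at this
  refine ⟨q, hq, ProjectiveSpectrum.ext (SetLike.ext fun a => ?_)⟩
  rw [mem_fieldAut_iff, hp.mem_point, hq.mem_point, chart_ψ, chart_ψ]
  exact dvd_ψ_signAct_coordMap_iff hs τ q a

/-- The automorphism of the field of fractions of the coordinate ring given by a field
automorphism. -/
def fracMap [IsDomain (CoordRing K)] (σ : K ≃+* K) :
    FractionRing (CoordRing K) →+* FractionRing (CoordRing K) :=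
  IsFractionRing.map (j := (coordMap σ).toRingHom) (coordMap_injective σ)

omit [CharZero K] in
theorem fracMap_algebraMap [IsDomain (CoordRing K)] (σ : K ≃+* K) (a : CoordRing K) :
    fracMap σ (algebraMap _ _ a) = algebraMap _ _ (coordMap σ a) :=
  IsLocalization.map_eq (S := FractionRing (CoordRing K)) (Q := FractionRing (CoordRing K))
    (nonZeroDivisors_le_comap_nonZeroDivisors_of_injective (coordMap σ).toRingHom
      (coordMap_injective σ)) a

variable [IsDomain (CoordRing K)] [IsIntegral (surface K)]

omit [CharZero K] in
theorem toFrac_fieldAut (σ : K ≃+* K) {f : (surface K).functionFieldˣ} {a b : CoordRing K}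
    (hf : Proj.toFrac (grading K) f = algebraMap _ _ a / algebraMap _ _ b) :
    Proj.toFrac (grading K)
      (Units.map (functionFieldMap (fieldAut σ)).hom.toMonoidHom f :
        (surface K).functionFieldˣ) =
      algebraMap _ _ (coordMap σ a) / algebraMap _ _ (coordMap σ b) := by
  have : IsDominant (Proj.map (coordMap σ) (irrelevant_le σ)) :=
    inferInstanceAs (IsDominant (fieldAut σ))
  refine (Proj.toFrac_functionFieldMap (grading K) (coordMap σ) (irrelevant_le σ) (fracMap σ)
    (fracMap_algebraMap σ) f).trans ?_
  rw [hf, map_div₀, fracMap_algebraMap, fracMap_algebraMap]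

omit [CharZero K] [IsDomain (CoordRing K)] in
theorem cartierPullback_apply_of_germ (σ : K ≃+* K) {D : (surface K).cartierDivisors}
    {x : surface K} {f : (surface K).functionFieldˣ}
    (hf : D.1 (fieldAut σ x) = (surface K).germDiv _ f) :
    (cartierPullback (fieldAut σ) D).1 x = (surface K).germDiv x
      (Units.map (functionFieldMap (fieldAut σ)).hom.toMonoidHom f) :=
  (congrArg (cartierStalkMap (fieldAut σ) x) hf).trans (cartierStalkMap_germDiv _ x f)

include hs in
theorem lineMult_cartierPullback (ε : Fin 5 → ℤˣ) (D : (surface K).cartierDivisors) :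
    lineMult r ε (cartierPullback (fieldAut σ) D) = lineMult r (ε * s) D := by
  obtain ⟨U, hU, f, hf⟩ := D.2 (linePoint r (ε * s))
  obtain ⟨n, a, ha, b, hb, ha0, hb0, h⟩ := PlaneChart.exists_toFrac_unit_eq f
  rw [lineMult_of_germ r _ (hf _ hU) ha0 hb0 h, lineMult_of_germ r ε
    (cartierPullback_apply_of_germ σ (hf _ (by rw [fieldAut_linePoint hs]; exact hU)))
    (coordMap_ne_zero σ ha0) (coordMap_ne_zero σ hb0) (toFrac_fieldAut σ h),
    lineOrd_coordMap hs, lineOrd_coordMap hs]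

include hs in
theorem lineDeg_cartierPullback (τ : Fin 5 → ℤˣ) (D : (surface K).cartierDivisors) :
    lineDeg r τ (cartierPullback (fieldAut σ) D) = lineDeg r (τ * s) D := by
  simp only [lineDeg, lineMult_cartierPullback hs, mul_right_comm]

include hs in
theorem SupportedOnLines.cartierPullback {D : (surface K).cartierDivisors}
    (hD : SupportedOnLines r D) :
    SupportedOnLines r (cartierPullback (fieldAut σ) D) := fun τ p hp hl => by
  obtain ⟨q, hq, h⟩ := fieldAut_point hs hp
  have h1 : D.1 hq.point = 1 := hD _ q hq fun ε he => by
    refine hl (ε * s) ?_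
    have : fieldAut σ hp.point = fieldAut σ (linePoint r (ε * s)) := by
      rw [h, he, fieldAut_linePoint hs, mul_assoc, sign_mul_self, mul_one]
    exact (fieldAut σ).homeomorph.injective this
  have h2 : D.1 (fieldAut σ hp.point) = 1 := by rw [h]; exact h1
  exact (congrArg (cartierStalkMap (fieldAut σ) hp.point) h2).trans (map_one _)

theorem cartierPullback_hyperplane (r : Roots K) (σ : K ≃+* K) {h : CoordRing K}
    (hh : h ∈ grading K 1) (h0 : h ≠ 0) (hσ : coordMap σ h = h) :
    Scheme.cartierPullback (fieldAut σ) (hyperplane r hh h0) = hyperplane r hh h0 := by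
  refine cartierDivisors_ext fun x => ?_
  obtain ⟨f, b, hb, hbx, hf⟩ := exists_hyperplane_eq r hh h0 (fieldAut σ x)
  rw [cartierPullback_apply_of_germ σ (hyperplane_apply r hh h0 hb hbx hf)]
  refine (hyperplane_apply r hh h0 ((coordMap σ).map_mem hb) hbx ?_).symm
  have := toFrac_fieldAut σ hf
  rwa [hσ] at this

omit [CharZero K] [IsDomain (CoordRing K)] in
theorem picardPullback_divisorClass (f : surface K ⟶ surface K) [IsDominant f]
    (D : (surface K).cartierDivisors) :
    picardPullback f ((surface K).divisorClass D) =
      (surface K).divisorClass (Scheme.cartierPullback f D) := rfl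

omit [IsDomain (CoordRing K)] [IsIntegral (surface K)] in
theorem T_ne_zero (r : Roots K) (n : Fin 5) : (T n : CoordRing K) ≠ 0 := by
  intro h0
  -- otherwise the change of the `n`-th sign is trivial
  have h : (signAct (K := K) (flip n)).toRingHom = RingHom.id _ := by
    refine coordRing_hom_ext (fun t => (signAct (flip n)).commutes t) fun m => ?_
    refine (signAct_T _ m).trans ?_
    rcases eq_or_ne m n with rfl | hm
    · rw [h0, mul_zero, map_zero]
    · simp [flip, hm]
  have h1 := lineOrd_signAct r 1 (flip n) (φ r (δ K))
  rw [one_mul, lineOrd_flip_φ_δ,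
    show signAct (flip n) (φ r (δ K)) = φ r (δ K) from RingHom.congr_fun h _,
    lineOrd_one_φ_δ] at h1
  omega

theorem picardPullback_hyperplane (r : Roots K) (σ : K ≃+* K) :
    picardPullback (fieldAut σ) ((surface K).divisorClass (quadrilateral r)) =
      (surface K).divisorClass (quadrilateral r) := by
  rw [quadrilateral, divisorClass_hyperplane r _ _ (T_mem 0) (T_ne_zero r 0),
    picardPullback_divisorClass, cartierPullback_hyperplane r σ _ _ (coordMap_T σ 0)]

/-- If the Galois group realizes all sign changes (up to a common sign) of the square roots, the
invariant classes are the multiples of the class of a hyperplane section: an invariant class has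
the same intersection number with all lines. -/
theorem mem_zpowers_of_invariant (r : Roots K) {S : Set (K ≃+* K)}
    (hS : ∀ s : Fin 5 → ℤˣ, ∏ n, s n = 1 → ∃ σ ∈ S, ∀ n, σ (r.c n) = (s n : ℤ) * r.c n)
    {p : (surface K).PicardGroup} (hp : ∀ σ ∈ S, picardPullback (fieldAut σ) p = p) :
    p ∈ Subgroup.zpowers ((surface K).divisorClass (quadrilateral r)) := by
  obtain ⟨D₀, rfl⟩ := divisorClass_surjective p
  obtain ⟨g, hD⟩ := exists_supportedOnLines r D₀
  set D := D₀ / (surface K).principalDivisor g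
  have hDD : (surface K).divisorClass D₀ = (surface K).divisorClass D :=
    divisorClass_eq_iff.mpr ⟨g, (div_div_cancel _ _).symm⟩
  rw [hDD] at hp ⊢
  have hdeg : ∀ s, ∏ n, s n = 1 → lineDeg r s D = lineDeg r 1 D := by
    intro s hs1
    obtain ⟨σ, hσ, hs⟩ := hS s hs1
    obtain ⟨g, hg⟩ := divisorClass_eq_iff.mp
      ((picardPullback_divisorClass (fieldAut σ) D).symm.trans (hp σ hσ))
    have h1 := lineDeg_principalDivisor r 1 (hg ▸ (hD.cartierPullback hs).div hD)
    rw [hg, lineDeg_div, lineDeg_cartierPullback hs, one_mul, sub_eq_zero] at h1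
    exact h1
  -- changing all signs changes the product of the signs but not the line
  have hdeg' : ∀ s, lineDeg r s D = lineDeg r 1 D := by
    intro s
    rcases Int.units_eq_one_or (∏ n, s n) with h | h
    · exact hdeg s h
    · rw [← lineDeg_neg, hdeg (-s) ?_]
      simp only [Pi.neg_apply, Fin.prod_univ_five] at h ⊢
      rw [← neg_eq_iff_eq_neg] at h
      simpa using h
  obtain ⟨g, hg⟩ := (hD.div ((supportedOnLines_quadrilateral r).zpow
    (lineDeg r 1 D))).exists_principalDivisor_eq fun τ => by
      rw [lineDeg_div, lineDeg_zpow, lineDeg_quadrilateral, hdeg', mul_one, sub_self]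
  refine ⟨lineDeg r 1 D, ?_⟩
  change _ ^ _ = _
  rw [← map_zpow]
  exact (divisorClass_eq_iff.mpr ⟨g, hg⟩).symm

end Galois

end
end TwoQuadrics

/-! ### Differential forms of the second degree -/

namespace TwoQuadrics

open KaehlerDifferential

noncomputable section

section Wedge

variable {F M : Type*} [Field F] [AddCommGroup M] [Module F M]

theorem update_one {M : Type*} (x y z : M) : Function.update ![x, y] 1 z = ![x, z] := by
  funext i
  fin_cases i <;> rfl

/-- The exterior product of two vectors. -/
def wedge : M →ₗ[F] M →ₗ[F] ⋀[F]^2 M :=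
  LinearMap.mk₂ F (fun x y => exteriorPower.ιMulti F 2 ![x, y])
    (fun x x' y => (exteriorPower.ιMulti F 2).map_vecCons_add ![y] x x')
    (fun c x y => (exteriorPower.ιMulti F 2).map_vecCons_smul ![y] c x)
    (fun x y y' => by
      have := (exteriorPower.ιMulti F 2).map_update_add ![x, y] 1 y y'
      rwa [update_one, update_one, update_one] at this)
    (fun c x y => by
      have := (exteriorPower.ιMulti F 2).map_update_smul ![x, y] 1 c y
      rwa [update_one, update_one] at this)

theorem wedge_apply (x y : M) : wedge x y = exteriorPower.ιMulti F 2 ![x, y] := rfl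

theorem isAlt_wedge : (wedge : M →ₗ[F] M →ₗ[F] ⋀[F]^2 M).IsAlt := fun x =>
  (exteriorPower.ιMulti F 2).map_eq_zero_of_eq ![x, x] (i := 0) (j := 1) rfl (by decide)

variable {N : Type*} [AddCommGroup N] [Module F N] (B : M →ₗ[F] M →ₗ[F] N)

/-- The exterior product of three vectors of `F × M`, or rather its component in `F ⊗ ⋀² M`,
evaluated with an alternating map `B` on `M`. -/
def tripleProd (s : Fin 5 → F) (w : Fin 5 → M) (i c d : Fin 5) : N :=
  s i • B (w c) (w d) - s c • B (w i) (w d) + s d • B (w i) (w c)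

variable {B} (hB : B.IsAlt)

include hB in
theorem tripleProd_swap (s : Fin 5 → F) (w : Fin 5 → M) (i c d : Fin 5) :
    tripleProd B s w c i d = -tripleProd B s w i c d := by
  simp only [tripleProd, ← hB.neg (w i) (w c)]
  module

include hB in
theorem tripleProd_swap' (s : Fin 5 → F) (w : Fin 5 → M) (i c d : Fin 5) :
    tripleProd B s w i d c = -tripleProd B s w i c d := by
  simp only [tripleProd, ← hB.neg (w c) (w d)]
  module

include hB in
/-- If the `s m` and the `w m` satisfy the same linear relation between four indices, the triple
products of three of these indices are proportional. -/
theorem tripleProd_exchange {s : Fin 5 → F} {w : Fin 5 → M} {i a c d : Fin 5} {α : Fin 5 → F}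
    (hs : α a * s a = -(α i * s i + α c * s c + α d * s d))
    (hw : α a • w a = -(α i • w i + α c • w c + α d • w d)) :
    α a • tripleProd B s w a c d = -α i • tripleProd B s w i c d := by
  have h : α a • tripleProd B s w a c d = (α a * s a) • B (w c) (w d) -
      s c • B (α a • w a) (w d) + s d • B (α a • w a) (w c) := by
    simp only [tripleProd, map_smul, LinearMap.smul_apply]
    module
  rw [h, hs, hw]
  simp only [tripleProd, map_neg, map_add, map_smul, LinearMap.smul_apply, LinearMap.add_apply,
    LinearMap.neg_apply, hB.self_eq_zero, ← hB.neg (w c) (w d)]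
  module

end Wedge

/-- A property of triples of distinct indices which is invariant under permutations and under the
exchange of one index holds for all of them if it holds for one. -/
theorem forall_distinct_triple {P : Fin 5 → Fin 5 → Fin 5 → Prop} (h₀ : P 0 1 2)
    (h₁ : ∀ i c d, P i c d → P c i d) (h₂ : ∀ i c d, P i c d → P i d c)
    (h₃ : ∀ i a c d, a ≠ i → i ≠ c → i ≠ d → a ≠ c → a ≠ d → c ≠ d → P i c d → P a c d)
    {i c d : Fin 5} (hic : i ≠ c) (hid : i ≠ d) (hcd : c ≠ d) : P i c d := by
  have h₄ : ∀ d, d ≠ 0 → d ≠ 1 → P 0 1 d := by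
    intro d hd0 hd1
    rcases eq_or_ne d 2 with rfl | hd2
    · exact h₀
    · have := h₃ 2 d 0 1 hd2 (by decide) (by decide) hd0 hd1 (by decide)
        (h₁ _ _ _ (h₂ _ _ _ h₀))
      exact h₂ _ _ _ (h₁ _ _ _ this)
  have h₅ : ∀ c d, c ≠ 0 → d ≠ 0 → c ≠ d → P 0 c d := by
    intro c d hc0 hd0 hcd
    rcases eq_or_ne c 1 with rfl | hc1
    · exact h₄ d hd0 hcd.symm
    rcases eq_or_ne d 1 with rfl | hd1
    · exact h₂ _ _ _ (h₄ c hc0 hc1)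
    exact h₁ _ _ _ (h₃ 1 c 0 d hc1 (by decide) hd1.symm hc0 hcd hd0.symm
      (h₁ _ _ _ (h₄ d hd0 hd1)))
  rcases eq_or_ne i 0 with rfl | hi
  · exact h₅ c d hic.symm hid.symm hcd
  rcases eq_or_ne c 0 with rfl | hc
  · exact h₁ _ _ _ (h₅ i d hic hcd.symm hid)
  rcases eq_or_ne d 0 with rfl | hd
  · exact h₂ _ _ _ (h₁ _ _ _ (h₅ i c hid hcd hic))
  exact h₃ 0 i c d hi hc.symm hd.symm hic hid hcd (h₅ c d hc hd hcd)

variable {K F : Type u} [Field K] [Field F] [CharZero K] [Algebra K F] {t : Fin 5 → F}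
  (ht : ∀ n, t n ≠ 0) (h₁ : ∑ n, t n ^ 2 = 0) (h₂ : ∑ n, a F n * t n ^ 2 = 0)

variable {N : Type*} [AddCommGroup N] [Module F N] {B : Ω[F⁄K] →ₗ[F] Ω[F⁄K] →ₗ[F] N}
  (hB : B.IsAlt)

variable (B t) in
/-- The rational differential form on the surface given by the residue of the standard form of
projective space, in the coordinates `t`. -/
def residueForm : N :=
  (∏ n, t n)⁻¹ • tripleProd B (fun n => t n ^ 2) (fun n => t n • D K F (t n)) 0 1 2

theorem prod_distinct {S : Type*} [CommMonoid S] {i j k l n : Fin 5} (h : Distinct i j k l n)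
    (f : Fin 5 → S) : ∏ m, f m = f i * f j * f k * f l * f n := by
  have hu : (Finset.univ : Finset (Fin 5)) = [i, j, k, l, n].toFinset :=
    (Finset.eq_univ_of_card _ (by rw [List.toFinset_card_of_nodup h]; rfl)).symm
  rw [hu, List.prod_toFinset _ h]
  simp [mul_assoc]

include h₁ h₂ in
omit [CharZero K] [Algebra K F] [Field K] in
theorem sum_sub_mul_sq {i a₁ b c d : Fin 5} (h : Distinct i a₁ b c d) :
    (a F a₁ - a F b) * t a₁ ^ 2 + (a F i - a F b) * t i ^ 2 + (a F c - a F b) * t c ^ 2 +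
      (a F d - a F b) * t d ^ 2 = 0 := by
  have := sum_distinct h (fun n => (a F n - a F b) * t n ^ 2)
  simp only [sub_mul, Finset.sum_sub_distrib, ← Finset.mul_sum, h₁, h₂] at this
  linear_combination -this

include h₁ h₂ in
/-- The differential of the equation obtained by elimination of the coordinate `b` from the two
quadrics. -/
theorem sum_sub_smul_D {i a₁ b c d : Fin 5} (h : Distinct i a₁ b c d) :
    (a F a₁ - a F b) • t a₁ • D K F (t a₁) = -((a F i - a F b) • t i • D K F (t i) +
      (a F c - a F b) • t c • D K F (t c) + (a F d - a F b) • t d • D K F (t d)) := by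
  have := congrArg (D K F) (sum_sub_mul_sq h₁ h₂ h)
  have ha : ∀ n, D K F (a F n) = 0 := fun n => by
    rw [a]; exact Derivation.map_natCast _ _
  simp only [map_add, Derivation.leibniz, map_sub, ha, Derivation.leibniz_pow, map_zero,
    sub_self, smul_zero, add_zero] at this
  have hF : CharZero F := charZero_of_injective_algebraMap (algebraMap K F).injective
  have h2 : (2 : F) ≠ 0 := two_ne_zero
  rw [← sub_eq_zero]
  apply (smul_eq_zero_iff_right h2).mp
  rw [← this]
  module

omit [CharZero K] in
theorem algebraMap_a_sub {R : Type*} [CommRing R] [Algebra K R] (i j : Fin 5) :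
    algebraMap K R (a K i - a K j) = a R i - a R j := by
  rw [map_sub, map_a, map_a]

include h₁ h₂ hB in
/-- The residue form does not depend, up to a constant, on the choice of the three coordinates. -/
theorem exists_tripleProd_eq {i c d : Fin 5} (hic : i ≠ c) (hid : i ≠ d) (hcd : c ≠ d) :
    ∃ v : K, v ≠ 0 ∧ tripleProd B (fun n => t n ^ 2) (fun n => t n • D K F (t n)) i c d =
      algebraMap K F v •
        tripleProd B (fun n => t n ^ 2) (fun n => t n • D K F (t n)) 0 1 2 := by
  refine forall_distinct_triple (P := fun i c d => ∃ v : K, v ≠ 0 ∧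
    tripleProd B (fun n => t n ^ 2) (fun n => t n • D K F (t n)) i c d = algebraMap K F v •
      tripleProd B (fun n => t n ^ 2) (fun n => t n • D K F (t n)) 0 1 2)
    ⟨1, one_ne_zero, by simp⟩ ?_ ?_ ?_ hic hid hcd
  · rintro i c d ⟨v, hv, h⟩
    exact ⟨-v, neg_ne_zero.mpr hv, by rw [tripleProd_swap hB, h, map_neg, neg_smul]⟩
  · rintro i c d ⟨v, hv, h⟩
    exact ⟨-v, neg_ne_zero.mpr hv, by rw [tripleProd_swap' hB, h, map_neg, neg_smul]⟩
  · rintro i a₁ c d hai hic hid hac had hcd ⟨v, hv, h⟩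
    obtain ⟨b, hb⟩ : ∃ b, Distinct i a₁ b c d := by
      have : ∀ i a₁ : Fin 5, a₁ ≠ i → ∀ c, i ≠ c → a₁ ≠ c → ∀ d, i ≠ d → a₁ ≠ d → c ≠ d →
          ∃ b, Distinct i a₁ b c d := by decide
      exact this i a₁ hai c hic hac d hid had hcd
    obtain ⟨⟨-, hib, -, -⟩, ⟨hab, -, -⟩, -, -⟩ := hb.ne
    have hα : a K a₁ - a K b ≠ 0 := sub_ne_zero.mpr (a_ne hab)
    have hβ : a K i - a K b ≠ 0 := sub_ne_zero.mpr (a_ne hib)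
    have key := tripleProd_exchange hB (s := fun n => t n ^ 2) (w := fun n => t n • D K F (t n))
      (α := fun n => a F n - a F b) (i := i) (a := a₁) (c := c) (d := d)
      (by linear_combination sum_sub_mul_sq h₁ h₂ hb) (sum_sub_smul_D h₁ h₂ hb)
    rw [h] at key
    rw [← algebraMap_a_sub (K := K) (R := F), ← algebraMap_a_sub (K := K) (R := F)] at key
    refine ⟨-(a K i - a K b) * v / (a K a₁ - a K b), div_ne_zero (mul_ne_zero (neg_ne_zero.mpr hβ)
      hv) hα, ?_⟩
    have hα' : algebraMap K F (a K a₁ - a K b) ≠ 0 := (map_ne_zero _).mpr hα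
    rw [map_div₀, map_mul, map_neg, div_eq_inv_mul, mul_smul, mul_smul, ← key, inv_smul_smul₀ hα']

include h₁ h₂ ht hB in
/-- The form `d (t c / t i) ∧ d (t d / t i)` is the residue form divided by `t i`, up to a constant
and the factor `(t a₁ / t i) * (t b / t i)`. -/
theorem exists_apply_D_div {i a₁ b c d : Fin 5} (h : Distinct i a₁ b c d) :
    ∃ v : K, v ≠ 0 ∧ B (D K F (t c / t i)) (D K F (t d / t i)) =
      (algebraMap K F v * t a₁ * t b / t i ^ 3) • residueForm t B := by
  obtain ⟨⟨-, -, hic, hid⟩, -, -, hcd⟩ := h.ne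
  obtain ⟨v, hv, hE⟩ := exists_tripleProd_eq h₁ h₂ hB hic hid hcd
  refine ⟨v, hv, ?_⟩
  have hP : ∏ n, t n = t i * t a₁ * t b * t c * t d := prod_distinct h t
  have h3 : t i ^ 4 • t c • t d • B (D K F (t c / t i)) (D K F (t d / t i)) =
      tripleProd B (fun n => t n ^ 2) (fun n => t n • D K F (t n)) i c d := by
    rw [Derivation.leibniz_div, Derivation.leibniz_div]
    have hi := ht i
    have h1 := hB.self_eq_zero (D K F (t i))
    have h2 := hB.neg (D K F (t i)) (D K F (t c))
    simp only [tripleProd, map_smul, map_sub, LinearMap.smul_apply, LinearMap.sub_apply, h1, ← h2]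
    match_scalars <;> field_simp
  rw [hE] at h3
  have hi := ht i
  have ha := ht a₁
  have hb := ht b
  have hc := ht c
  have hd := ht d
  refine smul_right_injective _ (mul_ne_zero (pow_ne_zero 4 hi) (mul_ne_zero hc hd)) ?_
  simp only [mul_smul]
  rw [h3, residueForm, hP]
  match_scalars
  field_simp

end
end TwoQuadrics

/-! ### The module of regular forms at a point -/

namespace TwoQuadrics

open KaehlerDifferential

noncomputable section

section LocalGenerator

variable {K F : Type u} [Field K] [Field F] [CharZero K] [Algebra K F] {t : Fin 5 → F}
  (ht : ∀ n, t n ≠ 0) (h₁ : ∑ n, t n ^ 2 = 0) (h₂ : ∑ n, a F n * t n ^ 2 = 0)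
  {N : Type*} [AddCommGroup N] [Module F N] {B : Ω[F⁄K] →ₗ[F] Ω[F⁄K] →ₗ[F] N} (hB : B.IsAlt)
  {S : Subring F} (hK : ∀ x : K, algebraMap K F x ∈ S)

include h₁ h₂ hK in
/-- At a point where `t i`, `t a₁` and `t b` do not vanish, the differentials of the remaining two
coordinates generate the differentials of all functions. -/
theorem D_mem_span {i a₁ b c d : Fin 5} (h : Distinct i a₁ b c d) (hi : t i = 1)
    (hS : ∀ n, t n ∈ S) (ha : (t a₁)⁻¹ ∈ S) (hb : (t b)⁻¹ ∈ S) (ha0 : t a₁ ≠ 0) (hb0 : t b ≠ 0)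
    (hfrac : ∀ f ∈ S, ∃ p ∈ Algebra.adjoin K (Set.range t), ∃ q ∈ Algebra.adjoin K (Set.range t),
      q ≠ 0 ∧ q⁻¹ ∈ S ∧ f = p / q) {f : F} (hf : f ∈ S) :
    D K F f ∈ Submodule.span S {D K F (t c), D K F (t d)} := by
  set M := Submodule.span S {D K F (t c), D K F (t d)} with hM
  have hsmul : ∀ {s : F} {x : Ω[F⁄K]}, s ∈ S → x ∈ M → s • x ∈ M :=
    fun {s x} hs hx => M.smul_mem ⟨s, hs⟩ hx
  have hc : D K F (t c) ∈ M := Submodule.subset_span (Or.inl rfl)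
  have hd : D K F (t d) ∈ M := Submodule.subset_span (Or.inr rfl)
  have hrel : ∀ {a₁ b : Fin 5}, Distinct i a₁ b c d → (t a₁)⁻¹ ∈ S → t a₁ ≠ 0 →
      D K F (t a₁) ∈ M := by
    intro a₁ b h ha ha0
    have hab := h.ne.2.1.1
    have key := sum_sub_smul_D (K := K) h₁ h₂ h
    rw [hi, Derivation.map_one_eq_zero, smul_zero, smul_zero, zero_add] at key
    simp only [← algebraMap_a_sub (K := K) (R := F)] at key
    have hne : algebraMap K F (a K a₁ - a K b) ≠ 0 :=
      (map_ne_zero _).mpr (sub_ne_zero.mpr (a_ne hab))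
    have h3 : D K F (t a₁) = (t a₁)⁻¹ • algebraMap K F (a K a₁ - a K b)⁻¹ •
        algebraMap K F (a K a₁ - a K b) • t a₁ • D K F (t a₁) := by
      rw [map_inv₀, inv_smul_smul₀ hne, inv_smul_smul₀ ha0]
    rw [h3, key]
    exact hsmul ha (hsmul (hK _) (M.neg_mem (M.add_mem (hsmul (hK _) (hsmul (hS _) hc))
      (hsmul (hK _) (hsmul (hS _) hd)))))
  have hgen : ∀ n, D K F (t n) ∈ M := by
    intro n
    have hn : n = i ∨ n = a₁ ∨ n = b ∨ n = c ∨ n = d := by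
      have hu : n ∈ [i, a₁, b, c, d].toFinset := by
        rw [Finset.eq_univ_of_card [i, a₁, b, c, d].toFinset
          (by rw [List.toFinset_card_of_nodup h]; rfl)]
        exact Finset.mem_univ n
      simpa using hu
    rcases hn with rfl | rfl | rfl | rfl | rfl
    · rw [hi, Derivation.map_one_eq_zero]; exact M.zero_mem
    · exact hrel h ha ha0
    · refine hrel (b := a₁) ?_ hb hb0
      simp only [Distinct, List.nodup_cons, List.mem_cons, not_or, List.not_mem_nil] at h ⊢
      tauto
    · exact hc
    · exact hd
  have hadj : ∀ p ∈ Algebra.adjoin K (Set.range t), p ∈ S ∧ D K F p ∈ M := by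
    intro p hp
    induction hp using Algebra.adjoin_induction with
    | mem x hx =>
      obtain ⟨n, rfl⟩ := hx
      exact ⟨hS n, hgen n⟩
    | algebraMap r => exact ⟨hK r, by rw [Derivation.map_algebraMap]; exact M.zero_mem⟩
    | add x y _ _ hx hy => exact ⟨S.add_mem hx.1 hy.1, by
        rw [map_add]; exact M.add_mem hx.2 hy.2⟩
    | mul x y _ _ hx hy => exact ⟨S.mul_mem hx.1 hy.1, by
        rw [Derivation.leibniz]; exact M.add_mem (hsmul hx.1 hy.2) (hsmul hy.1 hx.2)⟩
  obtain ⟨p, hp, q, hq, hq0, hqS, rfl⟩ := hfrac f hf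
  rw [Derivation.leibniz_div]
  exact hsmul (S.pow_mem hqS 2) (M.sub_mem (hsmul (hadj q hq).1 (hadj p hp).2)
    (hsmul (hadj p hp).1 (hadj q hq).2))

include ht h₁ h₂ hB hK in
/-- The module of regular forms of the second degree at a point where `t i`, `t a₁` and `t b` do
not vanish. -/
theorem span_apply_D_eq {i a₁ b c d : Fin 5} (h : Distinct i a₁ b c d)
    (hS : ∀ n, t n / t i ∈ S) (ha : t i / t a₁ ∈ S) (hb : t i / t b ∈ S)
    (hfrac : ∀ f ∈ S, ∃ p ∈ Algebra.adjoin K (Set.range fun n => t n / t i),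
      ∃ q ∈ Algebra.adjoin K (Set.range fun n => t n / t i), q ≠ 0 ∧ q⁻¹ ∈ S ∧ f = p / q) :
    Submodule.span S {(t i)⁻¹ • residueForm t B} =
      Submodule.span S {η | ∃ f ∈ S, ∃ g ∈ S, η = B (D K F f) (D K F g)} := by
  obtain ⟨v, hv, hvE⟩ := exists_apply_D_div ht h₁ h₂ hB h
  have hv' : algebraMap K F v ≠ 0 := (map_ne_zero _).mpr hv
  have hi := ht i
  have ha0 := ht a₁
  have hb0 := ht b
  have e₁ : ∑ n, (t n / t i) ^ 2 = 0 := by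
    simp only [div_pow, ← Finset.sum_div, h₁, zero_div]
  have e₂ : ∑ n, a F n * (t n / t i) ^ 2 = 0 := by
    simp only [div_pow, ← mul_div_assoc, ← Finset.sum_div, h₂, zero_div]
  refine le_antisymm (Submodule.span_le.mpr ?_) (Submodule.span_le.mpr ?_)
  · rintro _ rfl
    have hu : (algebraMap K F v⁻¹ * (t i / t a₁) * (t i / t b)) ∈ S :=
      S.mul_mem (S.mul_mem (hK _) ha) hb
    have : (t i)⁻¹ • residueForm t B = (algebraMap K F v⁻¹ * (t i / t a₁) * (t i / t b)) •
        B (D K F (t c / t i)) (D K F (t d / t i)) := by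
      rw [hvE, smul_smul, map_inv₀]
      congr 1
      field_simp
    rw [this]
    exact Submodule.smul_mem _ (⟨_, hu⟩ : S)
      (Submodule.subset_span ⟨_, hS c, _, hS d, rfl⟩)
  · rintro _ ⟨f, hf, g, hg, rfl⟩
    have hD := fun f hf => D_mem_span (f := f) e₁ e₂ hK h (div_self hi) hS
      (by rwa [inv_div]) (by rwa [inv_div]) (div_ne_zero ha0 hi) (div_ne_zero hb0 hi) hfrac hf
    obtain ⟨⟨p, hp⟩, ⟨q, hq⟩, hf'⟩ := Submodule.mem_span_pair.mp (hD f hf)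
    obtain ⟨⟨p', hp'⟩, ⟨q', hq'⟩, hg'⟩ := Submodule.mem_span_pair.mp (hD g hg)
    replace hf' : p • D K F (t c / t i) + q • D K F (t d / t i) = D K F f := hf'
    replace hg' : p' • D K F (t c / t i) + q' • D K F (t d / t i) = D K F g := hg'
    have hu : (p * q' - q * p') * (algebraMap K F v * (t a₁ / t i) * (t b / t i)) ∈ S :=
      S.mul_mem (S.sub_mem (S.mul_mem hp hq') (S.mul_mem hq hp'))
        (S.mul_mem (S.mul_mem (hK _) (hS _)) (hS _))
    have : B (D K F f) (D K F g) =
        ((p * q' - q * p') * (algebraMap K F v * (t a₁ / t i) * (t b / t i))) •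
          (t i)⁻¹ • residueForm t B := by
      have h3 : B (D K F f) (D K F g) =
          (p * q' - q * p') • B (D K F (t c / t i)) (D K F (t d / t i)) := by
        rw [← hf', ← hg']
        simp only [map_add, map_smul, LinearMap.add_apply, LinearMap.smul_apply, hB.self_eq_zero,
          ← hB.neg (D K F (t c / t i)) (D K F (t d / t i))]
        module
      rw [h3, hvE, smul_smul, smul_smul]
      congr 1
      field_simp
    rw [this]
    exact Submodule.smul_mem _ (⟨_, hu⟩ : S) (Submodule.mem_span_singleton_self _)

end LocalGenerator

end
end TwoQuadrics

/-! ### A criterion for the nonvanishing of a form -/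

namespace TwoQuadrics

open KaehlerDifferential MvPolynomial

noncomputable section

section Nonzero

variable {F M E : Type*} [Field F] [AddCommGroup M] [Module F M] [CommRing E] [Algebra F E]

/-- The alternating form given by the determinant of two linear forms. -/
def detForm (l m : M →ₗ[F] E) : M [⋀^Fin 2]→ₗ[F] E where
  toFun v := l (v 0) * m (v 1) - l (v 1) * m (v 0)
  map_update_add' v i x y := by
    fin_cases i
    · simp; ring
    · simp; ring
  map_update_smul' v i c x := by
    fin_cases i
    · simp [smul_sub]
    · simp [smul_sub]
  map_eq_zero_of_eq' v i j h hij := by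
    have h01 : v 0 = v 1 := by
      fin_cases i <;> fin_cases j
      · exact absurd rfl hij
      · exact h
      · exact h.symm
      · exact absurd rfl hij
    rw [h01, sub_self]

theorem wedge_ne_zero (l m : M →ₗ[F] E) {x y : M} (h : l x * m y - l y * m x ≠ 0) :
    wedge (F := F) x y ≠ 0 := by
  intro h0
  have := exteriorPower.alternatingMapLinearEquiv_apply_ιMulti (detForm l m) ![x, y]
  rw [← wedge_apply, h0, map_zero] at this
  exact h this.symm

/-- The differentials of the coordinates form a basis of the differentials of a field of rational
functions. -/
def rationalBasis (K : Type u) [Field K] (σ : Type*) :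
    Module.Basis σ (FractionRing (MvPolynomial σ K))
      Ω[FractionRing (MvPolynomial σ K)⁄K] :=
  have : Algebra.FormallyEtale (MvPolynomial σ K) (FractionRing (MvPolynomial σ K)) :=
    Algebra.FormallyEtale.of_isLocalization (nonZeroDivisors _)
  ((mvPolynomialBasis K σ).baseChange _).map
    (tensorKaehlerEquivOfFormallyEtale K (MvPolynomial σ K) (FractionRing (MvPolynomial σ K)))

theorem rationalBasis_apply (K : Type u) [Field K] (σ : Type*) (n : σ) :
    rationalBasis K σ n = D K _ (algebraMap (MvPolynomial σ K) _ (X n)) := by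
  have : Algebra.FormallyEtale (MvPolynomial σ K) (FractionRing (MvPolynomial σ K)) :=
    Algebra.FormallyEtale.of_isLocalization (nonZeroDivisors _)
  rw [rationalBasis, Module.Basis.map_apply, Module.Basis.baseChange_apply, mvPolynomialBasis_apply,
    ← tensorKaehlerEquivOfFormallyEtale_symm_D_algebraMap, LinearEquiv.apply_symm_apply]

end Nonzero

/-- The quotients of two coordinates of the plane by the third have independent differentials in
every field they generate rationally. -/
theorem wedge_D_ne_zero {K F : Type u} [Field K] [Field F] [Algebra K F]
    (Θ : F →+* FractionRing (MvPolynomial (Fin 3) K))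
    (hΘ : ∀ x, Θ (algebraMap K F x) = algebraMap K (FractionRing (MvPolynomial (Fin 3) K)) x)
    {f g : F}
    (hf : Θ f = algebraMap (MvPolynomial (Fin 3) K) (FractionRing (MvPolynomial (Fin 3) K)) (X 1) /
      algebraMap (MvPolynomial (Fin 3) K) _ (X 0))
    (hg : Θ g = algebraMap (MvPolynomial (Fin 3) K) (FractionRing (MvPolynomial (Fin 3) K)) (X 2) /
      algebraMap (MvPolynomial (Fin 3) K) _ (X 0)) :
    wedge (F := F) (D K F f) (D K F g) ≠ 0 := by
  let E := FractionRing (MvPolynomial (Fin 3) K)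
  let _ : Algebra F E := Θ.toAlgebra
  have : IsScalarTower K F E := .of_algebraMap_eq fun x => (hΘ x).symm
  let b : Module.Basis (Fin 3) E Ω[E⁄K] := rationalBasis K (Fin 3)
  let x : Fin 3 → E := fun n => algebraMap (MvPolynomial (Fin 3) K) E (X n)
  have hb : ∀ n, D K E (x n) = b n := fun n => (rationalBasis_apply K (Fin 3) n).symm
  let l : Fin 3 → Ω[F⁄K] →ₗ[F] E := fun j =>
    ((b.coord j).restrictScalars F).comp (KaehlerDifferential.map K K F E)
  have hl : ∀ j h, l j (D K F h) = b.coord j (D K E (Θ h)) := fun j h =>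
    congrArg (b.coord j) (KaehlerDifferential.map_D K K F E h)
  have hx0 : x 0 ≠ 0 := fun h => X_ne_zero (R := K) (0 : Fin 3)
    ((map_eq_zero_iff _ (IsFractionRing.injective _ E)).mp h)
  have hD : ∀ n, D K E (x n / x 0) = (x 0)⁻¹ ^ 2 • (x 0 • b n - x n • b 0) := fun n => by
    rw [Derivation.leibniz_div, hb, hb]
  refine wedge_ne_zero (l 1) (l 2) ?_
  have h1 : D K E (Θ f) = (x 0)⁻¹ ^ 2 • (x 0 • b 1 - x 1 • b 0) := by rw [hf]; exact hD 1
  have h2 : D K E (Θ g) = (x 0)⁻¹ ^ 2 • (x 0 • b 2 - x 2 • b 0) := by rw [hg]; exact hD 2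
  simp only [hl, h1, h2, map_smul, map_sub, Module.Basis.coord_apply, Module.Basis.repr_self]
  simp [hx0]

end
end TwoQuadrics

/-! ### Affine coordinates of the surface -/

namespace TwoQuadrics

open MvPolynomial Scheme KaehlerDifferential

noncomputable section

variable {K : Type u} [Field K]

/-- At most two coordinates vanish at a point of the surface. -/
theorem exists_three_notMem [CharZero K] {I : Ideal (CoordRing K)} (hI : I.IsPrime)
    (h : ∃ n, T n ∉ I) :
    ∃ i a b c d, Distinct i a b c d ∧ T i ∉ I ∧ T a ∉ I ∧ T b ∉ I := by
  classical
  have key : ∀ {p q s l m : Fin 5}, Distinct p q s l m → T p ∈ I → T q ∈ I → T s ∈ I →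
      T l ∈ I := by
    intro p q s l m hd hp hq hs
    obtain ⟨-, -, -, hlm⟩ := hd.ne
    have h1 := sum_T_sq (K := K)
    have h2 := sum_a_mul_T_sq (K := K)
    rw [sum_distinct hd] at h1 h2
    have h3 : algebraMap K (CoordRing K) (a K l - a K m) * T l ^ 2 ∈ I := by
      have : algebraMap K (CoordRing K) (a K l - a K m) * T l ^ 2 =
          -((a _ p - a _ m) * T p * T p + (a _ q - a _ m) * T q * T q +
            (a _ s - a _ m) * T s * T s) := by
        rw [algebraMap_a_sub]
        linear_combination h2 - a _ m * h1
      rw [this]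
      exact I.neg_mem (I.add_mem (I.add_mem (I.mul_mem_left _ hp) (I.mul_mem_left _ hq))
        (I.mul_mem_left _ hs))
    refine hI.mem_of_pow_mem 2 ((hI.mem_or_mem h3).resolve_left fun h4 => hI.ne_top ?_)
    exact I.eq_top_of_isUnit_mem h4
      ((IsUnit.mk0 _ (sub_ne_zero.mpr (a_ne hlm))).map (algebraMap K (CoordRing K)))
  have hthree : ∀ i a : Fin 5, i ≠ a → ∀ b, i ≠ b → a ≠ b → ∃ c d, Distinct i a b c d := by
    decide
  obtain ⟨n, hn⟩ := h
  have hcard : 2 < (Finset.univ.filter fun n => (T n : CoordRing K) ∉ I).card := by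
    by_contra hc
    have h5 := Finset.card_filter_add_card_filter_not (s := Finset.univ)
      (fun n : Fin 5 => (T n : CoordRing K) ∈ I)
    rw [Finset.card_univ, Fintype.card_fin] at h5
    obtain ⟨p, hp, q, hq, s, hs, hpq, hps, hqs⟩ := Finset.two_lt_card.mp
      (show 2 < (Finset.univ.filter fun n => (T n : CoordRing K) ∈ I).card by omega)
    rw [Finset.mem_filter] at hp hq hs
    obtain ⟨l, m, hd⟩ := hthree p q hpq s hps hqs
    have hl := key hd hp.2 hq.2 hs.2
    have hm := key (l := m) (m := l) (by
      simp only [Distinct, List.nodup_cons, List.mem_cons, not_or, List.not_mem_nil] at hd ⊢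
      tauto) hp.2 hq.2 hs.2
    have hu : n ∈ [p, q, s, l, m].toFinset := by
      rw [Finset.eq_univ_of_card [p, q, s, l, m].toFinset
        (by rw [List.toFinset_card_of_nodup hd]; rfl)]
      exact Finset.mem_univ n
    simp only [List.mem_toFinset, List.mem_cons, List.not_mem_nil, or_false] at hu
    rcases hu with rfl | rfl | rfl | rfl | rfl
    exacts [hn hp.2, hn hq.2, hn hs.2, hn hl, hn hm]
  obtain ⟨i, hi, a, ha, b, hb, hia, hib, hab⟩ := Finset.two_lt_card.mp hcard
  rw [Finset.mem_filter] at hi ha hb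
  obtain ⟨c, d, hd⟩ := hthree i a hia b hib hab
  exact ⟨i, a, b, c, d, hd, hi.2, ha.2, hb.2⟩

variable [IsIntegral (surface K)]

variable (K) in
/-- The function field of the surface as an extension of the ground field. -/
abbrev functionFieldAlgebra : Algebra K (surface K).functionField :=
  (baseToFunctionField (structureMap K)).toAlgebra

attribute [local instance] functionFieldAlgebra

variable [IsDomain (CoordRing K)]

theorem toFrac_algebraMap (x : K) :
    Proj.toFrac (grading K) (algebraMap K (surface K).functionField x) =
      algebraMap (CoordRing K) _ (algebraMap K _ x) := by
  refine Eq.trans ?_ (Proj.toFrac_germ_toSpecZero (grading K) (algebraMap K (grading K 0) x)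
    trivial)
  refine congrArg (Proj.toFrac (grading K)) ?_
  change ((Scheme.ΓSpecIso (.of K)).inv ≫ (structureMap K).appTop ≫
    (surface K).presheaf.germ ⊤ (genericPoint (surface K)) trivial).hom x = _
  rw [structureMap, Scheme.Hom.comp_appTop, Category.assoc, ← Scheme.ΓSpecIso_inv_naturality_assoc]
  rfl

variable [CharZero K]

theorem exists_affine_coordinates (r : Roots K) : ∃ t : Fin 5 → (surface K).functionFieldˣ,
    ∀ n, Proj.toFrac (grading K) (t n) =
      algebraMap (CoordRing K) _ (T n) / algebraMap (CoordRing K) _ (T 0) := by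
  choose t ht using fun n => exists_unit_toFrac_eq r (T_mem n) (T_mem 0) (T_ne_zero r n)
    (T_ne_zero r 0)
  exact ⟨t, ht⟩

section Coordinates

variable (r : Roots K) {t : Fin 5 → (surface K).functionFieldˣ}
    (ht : ∀ n, Proj.toFrac (grading K) (t n) =
      algebraMap (CoordRing K) _ (T n) / algebraMap (CoordRing K) _ (T 0))

omit [CharZero K] [IsIntegral (surface K)] [IsDomain (CoordRing K)] in
theorem algebraMap_frac_ne_zero {x : CoordRing K} (hx : x ≠ 0) :
    algebraMap _ (FractionRing (CoordRing K)) x ≠ 0 :=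
  fun h0 => hx ((map_eq_zero_iff _ (IsFractionRing.injective _ _)).mp h0)

include r ht in
theorem toFrac_div (n i : Fin 5) : Proj.toFrac (grading K) (t n / t i) =
    algebraMap (CoordRing K) _ (T n) / algebraMap (CoordRing K) _ (T i) := by
  rw [map_div₀, ht, ht, div_div_div_cancel_right₀ (algebraMap_frac_ne_zero (T_ne_zero r 0))]

omit [CharZero K] in
include ht in
theorem sum_coordinates_sq : ∑ n, (t n : (surface K).functionField) ^ 2 = 0 := by
  apply Proj.toFrac_injective (grading K)
  simp only [map_sum, map_pow, ht, div_pow, ← Finset.sum_div, map_zero]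
  simp only [← map_pow, ← map_sum, sum_T_sq, map_zero, zero_div]

omit [CharZero K] in
include ht in
theorem sum_a_mul_coordinates_sq :
    ∑ n, a _ n * (t n : (surface K).functionField) ^ 2 = 0 := by
  apply Proj.toFrac_injective (grading K)
  simp only [map_sum, map_mul, map_a, map_pow, ht, div_pow, ← mul_div_assoc, ← Finset.sum_div,
    map_zero]
  rw [div_eq_zero_iff]
  left
  have := congrArg (algebraMap (CoordRing K) (FractionRing (CoordRing K))) (sum_a_mul_T_sq (K := K))
  simpa only [map_sum, map_mul, map_a, map_pow, map_zero] using this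

include r ht in
/-- Substitution of the affine coordinates `t m / t i` into a form `P` of degree `n` gives the
function `P / T i ^ n`. -/
theorem toFrac_aeval {i : Fin 5} {P : MvPolynomial (Fin 5) K} {n : ℕ} (hP : P.IsHomogeneous n) :
    Proj.toFrac (grading K)
      (aeval (fun m => (t m / t i : (surface K).functionField)) P) =
      algebraMap (CoordRing K) _ (Ideal.Quotient.mk _ P) /
        algebraMap (CoordRing K) _ (T i ^ n) := by
  have hi := algebraMap_frac_ne_zero (T_ne_zero r i)
  have := hP.map_eq_pow_mul
    ((algebraMap (CoordRing K) (FractionRing (CoordRing K))).comp (Ideal.Quotient.mk (ideal K)))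
    ((Proj.toFrac (grading K)).comp (aeval (R := K)
      (fun m => (t m / t i : (surface K).functionField))).toRingHom)
    (algebraMap (CoordRing K) _ (T i)) (fun c => ?_) fun m => ?_
  · rw [eq_div_iff (by rw [map_pow]; exact pow_ne_zero _ hi), map_pow, mul_comm]
    exact this.symm
  · refine Eq.trans (toFrac_algebraMap c).symm ?_
    exact congrArg (Proj.toFrac (grading K)) (aeval_C _ c).symm
  · change algebraMap (CoordRing K) _ (T m) = _ * Proj.toFrac (grading K) (aeval _ (X m))
    rw [aeval_X, toFrac_div r ht, mul_div_cancel₀ _ hi]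

include r ht in
theorem mem_localSubring_of_notMem {x : surface K} {i : Fin 5} (hi : T i ∉ x.asHomogeneousIdeal)
    (n : Fin 5) : (t n / t i : (surface K).functionField) ∈ (surface K).localSubring x :=
  (Proj.mem_localSubring_iff (grading K) x _).mpr
    ⟨1, T n, T_mem n, T i, T_mem i, hi, toFrac_div r ht n i⟩

omit [CharZero K] in
theorem algebraMap_mem_localSubring (x : surface K) (c : K) :
    algebraMap K (surface K).functionField c ∈ (surface K).localSubring x := by
  refine (Proj.mem_localSubring_iff (grading K) x _).mpr
    ⟨0, algebraMap K _ c, SetLike.algebraMap_mem_graded (grading K) c, 1,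
      SetLike.GradedOne.one_mem, fun h => ?_, ?_⟩
  · exact (Proj.isPrime_toIdeal (grading K) x).ne_top ((Ideal.eq_top_iff_one _).mpr h)
  · rw [toFrac_algebraMap, map_one, div_one]

include r ht in
/-- The functions regular at a point of an affine chart are quotients of polynomials in the
coordinates. -/
theorem exists_eq_div_of_mem_localSubring {x : surface K} {i : Fin 5}
    {f : (surface K).functionField}
    (hf : f ∈ (surface K).localSubring x) :
    ∃ p ∈ Algebra.adjoin K (Set.range fun n => (t n / t i : (surface K).functionField)),
      ∃ q ∈ Algebra.adjoin K (Set.range fun n => (t n / t i : (surface K).functionField)),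
        q ≠ 0 ∧ q⁻¹ ∈ (surface K).localSubring x ∧ f = p / q := by
  obtain ⟨n, _, ⟨P, hP, rfl⟩, _, ⟨Q, hQ, rfl⟩, hQx, hf⟩ :=
    (Proj.mem_localSubring_iff (grading K) x _).mp hf
  have hQx' : Ideal.Quotient.mk (ideal K) Q ∉ x.asHomogeneousIdeal := hQx
  have hQ0 : Ideal.Quotient.mk (ideal K) Q ≠ 0 := fun h => hQx' (h ▸ zero_mem _)
  have h1 := toFrac_aeval r ht (i := i) hP
  have h2 := toFrac_aeval r ht (i := i) hQ
  have hTi := algebraMap_frac_ne_zero (pow_ne_zero n (T_ne_zero r i))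
  have hQf := algebraMap_frac_ne_zero hQ0
  have hadj : ∀ P : MvPolynomial (Fin 5) K,
      aeval (fun m => (t m / t i : (surface K).functionField)) P ∈
        Algebra.adjoin K (Set.range fun n => (t n / t i : (surface K).functionField)) := by
    intro P
    rw [Algebra.adjoin_range_eq_range_aeval]
    exact ⟨P, rfl⟩
  refine ⟨_, hadj P, _, hadj Q, fun h0 => ?_, ?_, ?_⟩
  · rw [h0, map_zero] at h2
    exact div_ne_zero hQf hTi h2.symm
  · refine (Proj.mem_localSubring_iff (grading K) x _).mpr ⟨n, T i ^ n, ?_, _, ⟨Q, hQ, rfl⟩, hQx,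
        ?_⟩
    · simpa using SetLike.pow_mem_graded n (T_mem (K := K) i)
    · rw [map_inv₀, h2, inv_div]
      rfl
  · apply Proj.toFrac_injective (grading K)
    rw [map_div₀, h1, h2, div_div_div_cancel_right₀ hTi]
    exact hf

end Coordinates

end
end TwoQuadrics

/-! ### Existence and uniqueness of the canonical class -/

namespace TwoQuadrics

open MvPolynomial Scheme KaehlerDifferential

noncomputable section

variable {K : Type u} [Field K] [IsIntegral (surface K)] [IsDomain (CoordRing K)] [CharZero K]

attribute [local instance] functionFieldAlgebra

section Canonical

variable (r : Roots K) {t : Fin 5 → (surface K).functionFieldˣ}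
    (ht : ∀ n, Proj.toFrac (grading K) (t n) =
      algebraMap (CoordRing K) _ (T n) / algebraMap (CoordRing K) _ (T 0))

variable (t) in
/-- The residue form in the affine coordinates of the surface. -/
def canonicalForm : ⋀[(surface K).functionField]^2 Ω[(surface K).functionField⁄K] :=
  residueForm (K := K) (fun n => (t n : (surface K).functionField)) wedge

include r ht in
/-- At a point where three coordinates `T i`, `T a₁`, `T b` do not vanish, the module of regular
forms is generated by the canonical form divided by the coordinate `t i`. -/
theorem span_regularForms {x : surface K} {i a₁ b c d : Fin 5} (h : Distinct i a₁ b c d)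
    (hi : T i ∉ x.asHomogeneousIdeal) (ha : T a₁ ∉ x.asHomogeneousIdeal)
    (hb : T b ∉ x.asHomogeneousIdeal) :
    Submodule.span ((surface K).localSubring x) {((t i)⁻¹ : (surface K).functionFieldˣ) •
      canonicalForm t} =
        Submodule.span ((surface K).localSubring x)
          {η | ∃ f ∈ (surface K).localSubring x, ∃ g ∈ (surface K).localSubring x,
            η = wedge (F := (surface K).functionField) (D K (surface K).functionField f)
              (D K (surface K).functionField g)} := by
  have := span_apply_D_eq (K := K) (t := fun n => (t n : (surface K).functionField))
    (fun n => (t n).ne_zero) (sum_coordinates_sq ht) (sum_a_mul_coordinates_sq ht)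
    (isAlt_wedge (M := Ω[(surface K).functionField⁄K]))
    (algebraMap_mem_localSubring x) h
    (fun n => mem_localSubring_of_notMem r ht hi n) (mem_localSubring_of_notMem r ht ha i)
    (mem_localSubring_of_notMem r ht hb i)
    (fun f hf => exists_eq_div_of_mem_localSubring r ht hf)
  rw [← this, Units.smul_def, Units.val_inv_eq_inv_val]
  rfl

omit [IsDomain (CoordRing K)] [CharZero K] in
theorem regularForms_eq (x : surface K) :
    {η : ⋀[(surface K).functionField]^2 Ω[(surface K).functionField⁄K] |
      ∃ b : Fin 2 → (surface K).functionField, (∀ i, b i ∈ (surface K).localSubring x) ∧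
        η = exteriorPower.ιMulti (surface K).functionField 2
          (fun i => D K (surface K).functionField (b i))} =
    {η | ∃ f ∈ (surface K).localSubring x, ∃ g ∈ (surface K).localSubring x,
      η = wedge (F := (surface K).functionField) (D K (surface K).functionField f)
        (D K (surface K).functionField g)} := by
  have hw : ∀ b : Fin 2 → (surface K).functionField,
      (fun i => D K (surface K).functionField (b i)) =
        ![D K (surface K).functionField (b 0), D K (surface K).functionField (b 1)] := by
    intro b
    funext i
    fin_cases i <;> rfl
  ext η
  constructor
  · rintro ⟨b, hb, rfl⟩
    exact ⟨b 0, hb 0, b 1, hb 1, by rw [hw, wedge_apply]⟩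
  · rintro ⟨f, hf, g, hg, rfl⟩
    refine ⟨![f, g], fun i => ?_, ?_⟩
    · fin_cases i
      · exact hf
      · exact hg
    · rw [hw, wedge_apply]; rfl

/-- The embedding of the function field of the surface into the field of rational functions of the
plane given by the parametrization. -/
def toRational : (surface K).functionField →+* FractionRing (MvPolynomial (Fin 3) K) :=
  (IsFractionRing.map (j := (ψ r).toRingHom) (K := FractionRing (CoordRing K))
    (L := FractionRing (MvPolynomial (Fin 3) K)) ((injective_iff_map_eq_zero _).mpr fun x hx => by
      by_contra h0
      refine (chart r 1).ψ_ne_zero h0 ?_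
      rw [chart_ψ, signAct_one]
      exact hx)).comp (Proj.toFrac (grading K))

theorem toRational_of_toFrac {f : (surface K).functionField} {x y : CoordRing K}
    (h : Proj.toFrac (grading K) f = algebraMap _ _ x / algebraMap _ _ y) :
    toRational r f = algebraMap _ _ (ψ r x) / algebraMap _ _ (ψ r y) := by
  rw [toRational, RingHom.comp_apply, h, map_div₀]
  congr 1 <;> exact IsLocalization.map_eq _ _

theorem toRational_algebraMap (c : K) : toRational r (algebraMap K _ c) =
    algebraMap K (FractionRing (MvPolynomial (Fin 3) K)) c := by
  have := toRational_of_toFrac r (f := algebraMap K _ c) (x := algebraMap K _ c) (y := 1)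
    (by rw [toFrac_algebraMap, map_one, div_one])
  rw [this, map_one, map_one, div_one, AlgHom.commutes]
  exact (IsScalarTower.algebraMap_apply K _ _ c).symm

include r ht in
/-- Every wedge of two exact differentials is a multiple of the canonical form: this is the
statement on regular forms at the generic point. -/
theorem mem_span_canonicalForm (f g : (surface K).functionField) :
    ∃ h : (surface K).functionField, h • canonicalForm t =
      wedge (F := (surface K).functionField) (D K (surface K).functionField f)
        (D K (surface K).functionField g) := by
  have hη := Proj.genericPoint_asHomogeneousIdeal (grading K) (chart r 1).irrelevant_ne_bot
  have hT : ∀ n, T n ∉ (genericPoint (surface K)).asHomogeneousIdeal := fun n => by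
    rw [hη]; exact T_ne_zero r n
  have hmem : ∀ f, f ∈ (surface K).localSubring (genericPoint (surface K)) := fun f => by
    obtain ⟨n, a, ha, b, hb, hb0, h⟩ := Proj.exists_toFrac_eq (grading K) f
    exact (Proj.mem_localSubring_iff (grading K) _ _).mpr ⟨n, a, ha, b, hb, by rw [hη]; exact hb0,
      h⟩
  have h : Distinct 0 1 2 3 4 := by decide
  have hm := Submodule.subset_span (R := (surface K).localSubring (genericPoint (surface K)))
    (show wedge (F := (surface K).functionField) (D K (surface K).functionField f)
        (D K (surface K).functionField g) ∈ {η | ∃ f ∈ (surface K).localSubring _,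
          ∃ g ∈ (surface K).localSubring _,
            η = wedge (F := (surface K).functionField) (D K (surface K).functionField f)
              (D K (surface K).functionField g)} from ⟨f, hmem f, g, hmem g, rfl⟩)
  rw [← span_regularForms r ht h (hT 0) (hT 1) (hT 2)] at hm
  obtain ⟨s, hs⟩ := Submodule.mem_span_singleton.mp hm
  refine ⟨(s : (surface K).functionField) * ((t 0)⁻¹ : (surface K).functionFieldˣ), ?_⟩
  rw [mul_smul]
  exact hs

include r ht in
/-- The affine coordinates of the plane are functions on the surface whose differentials have a
nonzero wedge product, because the surface is birational to the plane. -/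
theorem canonicalForm_ne_zero : canonicalForm t ≠ 0 := by
  intro h0
  have hX : ∀ n : Fin 3, φ r (X n) ≠ 0 := fun n =>
    φ_ne_zero r (isHomogeneous_X _ n) (X_ne_zero n)
  have hm : ∀ n : Fin 3, φ r (X n) ∈ grading K 1 := fun n => φ_mem r (isHomogeneous_X _ n)
  obtain ⟨f, hf⟩ := exists_unit_toFrac_eq r (hm 1) (hm 0) (hX 1) (hX 0)
  obtain ⟨g, hg⟩ := exists_unit_toFrac_eq r (hm 2) (hm 0) (hX 2) (hX 0)
  have hδ : algebraMap _ (FractionRing (MvPolynomial (Fin 3) K)) (δ K) ≠ 0 := fun h =>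
    δ_prime.ne_zero ((map_eq_zero_iff _ (IsFractionRing.injective _ _)).mp h)
  have hψ : ∀ n : Fin 3, ψ r (φ r (X n)) = δ K * X n := fun n => by
    rw [φ_X, ψ_powerSum]
  have key : ∀ {n : Fin 3} {f : (surface K).functionField}, Proj.toFrac (grading K) f =
      algebraMap _ _ (φ r (X n)) / algebraMap _ _ (φ r (X 0)) → toRational r f =
        algebraMap (MvPolynomial (Fin 3) K) (FractionRing (MvPolynomial (Fin 3) K)) (X n) /
          algebraMap (MvPolynomial (Fin 3) K) _ (X 0) := by
    intro n f hf
    rw [toRational_of_toFrac r hf, hψ, hψ, map_mul, map_mul, mul_div_mul_left _ _ hδ]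
  obtain ⟨h, hh⟩ := mem_span_canonicalForm r ht (f : (surface K).functionField) g
  rw [h0, smul_zero] at hh
  exact wedge_D_ne_zero (toRational r) (toRational_algebraMap r) (key hf) (key hg) hh.symm

include r ht in
/-- The rational forms of degree two are one-dimensional over the function field. -/
theorem exists_smul_canonicalForm_eq
    (ω : ⋀[(surface K).functionField]^2 Ω[(surface K).functionField⁄K]) :
    ∃ h : (surface K).functionField, h • canonicalForm t = ω := by
  have hω : ω ∈ Submodule.span (surface K).functionField {canonicalForm t} := by
    have hspan := exteriorPower.ιMulti_span_of_span (surface K).functionField 2 _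
      (KaehlerDifferential.span_range_derivation K (surface K).functionField)
    refine (Submodule.span_le.mpr ?_ : Submodule.span _ _ ≤ _)
      (hspan ▸ Submodule.mem_top : ω ∈ Submodule.span (surface K).functionField _)
    rintro _ ⟨v, hv, rfl⟩
    obtain ⟨f, hf⟩ := hv ⟨0, rfl⟩
    obtain ⟨g, hg⟩ := hv ⟨1, rfl⟩
    obtain ⟨h, hh⟩ := mem_span_canonicalForm r ht f g
    refine Submodule.mem_span_singleton.mpr ⟨h, hh.trans ?_⟩
    rw [hf, hg, wedge_apply]
    congr 1
    funext i
    fin_cases i <;> rfl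
  exact Submodule.mem_span_singleton.mp hω

/-- At a point with `T i ≠ 0` the canonical form is `t i = T i / T 0` times a generator of the
module of regular forms: its divisor is minus that of the section `T 0`. -/
theorem isCanonicalDivisor_inv_hyperplane : IsCanonicalDivisor (structureMap K) 2
    (hyperplane r (T_mem 0) (T_ne_zero r 0))⁻¹ := by
  obtain ⟨t, ht⟩ := exists_affine_coordinates r
  refine ⟨canonicalForm t, canonicalForm_ne_zero r ht, fun x => ?_⟩
  obtain ⟨i, a₁, b, c, d, h, hi, ha, hb⟩ :=
    exists_three_notMem (Proj.isPrime_toIdeal (grading K) x) (exists_T_notMem x)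
  refine ⟨t i, ?_, ?_⟩
  · have hf : Proj.toFrac (grading K) ((t i)⁻¹ : (surface K).functionFieldˣ) =
        algebraMap (CoordRing K) _ (T 0) / algebraMap (CoordRing K) _ (T i) := by
      rw [Units.val_inv_eq_inv_val, map_inv₀, ht, inv_div]
    have h1 : ((hyperplane r (T_mem 0) (T_ne_zero r 0))⁻¹).1 x =
      ((hyperplane r (T_mem 0) (T_ne_zero r 0)).1 x)⁻¹ := rfl
    rw [h1, hyperplane_apply r (T_mem 0) (T_ne_zero r 0) (T_mem i) hi hf, map_inv, inv_inv]
  · exact (span_regularForms r ht h hi ha hb).trans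
      (congrArg (Submodule.span _) (regularForms_eq x).symm)

end Canonical

/-- An element of the function field is a unit at `x` if it and its inverse are regular at `x`. -/
theorem mem_localUnits_of_mem {X : Scheme.{u}} [IsIntegral X] {x : X} {f : X.functionFieldˣ}
    (hf : (f : X.functionField) ∈ X.localSubring x)
    (hf' : ((f⁻¹ : X.functionFieldˣ) : X.functionField) ∈ X.localSubring x) :
    f ∈ X.localUnits x := by
  obtain ⟨s, hs⟩ := hf
  obtain ⟨s', hs'⟩ := hf'
  have h1 : s * s' = 1 := by
    apply IsFractionRing.injective (X.presheaf.stalk x) X.functionField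
    rw [map_mul, hs, hs', map_one, Units.mul_inv]
  exact ⟨⟨s, s', h1, (mul_comm _ _).trans h1⟩, Units.ext hs⟩

/-- Two nonzero rational forms differ by a rational function, so that their divisors differ by a
principal divisor. -/
theorem isCanonicalClass_unique (r : Roots K) {κ κ' : (surface K).PicardGroup}
    (h : IsCanonicalClass (structureMap K) 2 κ) (h' : IsCanonicalClass (structureMap K) 2 κ') :
    κ = κ' := by
  obtain ⟨t, ht⟩ := exists_affine_coordinates r
  obtain ⟨E, ⟨ω, hω, hE⟩, rfl⟩ := h
  obtain ⟨E', ⟨ω', hω', hE'⟩, rfl⟩ := h'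
  obtain ⟨g, rfl⟩ := exists_smul_canonicalForm_eq r ht ω
  obtain ⟨g', rfl⟩ := exists_smul_canonicalForm_eq r ht ω'
  have hc := canonicalForm_ne_zero r ht
  have hg : g ≠ 0 := by rintro rfl; exact hω (zero_smul _ _)
  have hg' : g' ≠ 0 := by rintro rfl; exact hω' (zero_smul _ _)
  lift g to (surface K).functionFieldˣ using hg.isUnit
  lift g' to (surface K).functionFieldˣ using hg'.isUnit
  refine divisorClass_eq_iff.mpr ⟨g / g', cartierDivisors_ext fun x => ?_⟩
  obtain ⟨f, hf, hfs⟩ := hE x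
  obtain ⟨f', hf', hfs'⟩ := hE' x
  rw [principalDivisor_apply, coe_div_apply, hf, hf', ← map_div, ← div_eq_one, ← map_div,
    germDiv_eq_one_iff]
  -- the quotient of the generators of the two presentations of the module of regular forms
  have key : ∀ {f f' g g' : (surface K).functionFieldˣ},
      Submodule.span ((surface K).localSubring x) {f⁻¹ • (g : (surface K).functionField) •
        canonicalForm t} = Submodule.span ((surface K).localSubring x)
          {f'⁻¹ • (g' : (surface K).functionField) • canonicalForm t} →
      ((g / g' / (f / f') : (surface K).functionFieldˣ) : (surface K).functionField) ∈
        (surface K).localSubring x := by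
    intro f f' g g' h
    have hm : f⁻¹ • (g : (surface K).functionField) • canonicalForm t ∈
        Submodule.span ((surface K).localSubring x)
          {f'⁻¹ • (g' : (surface K).functionField) • canonicalForm t} :=
      h ▸ Submodule.mem_span_singleton_self _
    obtain ⟨s, hs⟩ := Submodule.mem_span_singleton.mp hm
    have h2 : ((s : (surface K).functionField) * ((f'⁻¹ * g' : (surface K).functionFieldˣ))) •
        canonicalForm t = ((f⁻¹ * g : (surface K).functionFieldˣ) : (surface K).functionField) •
          canonicalForm t := by
      rw [Units.val_mul, Units.val_mul, mul_smul, mul_smul, mul_smul]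
      exact hs
    have h3 := smul_left_injective _ hc h2
    have h4 : ((g / g' / (f / f') : (surface K).functionFieldˣ) : (surface K).functionField) =
      s := by
      have e : g / g' / (f / f') = f⁻¹ * g * (f'⁻¹ * g')⁻¹ := by
        rw [div_div_div_eq, div_eq_mul_inv, mul_inv, mul_inv, inv_inv]
        simp only [mul_comm, mul_left_comm, mul_assoc]
      rw [e, Units.val_mul, ← h3, mul_assoc, ← Units.val_mul, mul_inv_cancel, Units.val_one,
        mul_one]
    rw [h4]
    exact s.2
  refine mem_localUnits_of_mem (key (hfs.trans hfs'.symm)) ?_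
  have e : (g / g' / (f / f'))⁻¹ = g' / g / (f' / f) := by
    rw [inv_div, div_div_div_eq, div_div_div_eq, mul_comm f, mul_comm f']
  rw [e]
  exact key (hfs'.trans hfs.symm)

theorem isCanonicalClass_inv_quadrilateral (r : Roots K) : IsCanonicalClass (structureMap K) 2
    ((surface K).divisorClass (quadrilateral r))⁻¹ := by
  refine ⟨_, isCanonicalDivisor_inv_hyperplane r, ?_⟩
  rw [map_inv, quadrilateral, divisorClass_hyperplane]

theorem existsUnique_isCanonicalClass (r : Roots K) :
    ∃! κ, IsCanonicalClass (structureMap K) 2 κ :=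
  ⟨_, isCanonicalClass_inv_quadrilateral r, fun _ h =>
    isCanonicalClass_unique r h (isCanonicalClass_inv_quadrilateral r)⟩

/-- The invariant classes are the multiples of the canonical class. -/
theorem invariant_iff_mem_zpowers (r : Roots K) {S : Set (K ≃+* K)}
    (hS : ∀ s : Fin 5 → ℤˣ, ∏ n, s n = 1 → ∃ σ ∈ S, ∀ n, σ (r.c n) = (s n : ℤ) * r.c n)
    {κ : (surface K).PicardGroup} (hκ : IsCanonicalClass (structureMap K) 2 κ)
    (p : (surface K).PicardGroup) :
    (∀ σ ∈ S, picardPullback (fieldAut σ) p = p) ↔ p ∈ Subgroup.zpowers κ := by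
  rw [isCanonicalClass_unique r hκ (isCanonicalClass_inv_quadrilateral r), Subgroup.zpowers_inv]
  refine ⟨mem_zpowers_of_invariant r hS, ?_⟩
  rintro ⟨n, rfl⟩ σ -
  exact (map_zpow _ _ n).trans (congrArg (· ^ n) (picardPullback_hyperplane r σ))

end
end TwoQuadrics

/-! ### Smoothness -/

namespace TwoQuadrics

open MvPolynomial HomogeneousLocalization

noncomputable section

variable {K : Type u} [Field K]

/-- Equations expressing the squares of two invertible variables `X 2` and `X 3` by the squares of
two free variables `X 0` and `X 1`; the variable `X 4` is the inverse of `X 2 * X 3`. -/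
def chartRelation (p q : Fin 4 → K) : Fin 3 → MvPolynomial (Fin 5) K :=
  ![C (p 0) * X 2 ^ 2 + (C (p 1) * X 0 ^ 2 + C (p 2) * X 1 ^ 2 + C (p 3)),
    C (q 0) * X 3 ^ 2 + (C (q 1) * X 0 ^ 2 + C (q 2) * X 1 ^ 2 + C (q 3)),
    X 2 * X 3 * X 4 - 1]

/-- The algebra defined by `chartRelation`. -/
abbrev ChartRing (p q : Fin 4 → K) : Type u :=
  MvPolynomial (Fin 5) K ⧸ Ideal.span (Set.range (chartRelation p q))

theorem mk_chartRelation (p q : Fin 4 → K) (m : Fin 3) :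
    (Ideal.Quotient.mk _ (chartRelation p q m) : ChartRing p q) = 0 :=
  Ideal.Quotient.eq_zero_iff_mem.mpr (Ideal.subset_span ⟨m, rfl⟩)

theorem isUnit_mk_X (p q : Fin 4 → K) : IsUnit (Ideal.Quotient.mk _ (X 2 * X 3) : ChartRing p q) :=
  IsUnit.of_mul_eq_one (Ideal.Quotient.mk _ (X 4)) (by
    rw [← map_mul]
    have := mk_chartRelation p q 2
    rwa [show chartRelation p q 2 = X 2 * X 3 * X 4 - 1 from rfl, map_sub, map_one,
      sub_eq_zero] at this)

/-- The Jacobian matrix with respect to `X 2`, `X 3`, `X 4` is triangular, with unit diagonal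
entries. -/
theorem isStandardSmooth_chartRing [CharZero K] {p q : Fin 4 → K} (hp : p 0 ≠ 0) (hq : q 0 ≠ 0) :
    Algebra.IsStandardSmoothOfRelativeDimension 2 K (ChartRing p q) := by
  have hinj : Function.Injective (![2, 3, 4] : Fin 3 → Fin 5) := by decide
  let P : Algebra.PreSubmersivePresentation K (ChartRing p q) (Fin 5) (Fin 3) :=
    Algebra.PreSubmersivePresentation.naive (v := chartRelation p q) ![2, 3, 4] hinj
  have hj : P.jacobiMatrix.det = C (4 * p 0 * q 0) * (X 2 * X 3) ^ 2 := by
    have h (m l) : P.jacobiMatrix m l = pderiv ((![2, 3, 4] : Fin 3 → Fin 5) m)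
        (chartRelation p q l) := Algebra.PreSubmersivePresentation.jacobiMatrix_naive _ _ _ _ _ _
    rw [Matrix.det_fin_three]
    simp only [h]
    simp [chartRelation, pderiv_X, Derivation.leibniz,
      Derivation.leibniz_pow]
    rw [map_ofNat]
    ring
  let Q : Algebra.SubmersivePresentation K (ChartRing p q) (Fin 5) (Fin 3) :=
    { P with
      jacobian_isUnit := by
        change IsUnit P.jacobian
        rw [P.jacobian_eq_jacobiMatrix_det, hj]
        change IsUnit (Ideal.Quotient.mk _ (C (4 * p 0 * q 0) * (X 2 * X 3) ^ 2) : ChartRing p q)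
        rw [map_mul, map_pow]
        refine IsUnit.mul ?_ ((isUnit_mk_X p q).pow 2)
        have h0 : 4 * p 0 * q 0 ≠ 0 := mul_ne_zero (mul_ne_zero (by norm_num) hp) hq
        exact ((isUnit_iff_ne_zero.mpr h0).map C).map (Ideal.Quotient.mk _) }
  exact Q.isStandardSmoothOfRelativeDimension (by
    rw [Algebra.Presentation.dimension]
    simp)

section Away

variable {i j l m n : Fin 5}

theorem T_mul_mem (i j l : Fin 5) : (T i * T j * T l : CoordRing K) ∈ grading K 3 :=
  SetLike.mul_mem_graded (SetLike.mul_mem_graded (T_mem i) (T_mem j)) (T_mem l)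

variable (K) in
/-- The function `T n / T i` on the open set `T i * T j * T l ≠ 0`. -/
def awayCoord (i j l n : Fin 5) : Away (grading K) (T i * T j * T l : CoordRing K) :=
  Away.mk _ (T_mul_mem i j l) 1 (T n * T j * T l) (by simpa using T_mul_mem (K := K) n j l)

variable (K) in
/-- The function `T i ^ 2 / (T j * T l)` on the open set `T i * T j * T l ≠ 0`. -/
def awayInv (i j l : Fin 5) : Away (grading K) (T i * T j * T l : CoordRing K) :=
  Away.mk _ (T_mul_mem i j l) 1 (T i * T i * T i) (by simpa using T_mul_mem (K := K) i i i)

theorem isUnit_algebraMap_T (i j l : Fin 5) :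
    IsUnit (algebraMap (CoordRing K) (Localization.Away (T i * T j * T l : CoordRing K)) (T i)) ∧
    IsUnit (algebraMap (CoordRing K) (Localization.Away (T i * T j * T l : CoordRing K)) (T j)) ∧
    IsUnit (algebraMap (CoordRing K) (Localization.Away (T i * T j * T l : CoordRing K))
      (T l)) := by
  have h := IsLocalization.Away.algebraMap_isUnit
    (S := Localization.Away (T i * T j * T l : CoordRing K))
    (T i * T j * T l : CoordRing K)
  rw [map_mul, map_mul, IsUnit.mul_iff, IsUnit.mul_iff] at h
  exact ⟨h.1.1, h.1.2, h.2⟩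

theorem val_away_mul (i j l : Fin 5) (e : ℕ) (x : CoordRing K) (hx) :
    (Away.mk _ (T_mul_mem i j l) e x hx).val *
      algebraMap (CoordRing K) (Localization.Away (T i * T j * T l : CoordRing K)) (T i * T j * T l)
        ^ e =
      algebraMap _ _ x := by
  rw [Away.val_mk, ← map_pow, Localization.mk_eq_mk']
  exact IsLocalization.mk'_spec _ _ _

theorem val_awayCoord_mul (i j l n : Fin 5) :
    (awayCoord K i j l n).val * algebraMap (CoordRing K) _ (T i) =
      algebraMap (CoordRing K) (Localization.Away (T i * T j * T l : CoordRing K)) (T n) := by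
  obtain ⟨-, hj, hl⟩ := isUnit_algebraMap_T (K := K) i j l
  have := val_away_mul (K := K) i j l 1 (T n * T j * T l) (by simpa using T_mul_mem (K := K) n j l)
  refine (hj.mul hl).mul_right_cancel ?_
  rw [pow_one, map_mul, map_mul, map_mul, map_mul] at this
  change (awayCoord K i j l n).val * _ = _ at this
  linear_combination this

theorem val_awayInv_mul (i j l : Fin 5) :
    (awayInv K i j l).val *
        algebraMap (CoordRing K) (Localization.Away (T i * T j * T l : CoordRing K))
          (T i * T j * T l) =
      algebraMap (CoordRing K) (Localization.Away (T i * T j * T l : CoordRing K)) (T i) ^ 3 := by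
  have := val_away_mul (K := K) i j l 1 (T i * T i * T i) (by simpa using T_mul_mem (K := K) i i i)
  rw [pow_one] at this
  refine this.trans ?_
  rw [map_mul, map_mul]
  ring

section Equations

variable (i j l : Fin 5)

theorem sum_awayCoord_sq : ∑ n, awayCoord K i j l n ^ 2 = 0 := by
  apply val_injective
  rw [← HomogeneousLocalization.algebraMap_apply, ← HomogeneousLocalization.algebraMap_apply]
  refine ((isUnit_algebraMap_T (K := K) i j l).1.pow 2).mul_right_cancel ?_
  simp only [map_sum, map_pow, map_zero, zero_mul, Finset.sum_mul, ← mul_pow]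
  simp only [HomogeneousLocalization.algebraMap_apply, val_awayCoord_mul]
  have := congrArg (algebraMap (CoordRing K) (Localization.Away (T i * T j * T l : CoordRing K)))
    (sum_T_sq (K := K))
  simpa only [map_sum, map_pow, map_zero] using this

theorem sum_a_mul_awayCoord_sq : ∑ n, a _ n * awayCoord K i j l n ^ 2 = 0 := by
  apply val_injective
  rw [← HomogeneousLocalization.algebraMap_apply, ← HomogeneousLocalization.algebraMap_apply]
  refine ((isUnit_algebraMap_T (K := K) i j l).1.pow 2).mul_right_cancel ?_
  simp only [map_sum, map_mul, map_a, map_pow, map_zero, zero_mul, Finset.sum_mul, mul_assoc,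
    ← mul_pow]
  simp only [HomogeneousLocalization.algebraMap_apply, val_awayCoord_mul]
  have := congrArg (algebraMap (CoordRing K) (Localization.Away (T i * T j * T l : CoordRing K)))
    (sum_a_mul_T_sq (K := K))
  simpa only [map_sum, map_mul, map_a, map_pow, map_zero] using this

theorem awayCoord_self : awayCoord K i j l i = 1 := by
  apply val_injective
  refine (isUnit_algebraMap_T (K := K) i j l).1.mul_right_cancel ?_
  rw [val_awayCoord_mul, val_one, one_mul]

theorem awayCoord_mul_awayInv :
    awayCoord K i j l j * awayCoord K i j l l * awayInv K i j l = 1 := by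
  apply val_injective
  obtain ⟨hi, -, -⟩ := isUnit_algebraMap_T (K := K) i j l
  refine ((hi.pow 3).mul (IsLocalization.Away.algebraMap_isUnit
    (S := Localization.Away (T i * T j * T l : CoordRing K))
      (T i * T j * T l : CoordRing K))).mul_right_cancel ?_
  have hj := val_awayCoord_mul (K := K) i j l j
  have hl := val_awayCoord_mul (K := K) i j l l
  have h := val_awayInv_mul (K := K) i j l
  rw [val_one, one_mul, val_mul, val_mul]
  calc _ = ((awayCoord K i j l j).val * algebraMap (CoordRing K) _ (T i)) *
        ((awayCoord K i j l l).val * algebraMap (CoordRing K) _ (T i)) *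
        algebraMap (CoordRing K) _ (T i) *
        ((awayInv K i j l).val * algebraMap (CoordRing K) _ (T i * T j * T l)) := by ring
    _ = _ := by
      rw [hj, hl, h, map_mul, map_mul]
      ring

end Equations

/-- The coordinate ring of the open set `T i * T j * T l ≠ 0` as an algebra over `K`. -/
abbrev awayAlgebra (i j l : Fin 5) : Algebra K (Away (grading K) (T i * T j * T l : CoordRing K)) :=
  ((fromZeroRingHom (grading K) _).comp (algebraMap K (grading K 0))).toAlgebra

attribute [local instance] awayAlgebra

theorem val_algebraMap (i j l : Fin 5) (c : K) :
    (algebraMap K (Away (grading K) (T i * T j * T l : CoordRing K)) c).val =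
      algebraMap (CoordRing K) _ (algebraMap K _ c) := by
  change (HomogeneousLocalization.mk _).val = _
  rw [val_mk]
  exact Localization.mk_one_eq_algebraMap _

/-- For distinct indices the open set `T i * T j * T l ≠ 0` is given by the equations expressing the
squares of `T j / T i` and `T l / T i` by the squares of `T m / T i` and `T n / T i`. -/
def awayRelation (j l m n i : Fin 5) : Fin 4 → K :=
  ![a K j - a K l, a K m - a K l, a K n - a K l, a K i - a K l]

theorem awayRelation_eq {S : Type*} [CommRing S] [Algebra K S] {i j l m n : Fin 5}
    (h : Distinct i j l m n) {t : Fin 5 → S} (hi : t i = 1) (x : Fin 5 → S)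
    (hj : x 2 = t j) (hl : x 3 = t l) (hm : x 0 = t m) (hn : x 1 = t n) (e : Fin 2) :
    aeval x (chartRelation (awayRelation (K := K) j l m n i) (awayRelation l j m n i)
      (![0, 1] e)) = ∑ m, a S m * t m ^ 2 - a S (![l, j] e) * ∑ m, t m ^ 2 := by
  rw [sum_distinct h, sum_distinct h]
  fin_cases e <;>
  · simp [chartRelation, hi, hj, hl, hm, hn]
    simp only [awayRelation, Matrix.cons_val, map_sub, map_a]
    ring

section Equiv

variable (h : Distinct i j l m n)

/-- The images in the coordinate ring of the open set of the variables of `ChartRing`. -/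
def awayVar (K : Type u) [Field K] (i j l m n : Fin 5) :
    Fin 5 → Away (grading K) (T i * T j * T l : CoordRing K) :=
  ![awayCoord K i j l m, awayCoord K i j l n, awayCoord K i j l j, awayCoord K i j l l,
    awayInv K i j l]

include h in
theorem aeval_awayVar (e : Fin 3) :
    aeval (awayVar K i j l m n) (chartRelation (awayRelation (K := K) j l m n i)
      (awayRelation l j m n i) e) = 0 := by
  have h1 := awayRelation_eq (K := K) h (awayCoord_self i j l) (awayVar K i j l m n) rfl rfl rfl rfl
  simp only [sum_awayCoord_sq, sum_a_mul_awayCoord_sq, mul_zero, sub_zero] at h1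
  fin_cases e
  · exact h1 0
  · exact h1 1
  · simp only [chartRelation, awayVar]
    simpa [sub_eq_zero] using awayCoord_mul_awayInv (K := K) i j l

/-- The homomorphism from `ChartRing` to the coordinate ring of the open set. -/
def toAway : ChartRing (awayRelation (K := K) j l m n i) (awayRelation l j m n i) →ₐ[K]
    Away (grading K) (T i * T j * T l : CoordRing K) :=
  Ideal.Quotient.liftₐ _ (aeval (awayVar K i j l m n)) (fun p hp => by
    have : Ideal.span (Set.range (chartRelation (awayRelation (K := K) j l m n i)
        (awayRelation l j m n i))) ≤ RingHom.ker (aeval (awayVar K i j l m n) :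
        MvPolynomial (Fin 5) K →ₐ[K] Away (grading K) (T i * T j * T l : CoordRing K)) := by
      rw [Ideal.span_le]
      rintro _ ⟨e, rfl⟩
      exact aeval_awayVar h e
    exact this hp)

theorem toAway_mk (p : MvPolynomial (Fin 5) K) :
    toAway (K := K) h (Ideal.Quotient.mk _ p) = aeval (awayVar K i j l m n) p := rfl

/-- The variables of `ChartRing` corresponding to the coordinates `T e / T i`. -/
def chartVar (i j l m : Fin 5) {S : Type*} [CommRing S] (x : Fin 5 → S) (e : Fin 5) : S :=
  if e = i then 1 else if e = j then x 2 else if e = l then x 3 else if e = m then x 0 else x 1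

include h in
theorem chartVar_eq {S : Type*} [CommRing S] (x : Fin 5 → S) :
    chartVar i j l m x i = 1 ∧ x 2 = chartVar i j l m x j ∧ x 3 = chartVar i j l m x l ∧
      x 0 = chartVar i j l m x m ∧ x 1 = chartVar i j l m x n := by
  obtain ⟨⟨h1, h2, h3, h4⟩, ⟨h5, h6, h7⟩, ⟨h8, h9⟩, h10⟩ := h.ne
  simp [chartVar, h1.symm, h2.symm, h3.symm, h4.symm, h5.symm, h6.symm, h7.symm, h8.symm,
    h9.symm, h10.symm]

/-- The classes of the variables. -/
def chartClass (p q : Fin 4 → K) (e : Fin 5) : ChartRing p q := Ideal.Quotient.mk _ (X e)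

theorem aeval_chartClass (p q : Fin 4 → K) (P : MvPolynomial (Fin 5) K) :
    aeval (chartClass p q) P = Ideal.Quotient.mk _ P := by
  have : (aeval (chartClass p q) : _ →ₐ[K] ChartRing p q) = Ideal.Quotient.mkₐ K _ :=
    MvPolynomial.algHom_ext fun e => aeval_X _ _
  exact DFunLike.congr_fun this P

variable [CharZero K]

include h in
theorem sum_chartVar_sq :
    ∑ e, chartVar i j l m (chartClass (awayRelation (K := K) j l m n i)
      (awayRelation l j m n i)) e ^ 2 = 0 ∧
    ∑ e, a (ChartRing (awayRelation (K := K) j l m n i) (awayRelation l j m n i)) e *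
      chartVar i j l m (chartClass (awayRelation (K := K) j l m n i)
      (awayRelation l j m n i)) e ^ 2 = 0 := by
  obtain ⟨hi, hj, hl, hm, hn⟩ := chartVar_eq h
    (chartClass (awayRelation (K := K) j l m n i) (awayRelation l j m n i))
  have h1 := awayRelation_eq (K := K) h hi _ hj hl hm hn
  have h2 := h1 0
  have h3 := h1 1
  rw [aeval_chartClass] at h2 h3
  have h4 := (mk_chartRelation _ _ _).symm.trans h2
  have h5 := (mk_chartRelation _ _ _).symm.trans h3
  have hne : IsUnit (algebraMap K (ChartRing (awayRelation (K := K) j l m n i)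
      (awayRelation l j m n i)) (a K j - a K l)) :=
    (isUnit_iff_ne_zero.mpr (sub_ne_zero.mpr (a_ne h.ne.2.1.1))).map _
  have h6 : ∑ e, chartVar i j l m (chartClass (awayRelation (K := K) j l m n i)
      (awayRelation l j m n i)) e ^ 2 = 0 := by
    refine hne.mul_left_cancel ?_
    rw [mul_zero, algebraMap_a_sub]
    simp only [Matrix.cons_val] at h4 h5
    linear_combination h5 - h4
  refine ⟨h6, ?_⟩
  rw [h6, mul_zero, sub_zero] at h4
  exact h4.symm

/-- The homomorphism from the homogeneous coordinate ring setting `T i = 1`. -/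
def dehomogenize : CoordRing K →ₐ[K]
    ChartRing (awayRelation (K := K) j l m n i) (awayRelation l j m n i) :=
  lift (chartVar i j l m (chartClass _ _)) (sum_chartVar_sq h).1 (sum_chartVar_sq h).2

theorem isUnit_dehomogenize : IsUnit
    ((dehomogenize h).toRingHom (T i * T j * T l : CoordRing K)) := by
  change IsUnit (dehomogenize h (T i * T j * T l : CoordRing K))
  rw [map_mul, map_mul]
  simp only [dehomogenize, lift_T]
  obtain ⟨hi, hj, hl, -, -⟩ := chartVar_eq h
    (chartClass (awayRelation (K := K) j l m n i) (awayRelation l j m n i))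
  rw [hi, ← hj, ← hl, one_mul]
  exact isUnit_mk_X _ _

/-- The homomorphism inverse to `toAway`. -/
def ofAway : Away (grading K) (T i * T j * T l : CoordRing K) →+*
    ChartRing (awayRelation (K := K) j l m n i) (awayRelation l j m n i) :=
  (Localization.awayLift (dehomogenize h).toRingHom _ (isUnit_dehomogenize h)).comp
    (algebraMap _ (Localization.Away (T i * T j * T l : CoordRing K)))

theorem ofAway_eq {z : Away (grading K) (T i * T j * T l : CoordRing K)} {x y : CoordRing K}
    (hz : z.val * algebraMap _ _ x = algebraMap _ _ y) :
    ofAway h z * dehomogenize h x = dehomogenize h y := by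
  have := congrArg (Localization.awayLift (dehomogenize h).toRingHom _ (isUnit_dehomogenize h)) hz
  rw [map_mul] at this
  have hL (w : CoordRing K) : Localization.awayLift (dehomogenize h).toRingHom _
      (isUnit_dehomogenize h) (algebraMap _ _ w) = dehomogenize h w :=
    IsLocalization.Away.lift_eq _ (isUnit_dehomogenize h) w
  rwa [hL, hL] at this

theorem ofAway_algebraMap (c : K) : ofAway (K := K) h (algebraMap K _ c) = algebraMap K _ c := by
  have := ofAway_eq h (z := algebraMap K _ c) (x := 1) (y := algebraMap K _ c)
    (by rw [map_one, mul_one, val_algebraMap])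
  rw [map_one, mul_one] at this
  exact this.trans ((dehomogenize h).commutes c)

theorem ofAway_toAway (x : ChartRing (awayRelation (K := K) j l m n i) (awayRelation l j m n i)) :
    ofAway h (toAway h x) = x := by
  obtain ⟨hi, hj, hl, hm, hn⟩ := chartVar_eq h
    (chartClass (awayRelation (K := K) j l m n i) (awayRelation l j m n i))
  have hT (e) : dehomogenize h (T e : CoordRing K) = chartVar i j l m
      (chartClass (awayRelation (K := K) j l m n i) (awayRelation l j m n i)) e := lift_T _ _ _ _
  have hc (e) : ofAway h (awayCoord K i j l e) = dehomogenize h (T e : CoordRing K) := by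
    have := ofAway_eq h (val_awayCoord_mul (K := K) i j l e)
    rwa [hT i, hi, mul_one] at this
  have key : (ofAway h).comp (toAway (K := K) h).toRingHom = RingHom.id _ := by
    refine Ideal.Quotient.ringHom_ext (MvPolynomial.ringHom_ext (fun c => ?_) fun e => ?_)
    · exact (congrArg (ofAway h) ((toAway h).commutes c)).trans (ofAway_algebraMap h c)
    · change ofAway h (toAway h (Ideal.Quotient.mk _ (X e))) = chartClass _ _ e
      rw [toAway_mk, aeval_X]
      fin_cases e
      · exact (hc m).trans ((hT m).trans hm.symm)
      · exact (hc n).trans ((hT n).trans hn.symm)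
      · exact (hc j).trans ((hT j).trans hj.symm)
      · exact (hc l).trans ((hT l).trans hl.symm)
      · change ofAway h (awayInv K i j l) = chartClass _ _ 4
        have h1 := ofAway_eq h (x := T i * T j * T l) (y := T i ^ 3)
          ((val_awayInv_mul (K := K) i j l).trans (map_pow _ _ _).symm)
        have h2 := mk_chartRelation (awayRelation (K := K) j l m n i) (awayRelation l j m n i) 2
        simp only [map_mul, map_pow, hT, hi, ← hj, ← hl, one_pow, one_mul] at h1
        have h3 : chartClass (awayRelation (K := K) j l m n i) (awayRelation l j m n i) 2 *
            chartClass _ _ 3 * chartClass _ _ 4 - 1 = 0 := h2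
        linear_combination chartClass _ _ 4 * h1 - ofAway h (awayInv K i j l) * h3
  exact DFunLike.congr_fun key x

/-- An element of the coordinate ring of the open set is a quotient of a form of degree `3 * e` by
`(T i * T j * T l) ^ e`; the variable `X 4` is mapped to the inverse of the dehomogenization of
`T i * T j * T l`. -/
theorem toAway_surjective : Function.Surjective (toAway (K := K) h) := by
  intro y
  obtain ⟨e, x, hx, rfl⟩ := Away.mk_surjective (grading K) (T_mul_mem i j l) y
  refine ⟨dehomogenize h x * chartClass _ _ 4 ^ e, ?_⟩
  obtain ⟨hi, hj, hl, hm, hn⟩ := chartVar_eq h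
    (chartClass (awayRelation (K := K) j l m n i) (awayRelation l j m n i))
  have hT (s) : toAway h (dehomogenize h (T s : CoordRing K)) = awayCoord K i j l s := by
    rw [dehomogenize, lift_T]
    have hs : s = i ∨ s = j ∨ s = l ∨ s = m ∨ s = n := by
      have : s ∈ [i, j, l, m, n].toFinset := by
        rw [Finset.eq_univ_of_card _ ((List.toFinset_card_of_nodup h).trans rfl)]
        exact Finset.mem_univ s
      simpa using this
    rcases hs with rfl | rfl | rfl | rfl | rfl
    · rw [hi, map_one, awayCoord_self]
    · rw [← hj]; exact aeval_X _ _
    · rw [← hl]; exact aeval_X _ _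
    · rw [← hm]; exact aeval_X _ _
    · rw [← hn]; exact aeval_X _ _
  have h4 : toAway h (chartClass _ _ 4) = awayInv K i j l := aeval_X _ _
  have h1 := coordRing_hom_eq_pow_mul
    (f := algebraMap (CoordRing K) (Localization.Away (T i * T j * T l : CoordRing K)))
    (g := (algebraMap (Away (grading K) (T i * T j * T l : CoordRing K)) _).comp
      ((toAway h).toRingHom.comp (dehomogenize h).toRingHom)) (t := algebraMap (CoordRing K) _
        (T i))
    (fun c => by
      change _ = (toAway h (dehomogenize h (algebraMap K _ c))).val
      rw [AlgHom.commutes, AlgHom.commutes, val_algebraMap])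
    (fun s => by
      change _ = _ * (toAway h (dehomogenize h (T s))).val
      rw [hT]
      exact ((mul_comm _ _).trans (val_awayCoord_mul i j l s)).symm) hx
  change _ = _ * (toAway h (dehomogenize h x)).val at h1
  apply val_injective
  refine ((IsLocalization.Away.algebraMap_isUnit
    (S := Localization.Away (T i * T j * T l : CoordRing K))
    (T i * T j * T l : CoordRing K)).pow e).mul_right_cancel ?_
  refine Eq.trans ?_ (val_away_mul i j l e x hx).symm
  rw [h1, map_mul, map_pow, h4, val_mul, val_pow]
  refine (mul_assoc _ _ _).trans ?_
  have h5 := congrArg (· ^ e) (val_awayInv_mul (K := K) i j l)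
  rw [smul_eq_mul, mul_comm e 3, pow_mul]
  exact (congrArg ((toAway h (dehomogenize h x)).val * ·)
    ((mul_pow _ _ _).symm.trans h5)).trans (mul_comm _ _)

include h in
theorem isStandardSmooth_away : Algebra.IsStandardSmoothOfRelativeDimension 2 K
    (Away (grading K) (T i * T j * T l : CoordRing K)) :=
  have := isStandardSmooth_chartRing (p := awayRelation (K := K) j l m n i)
    (q := awayRelation l j m n i) (sub_ne_zero.mpr (a_ne h.ne.2.1.1))
    (sub_ne_zero.mpr (a_ne h.ne.2.1.1.symm))
  .of_algEquiv 2 (AlgEquiv.ofBijective (toAway h)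
    ⟨Function.LeftInverse.injective (ofAway_toAway h), toAway_surjective h⟩)

end Equiv

end Away

variable (K) in
/-- At every point three coordinates do not vanish, so that the open sets on which three coordinates
are invertible cover the surface. -/
theorem smoothOfRelativeDimension_structureMap [CharZero K] :
    SmoothOfRelativeDimension 2 (structureMap K) := by
  have h (x : surface K) : ∃ i a b c d, Distinct i a b c d ∧
      x ∈ Proj.basicOpen (grading K) (T i * T a * T b) := by
    obtain ⟨i, a, b, c, d, hd, hi, ha, hb⟩ :=
      exists_three_notMem (I := x.asHomogeneousIdeal.toIdeal) x.isPrime (exists_T_notMem x)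
    refine ⟨i, a, b, c, d, hd, ?_⟩
    change _ ∉ x.asHomogeneousIdeal.toIdeal
    rw [x.isPrime.mul_mem_iff_mem_or_mem, x.isPrime.mul_mem_iff_mem_or_mem]
    tauto
  choose i a b c d hd hx using h
  let 𝒰 : (surface K).AffineOpenCover :=
    { I₀ := surface K
      X := fun x => .of (Away (grading K) (T (i x) * T (a x) * T (b x)))
      f := fun x => Proj.awayι (grading K) _ (T_mul_mem (i x) (a x) (b x)) (by norm_num)
      idx := id
      covers := fun x => by
        change x ∈ (Proj.awayι (grading K) _ (T_mul_mem (i x) (a x) (b x))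
          (by norm_num)).opensRange
        rw [Proj.opensRange_awayι]
        exact hx x }
  have := HasRingHomProperty.instIsZariskiLocalAtSource (P := @SmoothOfRelativeDimension.{u} 2)
    (Q := RingHom.Locally (RingHom.IsStandardSmoothOfRelativeDimension 2))
  refine IsZariskiLocalAtSource.of_openCover (P := @SmoothOfRelativeDimension.{u} 2) 𝒰.openCover
    fun x => ?_
  change SmoothOfRelativeDimension 2 (Proj.awayι (grading K) _
    (T_mul_mem (i x) (a x) (b x)) (by norm_num) ≫ structureMap K)
  rw [structureMap, Proj.awayι_toSpecZero_assoc, ← Spec.map_comp]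
  rw [HasRingHomProperty.Spec_iff (P := @SmoothOfRelativeDimension.{u} 2)]
  refine RingHom.locally_of
    (RingHom.isStandardSmoothOfRelativeDimension_respectsIso) _ ?_
  exact isStandardSmooth_away (hd x)

end

end TwoQuadrics

/-! ### The sixteen lines -/

namespace TwoQuadrics

open MvPolynomial

noncomputable section

variable {K : Type u} [Field K]

theorem eval_q₁ (v : Fin 5 → K) : eval v (q₁ K) = ∑ n, v n ^ 2 := by
  simp [q₁]

theorem eval_q₂ (v : Fin 5 → K) : eval v (q₂ K) = ∑ n, a K n * v n ^ 2 := by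
  simp [q₂, a]

theorem a_values (S : Type*) [CommRing S] :
    a S 0 = 2 ∧ a S 1 = 3 ∧ a S 2 = 5 ∧ a S 3 = 7 ∧ a S 4 = 11 := by
  refine ⟨?_, ?_, ?_, ?_, ?_⟩ <;> simp [a, coeffs]

/-- The parametrization of the line with signs `ε`: at the coordinate `n` it is the value at `a n`
of a linear polynomial, divided by `ε n * c n`. -/
def lineMap (r : Roots K) (ε : Fin 5 → ℤˣ) : K × K →ₗ[K] (Fin 5 → K) where
  toFun p n := (ε n : ℤ) * (p.1 + p.2 * a K n) / r.c n
  map_add' p q := funext fun n => by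
    simp only [Prod.fst_add, Prod.snd_add, Pi.add_apply]
    ring
  map_smul' t p := funext fun n => by
    simp only [Prod.smul_fst, Prod.smul_snd, Pi.smul_apply, smul_eq_mul, RingHom.id_apply]
    ring

/-- The line with signs `ε`, as a plane in `K⁵`. -/
def lineSpace (r : Roots K) (ε : Fin 5 → ℤˣ) : Submodule K (Fin 5 → K) :=
  LinearMap.range (lineMap r ε)

theorem lineMap_apply (r : Roots K) (ε : Fin 5 → ℤˣ) (p : K × K) (n : Fin 5) :
    lineMap r ε p n = (ε n : ℤ) * (p.1 + p.2 * a K n) / r.c n := rfl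

variable [CharZero K]

omit [CharZero K] in
theorem intUnits_cast_sq (ε : ℤˣ) : ((ε : ℤ) : K) ^ 2 = 1 := by
  rcases Int.units_eq_one_or ε with h | h <;> simp [h]

theorem lineMap_injective (r : Roots K) (ε : Fin 5 → ℤˣ) : Function.Injective (lineMap r ε) := by
  rw [← LinearMap.ker_eq_bot, LinearMap.ker_eq_bot']
  rintro ⟨u, w⟩ h
  have hn (n) : u + w * a K n = 0 := by
    have := congrFun h n
    rw [lineMap_apply, Pi.zero_apply, div_eq_zero_iff, or_iff_left (c_ne_zero r n)] at this
    linear_combination ((ε n : ℤ) : K) * this - (u + w * a K n) * intUnits_cast_sq (K := K) (ε n)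
  obtain ⟨h0, h1, -⟩ := a_values K
  have e0 := hn 0
  have e1 := hn 1
  rw [h0] at e0
  rw [h1] at e1
  refine Prod.ext ?_ ?_
  · change u = 0
    linear_combination 3 * e0 - 2 * e1
  · change w = 0
    linear_combination e1 - e0

omit [CharZero K] in
theorem lineMap_sq (r : Roots K) (ε : Fin 5 → ℤˣ) (p : K × K) (n : Fin 5) :
    lineMap r ε p n ^ 2 = (p.1 + p.2 * a K n) ^ 2 / d n := by
  rw [lineMap_apply, div_pow, mul_pow, intUnits_cast_sq, one_mul, r.sq]

/-- By Lagrange interpolation, the sums of `f (a n) / d n` and of `a n * f (a n) / d n` vanish for a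
polynomial `f` of degree at most two, such as the square of a linear polynomial. -/
theorem lineSpace_mem_lines (r : Roots K) (ε : Fin 5 → ℤˣ) : lineSpace r ε ∈ lines K := by
  refine ⟨(LinearMap.finrank_range_of_inj (lineMap_injective r ε)).trans (by simp), ?_⟩
  rintro _ ⟨p, rfl⟩
  obtain ⟨h0, h1, h2, h3, h4⟩ := a_values K
  obtain ⟨e0, e1, e2, e3, e4⟩ := d_eq
  rw [eval_q₁, eval_q₂]
  simp only [lineMap_sq, Fin.sum_univ_five, h0, h1, h2, h3, h4, e0, e1, e2, e3, e4]
  constructor <;>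
  · push_cast
    ring

/-- If `x` is orthogonal to `1` and to `a`, then `d n * x n` is the value at `a n` of a polynomial
of degree at most two, hence determined by the values for three indices. -/
theorem eq_of_orthogonal {x : Fin 5 → K} (h₁ : ∑ n, x n = 0) (h₂ : ∑ n, a K n * x n = 0) :
    d 3 * x 3 = 8 / 3 * (d 0 * x 0) - 5 * (d 1 * x 1) + 10 / 3 * (d 2 * x 2) ∧
    d 4 * x 4 = 16 * (d 0 * x 0) - 27 * (d 1 * x 1) + 12 * (d 2 * x 2) := by
  obtain ⟨h0, h1, h2, h3, h4⟩ := a_values K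
  obtain ⟨e0, e1, e2, e3, e4⟩ := d_eq
  simp only [Fin.sum_univ_five, h0, h1, h2, h3, h4] at h₁ h₂
  simp only [e0, e1, e2, e3, e4]
  push_cast
  constructor
  · linear_combination -40 * (11 * h₁ - h₂)
  · linear_combination -432 * (7 * h₁ - h₂)

/-- The bilinear forms associated with the two quadrics vanish on a plane on which the quadrics
vanish. -/
theorem isotropic_of_mem_lines {W : Submodule K (Fin 5 → K)} (hW : W ∈ lines K) {v w : Fin 5 → K}
    (hv : v ∈ W) (hw : w ∈ W) : ∑ n, v n * w n = 0 ∧ ∑ n, a K n * (v n * w n) = 0 := by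
  have h := hW.2 (v + w) (W.add_mem hv hw)
  have h1 := hW.2 v hv
  have h2 := hW.2 w hw
  simp only [eval_q₁, eval_q₂, Fin.sum_univ_five, Pi.add_apply] at h h1 h2 ⊢
  constructor
  · linear_combination (1 / 2) * (h.1 - h1.1 - h2.1)
  · linear_combination (1 / 2) * (h.2 - h1.2 - h2.2)

theorem orthogonal_mem_lines {W : Submodule K (Fin 5 → K)} (hW : W ∈ lines K) {v w : Fin 5 → K}
    (hv : v ∈ W) (hw : w ∈ W) :
    d 3 * (v 3 * w 3) = 8 / 3 * (d 0 * (v 0 * w 0)) - 5 * (d 1 * (v 1 * w 1)) +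
      10 / 3 * (d 2 * (v 2 * w 2)) ∧
    d 4 * (v 4 * w 4) = 16 * (d 0 * (v 0 * w 0)) - 27 * (d 1 * (v 1 * w 1)) +
      12 * (d 2 * (v 2 * w 2)) :=
  eq_of_orthogonal (isotropic_of_mem_lines hW hv hw).1 (isotropic_of_mem_lines hW hv hw).2

/-- A nonzero vector of a line cannot have two vanishing coordinates: the squares of its
coordinates would be given by a quadratic polynomial with two different roots, and comparing it
with the polynomial of a second vector shows that the two vectors are proportional. -/
theorem eq_zero_of_mem_lines {W : Submodule K (Fin 5 → K)} (hW : W ∈ lines K) {v : Fin 5 → K}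
    (hv : v ∈ W) (h0 : v 0 = 0) (h1 : v 1 = 0) : v = 0 := by
  have hd (n) : (d n : K) ≠ 0 := Int.cast_ne_zero.mpr (d_ne_zero n)
  have hvv := orthogonal_mem_lines hW hv hv
  simp only [h0, h1, mul_zero, sub_zero, zero_add] at hvv
  by_contra hne
  have h2 : v 2 ≠ 0 := by
    intro h2
    simp only [h2, mul_zero, mul_eq_zero, hd, false_or, or_self] at hvv
    refine hne (funext fun n => ?_)
    fin_cases n
    exacts [h0, h1, h2, hvv.1, hvv.2]
  have h3 : v 3 ≠ 0 := by
    intro h3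
    simp [h3, h2, hd] at hvv
  have h4 : v 4 ≠ 0 := by
    intro h4
    simp [h4, h2, hd] at hvv
  have key : ∀ w ∈ W, v 2 • w = w 2 • v := by
    intro w hw
    have hvw := orthogonal_mem_lines hW hv hw
    simp only [h0, h1, zero_mul, mul_zero, sub_zero, zero_add] at hvw
    have e3 : v 2 * w 3 - w 2 * v 3 = 0 := by
      refine (mul_eq_zero.mp ?_).resolve_left (mul_ne_zero (hd 3) h3)
      linear_combination v 2 * hvw.1 - w 2 * hvv.1
    have e4 : v 2 * w 4 - w 2 * v 4 = 0 := by
      refine (mul_eq_zero.mp ?_).resolve_left (mul_ne_zero (hd 4) h4)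
      linear_combination v 2 * hvw.2 - w 2 * hvv.2
    have hz := orthogonal_mem_lines hW (W.sub_mem (W.smul_mem (v 2) hw) (W.smul_mem (w 2) hv))
      (W.sub_mem (W.smul_mem (v 2) hw) (W.smul_mem (w 2) hv))
    simp only [Pi.sub_apply, Pi.smul_apply, smul_eq_mul, e3, e4, h0, h1, mul_zero, sub_zero] at hz
    have e0 : (d 0 : K) * (v 2 * w 0) ^ 2 = 0 := by
      linear_combination (27 / 8) * hz.1 - (5 / 8) * hz.2
    have e1 : (d 1 : K) * (v 2 * w 1) ^ 2 = 0 := by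
      linear_combination 2 * hz.1 - (1 / 3) * hz.2
    simp only [mul_eq_zero, pow_eq_zero_iff two_ne_zero, hd, h2, false_or] at e0 e1
    refine sub_eq_zero.mp (funext fun n => ?_)
    fin_cases n
    · change v 2 * w 0 - w 2 * v 0 = 0
      rw [e0, h0]
      ring
    · change v 2 * w 1 - w 2 * v 1 = 0
      rw [e1, h1]
      ring
    · change v 2 * w 2 - w 2 * v 2 = 0
      ring
    · exact e3
    · exact e4
  have hle : W ≤ Submodule.span K {v} := by
    intro w hw
    rw [Submodule.mem_span_singleton]
    exact ⟨(v 2)⁻¹ * w 2, by rw [mul_smul, ← key w hw, inv_smul_smul₀ h2]⟩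
  have := (Submodule.finrank_mono hle).trans (finrank_span_singleton hne).le
  rw [hW.1] at this
  omega

/-- Every line in the surface is one of the lines with signs. -/
theorem exists_eq_lineSpace (r : Roots K) {W : Submodule K (Fin 5 → K)} (hW : W ∈ lines K) :
    ∃ ε, W = lineSpace r ε := by
  obtain ⟨a0, a1, a2, a3, a4⟩ := a_values K
  obtain ⟨d0, d1, d2, d3, d4⟩ := d_eq
  let L : W →ₗ[K] K × K :=
    ((LinearMap.proj 0).prod (LinearMap.proj 1)).comp W.subtype
  have hL : Function.Injective L := by
    rw [← LinearMap.ker_eq_bot, LinearMap.ker_eq_bot']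
    rintro ⟨v, hv⟩ h
    exact Subtype.ext (eq_zero_of_mem_lines hW hv (congrArg Prod.fst h) (congrArg Prod.snd h))
  have hfin : Module.finrank K W = Module.finrank K (K × K) := by rw [hW.1]; simp
  have : FiniteDimensional K W := inferInstance
  have hs := (LinearMap.injective_iff_surjective_of_finrank_eq_finrank hfin).mp hL
  obtain ⟨⟨v, hv⟩, hv'⟩ := hs (0, 1)
  obtain ⟨⟨w, hw⟩, hw'⟩ := hs (1, 0)
  have v0 : v 0 = 0 := congrArg Prod.fst hv'
  have v1 : v 1 = 1 := congrArg Prod.snd hv'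
  have w0 : w 0 = 1 := congrArg Prod.fst hw'
  have w1 : w 1 = 0 := congrArg Prod.snd hw'
  have hE := orthogonal_mem_lines hW hv hv
  have hF := orthogonal_mem_lines hW hv hw
  have hG := orthogonal_mem_lines hW hw hw
  simp only [v0, v1, w0, w1, d0, d1, d2, d3, d4] at hE hF hG
  push_cast at hE hF hG
  obtain ⟨hE3, hE4⟩ := hE
  obtain ⟨hF3, hF4⟩ := hF
  obtain ⟨hG3, hG4⟩ := hG
  -- the relations `E 3 * G 3 = F 3 ^ 2` and `E 4 * G 4 = F 4 ^ 2` between the products of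
  -- coordinates of `v` and `w` determine `v 2 ^ 2` and `w 2 ^ 2`
  have h3 : 12 + 8 * (w 2 * w 2) + 9 * (v 2 * v 2) = 0 := by
    have : (-160 * (v 3 * v 3)) * (-160 * (w 3 * w 3)) = (-160 * (v 3 * w 3)) ^ 2 := by ring
    rw [hE3, hF3, hG3] at this
    linear_combination (1 / 9600) * this
  have h4 : 10 + 4 * (w 2 * w 2) + 5 * (v 2 * v 2) = 0 := by
    have : (1728 * (v 4 * v 4)) * (1728 * (w 4 * w 4)) = (1728 * (v 4 * w 4)) ^ 2 := by ring
    rw [hE4, hF4, hG4] at this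
    linear_combination (1 / 373248) * this
  have hv2 : v 2 * v 2 = -8 := by linear_combination 2 * h4 - h3
  have hw2 : w 2 * w 2 = 15 / 2 := by linear_combination (5 / 4) * h3 - (9 / 4) * h4
  -- up to constants, the quadratic polynomials are `(a - 2) ^ 2` and `(a - 2) * (a - 3)`
  have hvv (n) : d n * (v n * v n) = -64 * (a K n - 2) ^ 2 := by
    fin_cases n
    · change (d 0 : K) * (v 0 * v 0) = -64 * (a K 0 - 2) ^ 2
      rw [v0, a0]; ring
    · change (d 1 : K) * (v 1 * v 1) = -64 * (a K 1 - 2) ^ 2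
      rw [v1, a1, d1]; push_cast; ring
    · change (d 2 : K) * (v 2 * v 2) = -64 * (a K 2 - 2) ^ 2
      rw [hv2, a2, d2]; push_cast; ring
    · change (d 3 : K) * (v 3 * v 3) = -64 * (a K 3 - 2) ^ 2
      rw [a3, d3]; push_cast; linear_combination hE3 + 240 * hv2
    · change (d 4 : K) * (v 4 * v 4) = -64 * (a K 4 - 2) ^ 2
      rw [a4, d4]; push_cast; linear_combination hE4 + 864 * hv2
  have hvw (n) : d n * (v n * w n) = 12 * (v 2 * w 2) * ((a K n - 2) * (a K n - 3)) := by
    fin_cases n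
    · change (d 0 : K) * (v 0 * w 0) = 12 * (v 2 * w 2) * ((a K 0 - 2) * (a K 0 - 3))
      rw [v0, a0]; ring
    · change (d 1 : K) * (v 1 * w 1) = 12 * (v 2 * w 2) * ((a K 1 - 2) * (a K 1 - 3))
      rw [w1, a1]; ring
    · change (d 2 : K) * (v 2 * w 2) = 12 * (v 2 * w 2) * ((a K 2 - 2) * (a K 2 - 3))
      rw [a2, d2]; push_cast; ring
    · change (d 3 : K) * (v 3 * w 3) = 12 * (v 2 * w 2) * ((a K 3 - 2) * (a K 3 - 3))
      rw [a3, d3]; push_cast; linear_combination hF3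
    · change (d 4 : K) * (v 4 * w 4) = 12 * (v 2 * w 2) * ((a K 4 - 2) * (a K 4 - 3))
      rw [a4, d4]; push_cast; linear_combination hF4
  have hc1 := c_ne_zero r 1
  have hs1 : r.c 1 ^ 2 = -64 := by rw [r.sq, d1]; norm_num
  obtain ⟨g, hg⟩ : ∃ g, g * r.c 1 = 12 * (v 2 * w 2) := ⟨_, div_mul_cancel₀ _ hc1⟩
  have hg2 : g ^ 2 = 135 := by
    refine mul_right_cancel₀ (pow_ne_zero 2 hc1) ?_
    rw [← mul_pow, hg, hs1]
    linear_combination 144 * (w 2 * w 2) * hv2 - 1152 * hw2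
  have key (n) : ∃ ε : ℤˣ, r.c n * v n = (ε : ℤ) * (r.c 1 * (a K n - 2)) ∧
      r.c n * w n = (ε : ℤ) * (g * (a K n - 3)) := by
    by_cases hn : n = 0
    · subst hn
      have h0 : (r.c 0 * w 0) ^ 2 = (g * (a K 0 - 3)) ^ 2 := by
        rw [w0, a0, mul_pow, mul_pow, r.sq, hg2, d0]
        norm_num
      rcases sq_eq_sq_iff_eq_or_eq_neg.mp h0 with h | h
      · exact ⟨1, by rw [v0, a0]; simp, by rw [h]; simp⟩
      · exact ⟨-1, by rw [v0, a0]; simp, by rw [h]; simp⟩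
    · have hne : r.c 1 * (a K n - 2) ≠ 0 :=
        mul_ne_zero hc1 (sub_ne_zero.mpr (a0 ▸ a_ne hn))
      have h0 : (r.c n * v n) ^ 2 = (r.c 1 * (a K n - 2)) ^ 2 := by
        linear_combination v n ^ 2 * r.sq n + hvv n - (a K n - 2) ^ 2 * hs1
      have h1 : (r.c n * v n) * (r.c n * w n) = (r.c 1 * (a K n - 2)) * (g * (a K n - 3)) := by
        linear_combination v n * w n * r.sq n + hvw n - (a K n - 2) * (a K n - 3) * hg
      rcases sq_eq_sq_iff_eq_or_eq_neg.mp h0 with h | h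
      · refine ⟨1, by rw [h]; simp, ?_⟩
        rw [h] at h1
        rw [mul_left_cancel₀ hne h1]
        simp
      · refine ⟨-1, by rw [h]; simp, ?_⟩
        rw [h, neg_mul, ← mul_neg] at h1
        rw [← neg_eq_iff_eq_neg.mpr (mul_left_cancel₀ hne h1).symm]
        simp
  choose ε hεv hεw using key
  have hvm : v = lineMap r ε (-2 * r.c 1, r.c 1) := funext fun n => by
    rw [lineMap_apply, eq_div_iff (c_ne_zero r n), mul_comm, hεv]
    ring
  have hwm : w = lineMap r ε (-3 * g, g) := funext fun n => by
    rw [lineMap_apply, eq_div_iff (c_ne_zero r n), mul_comm, hεw]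
    ring
  refine ⟨ε, Submodule.eq_of_le_of_finrank_eq (fun x hx => ?_)
    (hW.1.trans (lineSpace_mem_lines r ε).1.symm)⟩
  have hx0 := eq_zero_of_mem_lines hW
    (W.sub_mem (W.sub_mem hx (W.smul_mem (x 1) hv)) (W.smul_mem (x 0) hw))
    (by simp [v0, w0]) (by simp [v1, w1])
  rw [sub_sub, sub_eq_zero] at hx0
  rw [hx0]
  exact Submodule.add_mem _ (Submodule.smul_mem _ _ ⟨_, hvm.symm⟩)
    (Submodule.smul_mem _ _ ⟨_, hwm.symm⟩)

theorem lineSpace_neg (r : Roots K) (ε : Fin 5 → ℤˣ) : lineSpace r (-ε) = lineSpace r ε := by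
  have h (ε : Fin 5 → ℤˣ) : lineSpace r (-ε) ≤ lineSpace r ε := by
    rintro _ ⟨p, rfl⟩
    refine ⟨-p, funext fun n => ?_⟩
    simp only [lineMap_apply, Pi.neg_apply, Units.val_neg, Int.cast_neg, Prod.fst_neg, Prod.snd_neg]
    ring
  exact le_antisymm (h ε) (by simpa using h (-ε))

theorem prod_neg_units (ε : Fin 5 → ℤˣ) : ∏ n, (-ε) n = -∏ n, ε n := by
  simp [Fin.prod_univ_five]

/-- A line determines its signs, if their product is required to be `1`. -/
theorem lineSpace_injective (r : Roots K) {ε ε' : Fin 5 → ℤˣ} (hε : ∏ n, ε n = 1)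
    (hε' : ∏ n, ε' n = 1) (h : lineSpace r ε = lineSpace r ε') : ε = ε' := by
  have hm : lineMap r ε (1, 0) ∈ lineSpace r ε' := h ▸ ⟨_, rfl⟩
  obtain ⟨⟨u, w⟩, hp⟩ := hm
  have hn (n) : u + w * a K n = ((ε n : ℤ) : K) * (ε' n : ℤ) := by
    have := congrFun hp n
    rw [lineMap_apply, lineMap_apply, div_left_inj' (c_ne_zero r n)] at this
    linear_combination ((ε' n : ℤ) : K) * this -
      (u + w * a K n) * intUnits_cast_sq (K := K) (ε' n)
  have hsq (n) : (u + w * a K n) ^ 2 = 1 := by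
    rw [hn, mul_pow, intUnits_cast_sq, intUnits_cast_sq, one_mul]
  obtain ⟨a0, a1, a2, -, -⟩ := a_values K
  have h0 := hsq 0
  have h1 := hsq 1
  have h2 := hsq 2
  rw [a0] at h0
  rw [a1] at h1
  rw [a2] at h2
  have hw : w = 0 := by
    refine pow_eq_zero_iff two_ne_zero |>.mp ?_
    linear_combination (1 / 3) * h0 - (1 / 2) * h1 + (1 / 6) * h2
  subst hw
  rw [zero_mul, add_zero] at h0
  rcases sq_eq_one_iff.mp h0 with rfl | rfl
  · refine funext fun n => ?_
    have h := hn n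
    rw [zero_mul, add_zero] at h
    rcases Int.units_eq_one_or (ε n) with h1 | h1 <;>
      rcases Int.units_eq_one_or (ε' n) with h2 | h2 <;>
      simp only [h1, h2] at h ⊢ <;> norm_num at h
  · have hneg : ε = -ε' := by
      refine funext fun n => ?_
      have h := hn n
      rw [zero_mul, add_zero] at h
      rcases Int.units_eq_one_or (ε n) with h1 | h1 <;>
        rcases Int.units_eq_one_or (ε' n) with h2 | h2 <;>
        simp only [h1, h2, Pi.neg_apply, neg_neg] at h ⊢ <;> norm_num at h
    rw [hneg, prod_neg_units, hε'] at hε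
    exact absurd hε (by decide)

/-- Every line is given by signs with product `1`, as changing all signs changes the product. -/
theorem exists_eq_lineSpace_of_prod (r : Roots K) {W : Submodule K (Fin 5 → K)} (hW : W ∈ lines K) :
    ∃ ε, ∏ n, ε n = 1 ∧ W = lineSpace r ε := by
  obtain ⟨ε, rfl⟩ := exists_eq_lineSpace r hW
  rcases Int.units_eq_one_or (∏ n, ε n) with h | h
  · exact ⟨ε, h, rfl⟩
  · exact ⟨-ε, by rw [prod_neg_units, h, neg_neg], (lineSpace_neg r ε).symm⟩

theorem prod_cons_prod (s : Fin 4 → ℤˣ) :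
    ∏ n, (Fin.cons (∏ n, s n) s : Fin 5 → ℤˣ) n = 1 := by
  rw [Fin.prod_univ_succ]
  simp only [Fin.cons_zero, Fin.cons_succ]
  exact Int.units_mul_self _

theorem ncard_lines (r : Roots K) : (lines K).ncard = 16 := by
  have h : lines K = Set.range fun s : Fin 4 → ℤˣ =>
      lineSpace r (Fin.cons (∏ n, s n) s : Fin 5 → ℤˣ) := by
    ext W
    constructor
    · intro hW
      obtain ⟨ε, hε, rfl⟩ := exists_eq_lineSpace_of_prod r hW
      refine ⟨Fin.tail ε, ?_⟩
      have h0 : ∏ n, Fin.tail ε n = ε 0 := by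
        rw [Fin.prod_univ_succ] at hε
        rw [← Int.units_inv_eq_self (ε 0)]
        exact (inv_eq_of_mul_eq_one_right hε).symm
      change lineSpace r (Fin.cons _ _) = _
      rw [h0, Fin.cons_self_tail]
    · rintro ⟨s, rfl⟩
      exact lineSpace_mem_lines r _
  rw [h, Set.ncard_range_of_injective]
  · simp [Nat.card_eq_fintype_card]
  · intro s t hst
    exact (Fin.cons_injective2 (lineSpace_injective r (prod_cons_prod s) (prod_cons_prod t) hst)).2

omit [CharZero K] in
/-- A field automorphism multiplying the square roots by signs maps lines to lines. -/
theorem image_lineSpace (r : Roots K) (ε s : Fin 5 → ℤˣ) (σ : K ≃+* K)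
    (hσ : ∀ n, σ (r.c n) = (s n : ℤ) * r.c n) :
    (fun (v : Fin 5 → K) n => σ (v n)) '' (lineSpace r ε : Set (Fin 5 → K)) =
      lineSpace r (s * ε) := by
  have key (p : K × K) : (fun n => σ (lineMap r ε p n)) = lineMap r (s * ε) (σ p.1, σ p.2) := by
    refine funext fun n => ?_
    have ha : σ (a K n) = a K n := map_natCast σ _
    simp only [lineMap_apply, map_div₀, map_mul, map_add, map_intCast, ha, hσ, Pi.mul_apply,
      Units.val_mul, Int.cast_mul]
    rcases Int.units_eq_one_or (s n) with h | h <;> simp [h, div_neg, neg_div]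
  ext x
  constructor
  · rintro ⟨_, ⟨p, rfl⟩, rfl⟩
    exact ⟨_, (key p).symm⟩
  · rintro ⟨p, rfl⟩
    exact ⟨_, ⟨(σ.symm p.1, σ.symm p.2), rfl⟩, by simp [key]⟩

/-- The group of signs with product `1` acts transitively on the lines. -/
theorem exists_image_eq (r : Roots K) {S : Set (K ≃+* K)}
    (hS : ∀ s : Fin 5 → ℤˣ, ∏ n, s n = 1 → ∃ σ ∈ S, ∀ n, σ (r.c n) = (s n : ℤ) * r.c n)
    {W W' : Submodule K (Fin 5 → K)} (hW : W ∈ lines K) (hW' : W' ∈ lines K) :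
    ∃ σ ∈ S, (W' : Set (Fin 5 → K)) = (fun v i => σ (v i)) '' (W : Set (Fin 5 → K)) := by
  obtain ⟨ε, hε, rfl⟩ := exists_eq_lineSpace_of_prod r hW
  obtain ⟨ε', hε', rfl⟩ := exists_eq_lineSpace_of_prod r hW'
  obtain ⟨σ, hσ, h⟩ := hS (ε' * ε) (by
    simp only [Pi.mul_apply, Finset.prod_mul_distrib, hε, hε', one_mul])
  refine ⟨σ, hσ, ?_⟩
  rw [image_lineSpace r ε _ σ h, mul_assoc,
    show ε * ε = 1 from funext fun n => Int.units_mul_self _, mul_one]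

end

end TwoQuadrics

/-! ### The action of the Galois group on the square roots -/

namespace TwoQuadrics

noncomputable section

variable {k kbar : Type u} [Field k] [CharZero k] [Field kbar] [Algebra k kbar]

/-- If the square roots of `-1`, `2`, `3`, `5` generate an extension of degree `16`, its sixteen
embeddings realize all sign patterns. -/
theorem exists_algEquiv_of_signs [IsAlgClosure k kbar]
    (hk : Module.finrank k (IntermediateField.adjoin k
      {x : kbar | x ^ 2 = -1 ∨ x ^ 2 = 2 ∨ x ^ 2 = 3 ∨ x ^ 2 = 5}) = 16)
    {α : Fin 4 → kbar} (hα : ∀ j, α j ^ 2 = (![-1, 2, 3, 5] j : ℤ)) (s : Fin 4 → ℤˣ) :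
    ∃ σ : kbar ≃ₐ[k] kbar, ∀ j, σ (α j) = (s j : ℤ) * α j := by
  have : IsAlgClosed kbar := IsAlgClosure.isAlgClosed k
  have : Algebra.IsAlgebraic k kbar := IsAlgClosure.isAlgebraic
  have : CharZero kbar := charZero_of_injective_algebraMap (algebraMap k kbar).injective
  set L := IntermediateField.adjoin k
      {x : kbar | x ^ 2 = -1 ∨ x ^ 2 = 2 ∨ x ^ 2 = 3 ∨ x ^ 2 = 5} with hL
  have : FiniteDimensional k L := Module.finite_of_finrank_pos (by rw [hk]; norm_num)
  have hα0 (j) : α j ≠ 0 := by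
    intro h
    have := hα j
    rw [h, zero_pow two_ne_zero] at this
    revert this
    fin_cases j <;> norm_num
  have hαL (j) : α j ∈ L := by
    refine IntermediateField.subset_adjoin _ _ ?_
    have := hα j
    fin_cases j
    · exact Or.inl (by simpa using this)
    · exact Or.inr (Or.inl (by simpa using this))
    · exact Or.inr (Or.inr (Or.inl (by simpa using this)))
    · exact Or.inr (Or.inr (Or.inr (by simpa using this)))
  have hgen (x : kbar) (hx : x ^ 2 = -1 ∨ x ^ 2 = 2 ∨ x ^ 2 = 3 ∨ x ^ 2 = 5) :
      ∃ j, x = α j ∨ x = -α j := by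
    have key (j : Fin 4) (h : x ^ 2 = (![-1, 2, 3, 5] j : ℤ)) : ∃ j, x = α j ∨ x = -α j :=
      ⟨j, sq_eq_sq_iff_eq_or_eq_neg.mp (h.trans (hα j).symm)⟩
    rcases hx with h | h | h | h
    · exact key 0 (by simpa using h)
    · exact key 1 (by simpa using h)
    · exact key 2 (by simpa using h)
    · exact key 3 (by simpa using h)
  -- an embedding multiplies the four square roots by signs, which determine it
  have hsign (τ : L →ₐ[k] kbar) (j) : ∃ e : ℤˣ, τ ⟨α j, hαL j⟩ = (e : ℤ) * α j := by
    have h1 : τ ⟨α j, hαL j⟩ ^ 2 = α j ^ 2 := by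
      rw [← map_pow, hα]
      have : (⟨α j, hαL j⟩ : L) ^ 2 = ((![-1, 2, 3, 5] j : ℤ) : L) := Subtype.ext (by
        push_cast
        exact hα j)
      rw [this, map_intCast]
    rcases sq_eq_sq_iff_eq_or_eq_neg.mp h1 with h | h
    · exact ⟨1, by simpa using h⟩
    · exact ⟨-1, by simpa using h⟩
  choose sgn hsgn using hsign
  have hinj : Function.Injective sgn := by
    intro τ τ' h
    have hj (j) : τ ⟨α j, hαL j⟩ = τ' ⟨α j, hαL j⟩ := by rw [hsgn, hsgn, h]
    refine IntermediateField.adjoin_algHom_ext k fun x hx => ?_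
    obtain ⟨j, hx' | hx'⟩ := hgen x hx
    · subst hx'
      exact hj j
    · have : (⟨x, IntermediateField.subset_adjoin k _ hx⟩ : L) = -⟨α j, hαL j⟩ := Subtype.ext hx'
      rw [this, map_neg, map_neg, hj]
  -- there are sixteen embeddings and sixteen sign patterns
  have hbij : Function.Bijective sgn := by
    rw [Fintype.bijective_iff_injective_and_card]
    refine ⟨hinj, ?_⟩
    rw [AlgHom.card, hk]
    simp
  obtain ⟨τ, hτ⟩ := hbij.2 s
  obtain ⟨σ, hσ⟩ := IsAlgClosed.surjective_domRestrict_of_isAlgebraic (K := k) (L := L) (M := kbar)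
    (E := kbar) τ
  refine ⟨AlgEquiv.ofBijective σ (Algebra.IsAlgebraic.algHom_bijective σ), fun j => ?_⟩
  have := hsgn τ j
  rw [hτ, ← hσ] at this
  exact this

/-- Square roots of the numbers `d n`, in terms of square roots of `-1`, `2`, `3`, `5`. -/
def rootsOfSqrt (α : Fin 4 → kbar) (hα : ∀ j, α j ^ 2 = (![-1, 2, 3, 5] j : ℤ)) :
    Roots kbar where
  c := ![3 * (α 2 * α 3), 8 * α 0, 6 * α 1, 4 * (α 0 * α 1 * α 3), 24 * α 2]
  sq n := by
    have h0 : α 0 ^ 2 = -1 := by simpa using hα 0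
    have h1 : α 1 ^ 2 = 2 := by simpa using hα 1
    have h2 : α 2 ^ 2 = 3 := by simpa using hα 2
    have h3 : α 3 ^ 2 = 5 := by simpa using hα 3
    fin_cases n <;> simp [d, mul_pow, h0, h1, h2, h3] <;> norm_num

/-- The numbers `c n` are monomials in the square roots of `-1`, `2`, `3`, `5`, and their product is
rational: the sign patterns with product `1` are exactly those realized by the sign patterns on
these four square roots. -/
theorem exists_roots_signs [IsAlgClosure k kbar]
    (hk : Module.finrank k (IntermediateField.adjoin k
      {x : kbar | x ^ 2 = -1 ∨ x ^ 2 = 2 ∨ x ^ 2 = 3 ∨ x ^ 2 = 5}) = 16) :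
    ∃ r : Roots kbar, ∀ s : Fin 5 → ℤˣ, ∏ n, s n = 1 →
      ∃ σ : kbar ≃ₐ[k] kbar, ∀ n, σ (r.c n) = (s n : ℤ) * r.c n := by
  have : IsAlgClosed kbar := IsAlgClosure.isAlgClosed k
  have : CharZero kbar := charZero_of_injective_algebraMap (algebraMap k kbar).injective
  choose α hα using fun j : Fin 4 =>
    IsAlgClosed.exists_pow_nat_eq ((![-1, 2, 3, 5] j : ℤ) : kbar) two_pos
  refine ⟨rootsOfSqrt α hα, fun s hs => ?_⟩
  obtain ⟨σ, hσ⟩ := exists_algEquiv_of_signs hk hα ![s 1, s 2, s 4, s 0 * s 4]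
  have h3 : s 3 = s 0 * s 1 * s 2 * s 4 := by
    rw [Fin.prod_univ_five] at hs
    have key : ∀ a b c d e : ℤˣ, a * b * c * d * e = 1 → d = a * b * c * e := by decide
    exact key _ _ _ _ _ hs
  refine ⟨σ, fun n => ?_⟩
  have e4 : ((s 4 : ℤ) : kbar) ^ 2 = 1 := intUnits_cast_sq _
  have hσ0 : σ (α 0) = (s 1 : ℤ) * α 0 := hσ 0
  have hσ1 : σ (α 1) = (s 2 : ℤ) * α 1 := hσ 1
  have hσ2 : σ (α 2) = (s 4 : ℤ) * α 2 := hσ 2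
  have hσ3 : σ (α 3) = (s 0 : ℤ) * (s 4 : ℤ) * α 3 := by
    simpa using hσ 3
  fin_cases n
  · change σ (3 * (α 2 * α 3)) = (s 0 : ℤ) * (3 * (α 2 * α 3))
    rw [map_mul, map_mul, map_ofNat, hσ2, hσ3]
    linear_combination 3 * (s 0 : ℤ) * α 2 * α 3 * e4
  · change σ (8 * α 0) = (s 1 : ℤ) * (8 * α 0)
    rw [map_mul, map_ofNat, hσ0]
    ring
  · change σ (6 * α 1) = (s 2 : ℤ) * (6 * α 1)
    rw [map_mul, map_ofNat, hσ1]
    ring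
  · change σ (4 * (α 0 * α 1 * α 3)) = (s 3 : ℤ) * (4 * (α 0 * α 1 * α 3))
    rw [map_mul, map_mul, map_mul, map_ofNat, hσ0, hσ1, hσ3, h3]
    push_cast
    ring
  · change σ (24 * α 2) = (s 4 : ℤ) * (24 * α 2)
    rw [map_mul, map_ofNat, hσ2]
    ring

end

end TwoQuadrics

theorem mainTheorem9 (k : Type u) [Field k] [CharZero k]
    (kbar : Type u) [Field kbar] [Algebra k kbar] [IsAlgClosure k kbar]
    (hk : Module.finrank k (IntermediateField.adjoin k
      {x : kbar | x ^ 2 = -1 ∨ x ^ 2 = 2 ∨ x ^ 2 = 3 ∨ x ^ 2 = 5}) = 16) :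
    SmoothOfRelativeDimension 2 (TwoQuadrics.structureMap k) ∧
    ((TwoQuadrics.lines kbar).ncard = 16 ∧
      ∀ W ∈ TwoQuadrics.lines kbar, ∀ W' ∈ TwoQuadrics.lines kbar, ∃ σ : kbar ≃ₐ[k] kbar,
        (W' : Set (Fin 5 → kbar)) = (fun v i => σ (v i)) '' (W : Set (Fin 5 → kbar))) ∧
    ∃ _ : IsIntegral (TwoQuadrics.surface kbar),
      (∃! κ : (TwoQuadrics.surface kbar).PicardGroup,
        Scheme.IsCanonicalClass (TwoQuadrics.structureMap kbar) 2 κ) ∧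
      ∀ κ : (TwoQuadrics.surface kbar).PicardGroup,
        Scheme.IsCanonicalClass (TwoQuadrics.structureMap kbar) 2 κ →
        ∀ p : (TwoQuadrics.surface kbar).PicardGroup,
          (∀ σ : kbar ≃ₐ[k] kbar,
            Scheme.picardPullback (TwoQuadrics.fieldAut σ.toRingEquiv) p = p) ↔
          p ∈ Subgroup.zpowers κ := by
  have : IsAlgClosed kbar := IsAlgClosure.isAlgClosed k
  have : CharZero kbar := charZero_of_injective_algebraMap (algebraMap k kbar).injective
  obtain ⟨r, hr⟩ := TwoQuadrics.exists_roots_signs hk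
  have hS (s : Fin 5 → ℤˣ) (hs : ∏ n, s n = 1) :
      ∃ σ ∈ Set.range fun σ : kbar ≃ₐ[k] kbar => σ.toRingEquiv,
        ∀ n, σ (r.c n) = (s n : ℤ) * r.c n := by
    obtain ⟨σ, hσ⟩ := hr s hs
    exact ⟨_, ⟨σ, rfl⟩, hσ⟩
  refine ⟨TwoQuadrics.smoothOfRelativeDimension_structureMap k,
    ⟨TwoQuadrics.ncard_lines r, fun W hW W' hW' => ?_⟩,
    Proj.isIntegral_of_irrelevant_ne_bot (TwoQuadrics.grading kbar)
      (TwoQuadrics.chart r 1).irrelevant_ne_bot,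
    ?_⟩
  · obtain ⟨_, ⟨σ, rfl⟩, hσ⟩ := TwoQuadrics.exists_image_eq r hS hW hW'
    exact ⟨σ, hσ⟩
  · have := Proj.isIntegral_of_irrelevant_ne_bot (TwoQuadrics.grading kbar)
      (TwoQuadrics.chart r 1).irrelevant_ne_bot
    refine ⟨TwoQuadrics.existsUnique_isCanonicalClass r, fun κ hκ p => ?_⟩
    rw [← TwoQuadrics.invariant_iff_mem_zpowers r hS hκ p, Set.forall_mem_range]
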